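/- Let $\mathbb K\in\{\mathbb R,\mathbb C\}$ and let $\mathcal A$ be a complete Hausdorff locally $m$-convex algebra over $\mathbb K$, that is, an associative (not necessarily unital or commutative) topological $\mathbb K$-algebra whose topology is generated by a family $\mathfrak P$ of seminorms with $\mathfrak p(ab)\le\mathfrak p(a)\mathfrak p(b)$ for all $a,b\in\mathcal A$, $\mathfrak p\in\mathfrak P$. Assume that the multiplication of $\mathcal A$ is not identically zero (automatic if $\mathcal A$ is unital and $\mathcal A\ne 0$). Let $d\ge 1$, let $\mathfrak s\in[1,\infty)^d$ be a scaling, and put $|\mathfrak s|=\sum_i\mathfrak s_i$, $|x|_{\mathfrak s}=\sum_i|x_i|^{1/\mathfrak s_i}$ for $x\in\mathbb R^d$, and $\lambda^{-\mathfrak s}x=(\lambda^{-\mathfrak s_1}x_1,\dots,\lambda^{-\mathfrak s_d}x_d)$; the scaled degree of the monomial $X^k$, $k\in\mathbb N^d$, is $\sum_i\mathfrak s_ik_i$, and the scaled degree of a polynomial is the largest scaled degree of its monomials. For $r\in\mathbb N$ let $\mathcal B^r$ be the set of $\eta\in\mathscr D(\mathbb R^d)$ (smooth, compactly supported, $\mathbb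 K$-valued) with $\operatorname{supp}\eta\subset\{|x|_{\mathfrak s}<1\}$ and $\|\eta\|_{\mathscr C^r}\le 1$, and for $\alpha\in\mathbb R$ let $\mathcal B^{r,\alpha}$ be the set of $\eta\in\mathcal B^r$ with $\int\eta P=0$ for all polynomials $P$ of scaled degree at most $\alpha$ (no condition if $\alpha<0$). Write $\mathcal S^\lambda_{x}\eta(y)=\lambda^{-|\mathfrak s|}\eta(\lambda^{-\mathfrak s}(y-x))$. For $\alpha\in\mathbb R$ let $r$ be the smallest natural number (possibly $0$) with $r+\alpha>0$; for an $\mathcal A$-valued distribution $\xi$, that is, a continuous linear map $\xi:\mathscr D(\mathbb R^d)\to\mathcal A$, for compact $K\subset\mathbb R^d$ and $\mathfrak p\in\mathfrak P$, set $$\|\xi\|_{\alpha;K,\mathfrak p}=\sup_{x\in K}\ \sup_{\eta\in\mathcal B^{r,\alpha}}\ \sup_{\lambda\in(0,1]}\lambda^{-\alpha}\,\mathfrak p\big(\xi(\mathcal S^\lambda_{x}\eta)\big)+\sup_{x\in K}\ \sup_{\eta\in\mathcal B^{r}}\mathfrak p\big(\xi(\mathcal S^1_{x}\eta)\big).$$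 Let $\mathcal C^\alpha_{\mathfrak s}(\mathbb R^d;\mathcal A)$ be the closure, with respect to these seminorms, of the space $\mathscr D(\mathbb R^d;\mathcal A)$ of smooth compactly supported functions $\mathbb R^d\to\mathcal A$ in the space of $\mathcal A$-valued distributions, endowed with the topology of the seminorms $\|\cdot\|_{\alpha;K,\mathfrak p}$. A continuous function $f:\mathbb R^d\to\mathcal A$ is identified with the distribution $\varphi\mapsto\int\varphi(x)f(x)\,dx$ (weak integral). **Theorem (Young multiplication).** Let $\alpha,\beta\in\mathbb R$. There exists a (jointly) continuous bilinear map $$B:\ \mathcal C^\alpha_{\mathfrak s}(\mathbb R^d;\mathcal A)\times\mathcal C^\beta_{\mathfrak s}(\mathbb R^d;\mathcal A)\to\mathcal C^{\alpha\wedge\beta}_{\mathfrak s}(\mathbb R^d;\mathcal A)$$ extending pointwise multiplication, i.e. with $B(f,g)=fg$ for all continuous functions $f\in\mathcal C^\alpha_{\mathfrak s}(\mathbb R^d;\mathcal A)$ and $g\in\mathcal C^\beta_{\mathfrak s}(\mathbb R^d;\mathcal A)$, if and only if $\alpha+\beta>0$. The same equivalence holds if $B(f,g)=fg$ is required only for $f,g\in\mathscr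 D(\mathbb R^d;\mathcal A)$. -/

import Mathlib

open Set Filter Topology TopologicalSpace MeasureTheory
open scoped ENNReal Distributions

noncomputable section

set_option linter.unusedSectionVars false

namespace VecHolder

variable {d : ℕ} {𝕂 : Type*} [RCLike 𝕂]

/-- The scaled "norm" `|x|_𝔰 = ∑ i, |x_i| ^ (1 / 𝔰_i)` on `ℝ^d`. -/
def scaledNorm (s : Fin d → ℝ) (x : EuclideanSpace ℝ (Fin d)) : ℝ :=
  ∑ i, |x i| ^ (1 / s i)

/-- The scaled degree `|k|_𝔰 = ∑ i, 𝔰_i k_i` of a monomial with exponent `k`. -/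
def scaledDegree (s : Fin d → ℝ) (k : Fin d →₀ ℕ) : ℝ :=
  ∑ i, s i * (k i : ℝ)

/-- The map `y ↦ l ^ (-𝔰) (y - x)`. -/
def recentre (s : Fin d → ℝ) (l : ℝ) (x y : EuclideanSpace ℝ (Fin d)) :
    EuclideanSpace ℝ (Fin d) :=
  WithLp.toLp 2 fun i => l ^ (-s i) * (y i - x i)

/-- For `l > 0` the map `recentre s l x` is a homeomorphism of `ℝ^d`. -/
def recentreHomeo (s : Fin d → ℝ) {l : ℝ} (hl : 0 < l) (x : EuclideanSpace ℝ (Fin d)) :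
    EuclideanSpace ℝ (Fin d) ≃ₜ EuclideanSpace ℝ (Fin d) where
  toFun := recentre s l x
  invFun z := WithLp.toLp 2 fun i => l ^ (s i) * z i + x i
  left_inv y := by
    ext i
    have h : l ^ (s i) * l ^ (-s i) = 1 := by
      rw [← Real.rpow_add hl]; simp
    simp only [recentre]
    rw [← mul_assoc, h]; ring
  right_inv z := by
    ext i
    have h : l ^ (-s i) * l ^ (s i) = 1 := by
      rw [← Real.rpow_add hl]; simp
    simp only [recentre]
    rw [add_sub_cancel_right, ← mul_assoc, h, one_mul]
  continuous_toFun := by unfold recentre; fun_prop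
  continuous_invFun := by fun_prop

theorem contDiff_recentre (s : Fin d → ℝ) (l : ℝ) (x : EuclideanSpace ℝ (Fin d)) :
    ContDiff ℝ ((⊤ : ℕ∞) : WithTop ℕ∞) (recentre s l x) := by
  rw [contDiff_euclidean]
  intro i
  simp only [recentre]
  fun_prop

/-- The recentred and rescaled test function
`(𝒮^l_{𝔰,x} η)(y) = l ^ (-|𝔰|) η (l ^ (-𝔰) (y - x))`, for `0 < l ≤ 1`, where `|𝔰| = ∑ i, 𝔰_i`. -/
def rescale (s : Fin d → ℝ) (l : Ioc (0 : ℝ) 1) (x : EuclideanSpace ℝ (Fin d))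
    (η : 𝓓((⊤ : Opens (EuclideanSpace ℝ (Fin d))), 𝕂)) :
    𝓓((⊤ : Opens (EuclideanSpace ℝ (Fin d))), 𝕂) where
  toFun y := (((l : ℝ) ^ (-∑ i, s i) : ℝ) : 𝕂) * η (recentre s l x y)
  contDiff' := contDiff_const.mul (η.contDiff.comp (contDiff_recentre s l x))
  hasCompactSupport' :=
    (η.hasCompactSupport.comp_homeomorph (recentreHomeo s l.2.1 x)).mul_left
  tsupport_subset' := fun _ _ => trivial

/-- The set `ℬ^r_{𝔰,0}` of smooth test functions `η` supported in the open unit ball of `|·|_𝔰`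
around `0` with `C^r` norm at most `1`. -/
def testBall (𝕂 : Type*) [RCLike 𝕂] (s : Fin d → ℝ) (r : ℕ) :
    Set 𝓓((⊤ : Opens (EuclideanSpace ℝ (Fin d))), 𝕂) :=
  {η | tsupport η ⊆ {y | scaledNorm s y < 1} ∧
    ∀ j ≤ r, ∀ y, ‖iteratedFDeriv ℝ j η y‖ ≤ 1}

/-- The set `ℬ^{r,α}_{𝔰,0}` of those `η ∈ ℬ^r_{𝔰,0}` that annihilate all polynomials of scaled
degree at most `α`. For `α < 0` there is no condition besides `η ∈ ℬ^r_{𝔰,0}`. -/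
def testBallVanishing (𝕂 : Type*) [RCLike 𝕂] (s : Fin d → ℝ) (r : ℕ) (α : ℝ) :
    Set 𝓓((⊤ : Opens (EuclideanSpace ℝ (Fin d))), 𝕂) :=
  {η | η ∈ testBall 𝕂 s r ∧
    ∀ P : MvPolynomial (Fin d) 𝕂, (∀ k ∈ P.support, scaledDegree s k ≤ α) →
      ∫ y : EuclideanSpace ℝ (Fin d), η y * MvPolynomial.eval (fun i => ((y i : ℝ) : 𝕂)) P = 0}

/-- The smallest natural number `r` with `r + α > 0`. -/
def testOrder (α : ℝ) : ℕ := sInf {r : ℕ | 0 < (r : ℝ) + α}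

variable {E : Type*} [AddCommGroup E] [Module 𝕂 E] [TopologicalSpace E]

/-- `f : ℝ^d → E` is of class `C^n`: all iterated partial derivatives of order at most `n` exist
(as limits of difference quotients in `E`) and are continuous. -/
def IsCk (𝕂 : Type*) [RCLike 𝕂] {E : Type*} [AddCommGroup E] [Module 𝕂 E] [TopologicalSpace E] :
    ℕ → (EuclideanSpace ℝ (Fin d) → E) → Prop
  | 0, f => Continuous f
  | n + 1, f => Continuous f ∧ ∃ g : Fin d → EuclideanSpace ℝ (Fin d) → E,
      (∀ i x, Tendsto
        (fun t : ℝ => ((t⁻¹ : ℝ) : 𝕂) • (f (x + t • EuclideanSpace.single i (1 : ℝ)) - f x))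
        (𝓝[≠] 0) (𝓝 (g i x))) ∧
      ∀ i, IsCk 𝕂 n (g i)

/-- `f` is an `E`-valued test function: smooth with compact support, that is `f ∈ 𝒟(ℝ^d; E)`. -/
def IsTest (𝕂 : Type*) [RCLike 𝕂] {E : Type*} [AddCommGroup E] [Module 𝕂 E] [TopologicalSpace E]
    (f : EuclideanSpace ℝ (Fin d) → E) : Prop :=
  (∀ n, IsCk 𝕂 n f) ∧ HasCompactSupport f

/-- The space `𝒟'(ℝ^d; E)` of `E`-valued distributions. -/
abbrev VDist (d : ℕ) (𝕂 : Type*) [RCLike 𝕂] (E : Type*) [AddCommGroup E] [Module 𝕂 E]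
    [TopologicalSpace E] : Type _ :=
  𝓓((⊤ : Opens (EuclideanSpace ℝ (Fin d))), 𝕂) →L[𝕂] E

/-- The distribution `ξ` is given by the continuous function `f : ℝ^d → E`, that is
`ξ(φ) = ∫ φ(x) f(x) dx` for all test functions `φ`, as a weak (Pettis) integral in `E`. -/
def IsGivenBy (ξ : VDist d 𝕂 E) (f : EuclideanSpace ℝ (Fin d) → E) : Prop :=
  Continuous f ∧ ∀ (φ : 𝓓((⊤ : Opens (EuclideanSpace ℝ (Fin d))), 𝕂)) (ℓ : E →L[𝕂] 𝕂),
    ℓ (ξ φ) = ∫ x, φ x * ℓ (f x)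

/-- The `[0, ∞]`-valued Hölder seminorm `‖ξ‖_{α;K,p}`. -/
def holderNorm (s : Fin d → ℝ) (α : ℝ) (p : Seminorm 𝕂 E)
    (K : Compacts (EuclideanSpace ℝ (Fin d))) (ξ : VDist d 𝕂 E) : ℝ≥0∞ :=
  (⨆ x ∈ K, ⨆ η ∈ testBallVanishing 𝕂 s (testOrder α) α, ⨆ l : Ioc (0 : ℝ) 1,
      ENNReal.ofReal ((l : ℝ) ^ (-α) * p (ξ (rescale s l x η)))) +
    ⨆ x ∈ K, ⨆ η ∈ testBall 𝕂 s (testOrder α),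
      ENNReal.ofReal (p (ξ (rescale s ⟨1, by norm_num⟩ x η)))

section Topological

variable [IsTopologicalAddGroup E] [ContinuousSMul 𝕂 E]

theorem holderNorm_zero (s : Fin d → ℝ) (α : ℝ) (p : Seminorm 𝕂 E)
    (K : Compacts (EuclideanSpace ℝ (Fin d))) : holderNorm s α p K (0 : VDist d 𝕂 E) = 0 := by
  simp [holderNorm]

theorem holderNorm_add_le (s : Fin d → ℝ) (α : ℝ) (p : Seminorm 𝕂 E)
    (K : Compacts (EuclideanSpace ℝ (Fin d))) (ξ ζ : VDist d 𝕂 E) :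
    holderNorm s α p K (ξ + ζ) ≤ holderNorm s α p K ξ + holderNorm s α p K ζ := by
  unfold holderNorm
  rw [add_add_add_comm]
  refine add_le_add ?_ ?_
  · refine iSup₂_le fun x hx => iSup₂_le fun η hη => iSup_le fun l => ?_
    have hl : 0 ≤ (l : ℝ) ^ (-α) := Real.rpow_nonneg l.2.1.le _
    have key : ∀ χ : VDist d 𝕂 E, ENNReal.ofReal ((l : ℝ) ^ (-α) * p (χ (rescale s l x η))) ≤
        ⨆ x ∈ K, ⨆ η ∈ testBallVanishing 𝕂 s (testOrder α) α, ⨆ l : Ioc (0 : ℝ) 1,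
          ENNReal.ofReal ((l : ℝ) ^ (-α) * p (χ (rescale s l x η))) := fun χ =>
      le_trans (le_trans (le_iSup
        (fun l : Ioc (0 : ℝ) 1 => ENNReal.ofReal ((l : ℝ) ^ (-α) * p (χ (rescale s l x η)))) l)
        (le_iSup₂ (f := fun η (_ : η ∈ testBallVanishing 𝕂 s (testOrder α) α) =>
          ⨆ l : Ioc (0 : ℝ) 1,
            ENNReal.ofReal ((l : ℝ) ^ (-α) * p (χ (rescale s l x η)))) η hη))
        (le_iSup₂ (f := fun x (_ : x ∈ K) => ⨆ η ∈ testBallVanishing 𝕂 s (testOrder α) α,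
          ⨆ l : Ioc (0 : ℝ) 1,
            ENNReal.ofReal ((l : ℝ) ^ (-α) * p (χ (rescale s l x η)))) x hx)
    refine le_trans (le_trans (ENNReal.ofReal_le_ofReal ?_) ENNReal.ofReal_add_le)
      (add_le_add (key ξ) (key ζ))
    rw [← mul_add]
    exact mul_le_mul_of_nonneg_left (map_add_le_add p _ _) hl
  · refine iSup₂_le fun x hx => iSup₂_le fun η hη => ?_
    have key : ∀ χ : VDist d 𝕂 E, ENNReal.ofReal (p (χ (rescale s ⟨1, by norm_num⟩ x η))) ≤
        ⨆ x ∈ K, ⨆ η ∈ testBall 𝕂 s (testOrder α),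
          ENNReal.ofReal (p (χ (rescale s ⟨1, by norm_num⟩ x η))) := fun χ =>
      le_trans (le_iSup₂ (f := fun η (_ : η ∈ testBall 𝕂 s (testOrder α)) =>
          ENNReal.ofReal (p (χ (rescale s ⟨1, by norm_num⟩ x η)))) η hη)
        (le_iSup₂ (f := fun x (_ : x ∈ K) => ⨆ η ∈ testBall 𝕂 s (testOrder α),
          ENNReal.ofReal (p (χ (rescale s ⟨1, by norm_num⟩ x η)))) x hx)
    exact le_trans (le_trans (ENNReal.ofReal_le_ofReal (map_add_le_add p _ _))
      ENNReal.ofReal_add_le) (add_le_add (key ξ) (key ζ))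

theorem holderNorm_smul (s : Fin d → ℝ) (α : ℝ) (p : Seminorm 𝕂 E)
    (K : Compacts (EuclideanSpace ℝ (Fin d))) (c : 𝕂) (ξ : VDist d 𝕂 E) :
    holderNorm s α p K (c • ξ) = ENNReal.ofReal ‖c‖ * holderNorm s α p K ξ := by
  unfold holderNorm
  rw [mul_add]
  simp only [ENNReal.mul_iSup, smul_apply, map_smul_eq_mul,
    ← ENNReal.ofReal_mul (norm_nonneg c), mul_left_comm]

variable {ι : Type*}

/-- The distributions all of whose Hölder seminorms `‖ξ‖_{α;K,p}` are finite. -/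
def boundedSubmodule (s : Fin d → ℝ) (α : ℝ) (P : SeminormFamily 𝕂 E ι) :
    Submodule 𝕂 (VDist d 𝕂 E) where
  carrier := {ξ | ∀ (K : Compacts (EuclideanSpace ℝ (Fin d))) (i : ι),
    holderNorm s α (P i) K ξ < ∞}
  zero_mem' K i := by rw [holderNorm_zero]; exact ENNReal.zero_lt_top
  add_mem' hξ hζ K i :=
    (holderNorm_add_le s α (P i) K _ _).trans_lt (ENNReal.add_lt_top.2 ⟨hξ K i, hζ K i⟩)
  smul_mem' c ξ hξ K i := by
    rw [holderNorm_smul]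
    exact ENNReal.mul_lt_top ENNReal.ofReal_lt_top (hξ K i)

/-- `boundedSubmodule` as a type of its own, so that it carries the topology of the Hölder
seminorms and not the subspace topology of `𝒟'(ℝ^d; E)`. -/
def BoundedHolder (s : Fin d → ℝ) (α : ℝ) (P : SeminormFamily 𝕂 E ι) : Type _ :=
  boundedSubmodule s α P

instance (s : Fin d → ℝ) (α : ℝ) (P : SeminormFamily 𝕂 E ι) :
    AddCommGroup (BoundedHolder s α P) :=
  inferInstanceAs (AddCommGroup (boundedSubmodule s α P))

instance (s : Fin d → ℝ) (α : ℝ) (P : SeminormFamily 𝕂 E ι) :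
    Module 𝕂 (BoundedHolder s α P) :=
  inferInstanceAs (Module 𝕂 (boundedSubmodule s α P))

/-- The distribution underlying an element of `BoundedHolder s α P`. -/
def BoundedHolder.toDist (s : Fin d → ℝ) (α : ℝ) (P : SeminormFamily 𝕂 E ι) :
    BoundedHolder s α P →ₗ[𝕂] VDist d 𝕂 E :=
  (boundedSubmodule s α P).subtype

/-- The Hölder seminorms `‖·‖_{α;K,p}`, indexed by the compact sets `K` and the seminorms `p` of
the family `P`. -/
def holderSeminorms (s : Fin d → ℝ) (α : ℝ) (P : SeminormFamily 𝕂 E ι) :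
    SeminormFamily 𝕂 (BoundedHolder s α P) (Compacts (EuclideanSpace ℝ (Fin d)) × ι) :=
  fun Ki => Seminorm.of
    (fun ξ => (holderNorm s α (P Ki.2) Ki.1 (BoundedHolder.toDist s α P ξ)).toReal)
    (fun ξ ζ => by
      have h : ∀ χ : BoundedHolder s α P,
          holderNorm s α (P Ki.2) Ki.1 (BoundedHolder.toDist s α P χ) ≠ ∞ := fun χ =>
        ((show ∀ (K : Compacts (EuclideanSpace ℝ (Fin d))) (i : ι),
          holderNorm s α (P i) K (BoundedHolder.toDist s α P χ) < ∞ from χ.2) Ki.1 Ki.2).ne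
      rw [map_add, ← ENNReal.toReal_add (h ξ) (h ζ)]
      exact ENNReal.toReal_mono (ENNReal.add_ne_top.2 ⟨h ξ, h ζ⟩)
        (holderNorm_add_le s α (P Ki.2) Ki.1 _ _))
    (fun c ξ => by
      rw [map_smul, holderNorm_smul, ENNReal.toReal_mul,
        ENNReal.toReal_ofReal (norm_nonneg c)])

/-- The topology generated by the Hölder seminorms. -/
instance (s : Fin d → ℝ) (α : ℝ) (P : SeminormFamily 𝕂 E ι) :
    TopologicalSpace (BoundedHolder s α P) :=
  (holderSeminorms s α P).moduleFilterBasis.topology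

theorem withSeminorms_holder (s : Fin d → ℝ) (α : ℝ) (P : SeminormFamily 𝕂 E ι) :
    WithSeminorms (holderSeminorms s α P) := ⟨rfl⟩

instance (s : Fin d → ℝ) (α : ℝ) (P : SeminormFamily 𝕂 E ι) :
    IsTopologicalAddGroup (BoundedHolder s α P) :=
  (withSeminorms_holder s α P).topologicalAddGroup

instance (s : Fin d → ℝ) (α : ℝ) (P : SeminormFamily 𝕂 E ι) :
    ContinuousSMul 𝕂 (BoundedHolder s α P) :=
  (withSeminorms_holder s α P).continuousSMul

theorem IsCk.zero (n : ℕ) : IsCk 𝕂 n (fun _ : EuclideanSpace ℝ (Fin d) => (0 : E)) := by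
  induction n with
  | zero => exact continuous_const
  | succ n ih => exact ⟨continuous_const, fun _ _ => 0, fun _ _ => by simpa using tendsto_const_nhds, fun _ => ih⟩

theorem IsCk.add {n : ℕ} : ∀ {f g : EuclideanSpace ℝ (Fin d) → E},
    IsCk 𝕂 n f → IsCk 𝕂 n g → IsCk 𝕂 n (fun x => f x + g x) := by
  induction n with
  | zero => exact fun hf hg => Continuous.add hf hg
  | succ n ih =>
    rintro f g ⟨hf, f', hf', hf''⟩ ⟨hg, g', hg', hg''⟩
    refine ⟨hf.add hg, fun i x => f' i x + g' i x, fun i x => ?_, fun i => ih (hf'' i) (hg'' i)⟩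
    refine ((hf' i x).add (hg' i x)).congr fun t => ?_
    rw [← smul_add]
    rw [add_sub_add_comm]

theorem IsCk.const_smul (c : 𝕂) {n : ℕ} : ∀ {f : EuclideanSpace ℝ (Fin d) → E},
    IsCk 𝕂 n f → IsCk 𝕂 n (fun x => c • f x) := by
  induction n with
  | zero => exact fun hf => Continuous.const_smul hf c
  | succ n ih =>
    rintro f ⟨hf, f', hf', hf''⟩
    refine ⟨hf.const_smul c, fun i x => c • f' i x, fun i x => ?_, fun i => ih (hf'' i)⟩
    refine ((hf' i x).const_smul c).congr fun t => ?_
    rw [smul_comm, smul_sub]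

theorem IsGivenBy.zero : IsGivenBy (0 : VDist d 𝕂 E) (fun _ => (0 : E)) :=
  ⟨continuous_const, by simp⟩

theorem integrable_test (φ : 𝓓((⊤ : Opens (EuclideanSpace ℝ (Fin d))), 𝕂)) (ℓ : E →L[𝕂] 𝕂)
    {f : EuclideanSpace ℝ (Fin d) → E} (hf : Continuous f) :
    Integrable (fun x => φ x * ℓ (f x)) :=
  (φ.continuous.mul (ℓ.continuous.comp hf)).integrable_of_hasCompactSupport
    φ.hasCompactSupport.mul_right

theorem IsGivenBy.add {ξ ζ : VDist d 𝕂 E} {f g : EuclideanSpace ℝ (Fin d) → E}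
    (hξ : IsGivenBy ξ f) (hζ : IsGivenBy ζ g) : IsGivenBy (ξ + ζ) (fun x => f x + g x) := by
  refine ⟨hξ.1.add hζ.1, fun φ ℓ => ?_⟩
  simp only [add_apply, map_add, mul_add]
  rw [integral_add (integrable_test φ ℓ hξ.1) (integrable_test φ ℓ hζ.1), hξ.2, hζ.2]

theorem IsGivenBy.const_smul (c : 𝕂) {ξ : VDist d 𝕂 E} {f : EuclideanSpace ℝ (Fin d) → E}
    (hξ : IsGivenBy ξ f) : IsGivenBy (c • ξ) (fun x => c • f x) := by
  refine ⟨hξ.1.const_smul c, fun φ ℓ => ?_⟩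
  simp only [smul_apply, map_smul, smul_eq_mul, mul_left_comm _ c]
  rw [integral_const_mul, hξ.2]

/-- The elements of `𝒟(ℝ^d; E)` with finite Hölder seminorms, as distributions. -/
def testSubmodule (s : Fin d → ℝ) (α : ℝ) (P : SeminormFamily 𝕂 E ι) :
    Submodule 𝕂 (BoundedHolder s α P) where
  carrier := {ξ | ∃ f : EuclideanSpace ℝ (Fin d) → E,
    IsTest 𝕂 f ∧ IsGivenBy (BoundedHolder.toDist s α P ξ) f}
  zero_mem' := ⟨fun _ => 0, ⟨IsCk.zero, HasCompactSupport.zero⟩, by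
    rw [map_zero]; exact IsGivenBy.zero⟩
  add_mem' := by
    rintro ξ ζ ⟨f, hf, hξ⟩ ⟨g, hg, hζ⟩
    refine ⟨fun x => f x + g x, ⟨fun n => (hf.1 n).add (hg.1 n), hf.2.add hg.2⟩, ?_⟩
    rw [map_add]
    exact hξ.add hζ
  smul_mem' := by
    rintro c ξ ⟨f, hf, hξ⟩
    refine ⟨fun x => c • f x, ⟨fun n => (hf.1 n).const_smul c, hf.2.smul_left⟩, ?_⟩
    rw [map_smul]
    exact hξ.const_smul c

/-- The Hölder space `𝒞^α_𝔰(ℝ^d; E)`: the closure of `𝒟(ℝ^d; E)` with respect to the Hölder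
seminorms, with the topology of these seminorms. -/
def HolderSpace (s : Fin d → ℝ) (α : ℝ) (P : SeminormFamily 𝕂 E ι) :
    Submodule 𝕂 (BoundedHolder s α P) :=
  (testSubmodule s α P).topologicalClosure

/-- The distribution underlying an element of the Hölder space. -/
def HolderSpace.toDist {s : Fin d → ℝ} {α : ℝ} {P : SeminormFamily 𝕂 E ι}
    (ξ : HolderSpace s α P) : VDist d 𝕂 E :=
  BoundedHolder.toDist s α P ξ

end Topological

section Multiplication

variable {A : Type*} [NonUnitalRing A] [Module 𝕂 A] [TopologicalSpace A]
  [IsTopologicalAddGroup A] [ContinuousSMul 𝕂 A] {ι : Type*}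

/-- `B` agrees with the pointwise product for all pairs of continuous functions that belong to
the two Hölder spaces. -/
def ExtendsMul {s : Fin d → ℝ} {α β γ : ℝ} {P : SeminormFamily 𝕂 A ι}
    (B : HolderSpace s α P →ₗ[𝕂] HolderSpace s β P →ₗ[𝕂] HolderSpace s γ P) : Prop :=
  ∀ (ξ : HolderSpace s α P) (ζ : HolderSpace s β P) (f g : EuclideanSpace ℝ (Fin d) → A),
    IsGivenBy (HolderSpace.toDist ξ) f → IsGivenBy (HolderSpace.toDist ζ) g →
      IsGivenBy (HolderSpace.toDist (B ξ ζ)) (fun x => f x * g x)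

/-- `B` agrees with the pointwise product for all pairs of test functions in `𝒟(ℝ^d; A)`. -/
def ExtendsTestMul {s : Fin d → ℝ} {α β γ : ℝ} {P : SeminormFamily 𝕂 A ι}
    (B : HolderSpace s α P →ₗ[𝕂] HolderSpace s β P →ₗ[𝕂] HolderSpace s γ P) : Prop :=
  ∀ (ξ : HolderSpace s α P) (ζ : HolderSpace s β P) (f g : EuclideanSpace ℝ (Fin d) → A),
    IsTest 𝕂 f → IsTest 𝕂 g → IsGivenBy (HolderSpace.toDist ξ) f → IsGivenBy (HolderSpace.toDist ζ) g →
      IsGivenBy (HolderSpace.toDist (B ξ ζ)) (fun x => f x * g x)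

end Multiplication

end VecHolder

end

open VecHolder

/-!
Young multiplication of vector-valued Hölder distributions.

*Sufficiency of `α + β > 0`.* By duality the estimate on products reduces to continuous functions
with values in Banach spaces and a bounded bilinear pairing `b`, where Hölder bounds (`HolderBd`) are
bounds on averages against rescaled test functions. Fix an even mollifier all of whose non-constant
moments up to a high degree vanish (`exists_kernel`), and let `a_n` be averaging at scale `2 ^ (-n)`.
The approximations `1 - (1 - a_n) ^ 2` of the identity (`lpP`) have increments (`lpU`) that are
smooth at scale `2 ^ (-n)` and of size `2 ^ (-n α)` on functions of regularity `α`
(`exists_scaledBd_lpU`); thanks to the square, each increment is the sum of the oscillations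
`v - a_n v` and `v - a_{n+1} v` of a function `v` of that size. The product of two approximations telescopes into blocks
(`norm_avg_bilin_lpP_le`). Let `α ≤ β` and test at scale `l`. Blocks coarser than `l` gain a power of
`l` larger than `α`, by Taylor expansion and the vanishing moments of the test function
(`exists_avg_gain`). Among the finer blocks, low frequencies of `f` times blocks of `g` are summable
by size since `α + β > 0`. In blocks of `f` times low frequencies of `g` the self-adjoint operator
`1 - a` is moved from `v` to the test function and the low frequencies, which are smoother, and gains
`r > -α` derivatives (`exists_resonant`, `exists_norm_avg_high_low_le`). The sum is
`exists_holderBd_bilin`.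

For an algebra `A` with seminorm `p` and a functional `ℓ` bounded by `p`, the scalar function `ℓ (f g)`
is the pairing of a function with values in the dual of `(A, p)`, given by `f`, with one in the bidual,
given by `g` (`exists_holderBd_mul`), and Hahn–Banach recovers the seminorms of the weak integrals,
which exist by completeness (`exists_weak_integral`). The product therefore extends by density
(`exists_extended_mul`). It takes values in the closure of the test functions because products of
test functions are test functions (`exists_young_mul`).

*Necessity.* Localised lacunary series of plane waves, with coefficients `2 ^ (-n α)`, have partial
sums that are bounded in the Hölder space of exponent `α`, uniformly in signs and phases
(`exists_holderBd_waveSeries`). If `α + β ≤ 0`, phases and signs can be chosen such that the mean of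
the product of two such partial sums, with exponents `α` and `β`, grows linearly in the number of
terms (`exists_waveSeries_resonance`): each diagonal term is bounded below by a suitable phase, and
the signs make the off-diagonal terms nonnegative in total. With values `a`, `b` such that `a b ≠ 0`
this contradicts continuity of a product that is correct on test functions
(`pos_of_continuous_extendsTestMul`).
-/


noncomputable section

namespace VecHolder

open scoped ContDiff

/-! ### Anisotropic dilations, bumps and moments -/

section

variable {d : ℕ}

/-- The anisotropic dilation `z ↦ (c ^ 𝔰_i z_i)_i`. -/
def dil (s : Fin d → ℝ) (c : ℝ) : EuclideanSpace ℝ (Fin d) →L[ℝ] EuclideanSpace ℝ (Fin d) :=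
  LinearMap.toContinuousLinearMap
    { toFun := fun z => WithLp.toLp 2 fun i => c ^ s i * z i
      map_add' := fun x y => by ext i; simp [mul_add]
      map_smul' := fun a x => by ext i; simp; ring }

@[simp]
theorem dil_apply (s : Fin d → ℝ) (c : ℝ) (z : EuclideanSpace ℝ (Fin d)) (i : Fin d) :
    dil s c z i = c ^ s i * z i := rfl

@[simp]
theorem dil_one (s : Fin d → ℝ) (z : EuclideanSpace ℝ (Fin d)) : dil s 1 z = z := by
  ext i; simp

theorem dil_mul (s : Fin d → ℝ) {a b : ℝ} (ha : 0 ≤ a) (hb : 0 ≤ b)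
    (z : EuclideanSpace ℝ (Fin d)) : dil s (a * b) z = dil s a (dil s b z) := by
  ext i; simp [Real.mul_rpow ha hb, mul_assoc]

theorem dil_dil_inv (s : Fin d → ℝ) {a : ℝ} (ha : 0 < a) (z : EuclideanSpace ℝ (Fin d)) :
    dil s a (dil s a⁻¹ z) = z := by
  rw [← dil_mul s ha.le (inv_nonneg.2 ha.le), mul_inv_cancel₀ ha.ne', dil_one]

theorem norm_dil_le {s : Fin d → ℝ} (hs : ∀ i, 1 ≤ s i) {c : ℝ} (h0 : 0 < c) (h1 : c ≤ 1)
    (z : EuclideanSpace ℝ (Fin d)) : ‖dil s c z‖ ≤ c * ‖z‖ := by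
  have h : ∑ i, ‖dil s c z i‖ ^ 2 ≤ c ^ 2 * ∑ i, ‖z i‖ ^ 2 := by
    rw [Finset.mul_sum]
    refine Finset.sum_le_sum fun i _ => ?_
    rw [dil_apply, norm_mul, mul_pow]
    gcongr
    rw [Real.norm_of_nonneg (Real.rpow_nonneg h0.le _)]
    simpa using Real.rpow_le_rpow_of_exponent_ge h0 h1 (hs i)
  rw [EuclideanSpace.norm_eq, EuclideanSpace.norm_eq]
  refine (Real.sqrt_le_sqrt h).trans_eq ?_
  rw [Real.sqrt_mul (sq_nonneg c), Real.sqrt_sq h0.le]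

theorem norm_dil_le_one {s : Fin d → ℝ} (hs : ∀ i, 1 ≤ s i) {c : ℝ} (h0 : 0 < c) (h1 : c ≤ 1)
    (z : EuclideanSpace ℝ (Fin d)) : ‖dil s c z‖ ≤ ‖z‖ :=
  (norm_dil_le hs h0 h1 z).trans (mul_le_of_le_one_left (norm_nonneg z) h1)

theorem opNorm_dil_le {s : Fin d → ℝ} (hs : ∀ i, 1 ≤ s i) {c : ℝ} (h0 : 0 < c) (h1 : c ≤ 1) :
    ‖dil s c‖ ≤ c :=
  ContinuousLinearMap.opNorm_le_bound _ h0.le (norm_dil_le hs h0 h1)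

theorem det_dil (s : Fin d → ℝ) {c : ℝ} (hc : 0 < c) :
    LinearMap.det (dil s c : EuclideanSpace ℝ (Fin d) →ₗ[ℝ] EuclideanSpace ℝ (Fin d)) =
      c ^ ∑ i, s i := by
  have hM : LinearMap.toMatrix (EuclideanSpace.basisFun (Fin d) ℝ).toBasis
      (EuclideanSpace.basisFun (Fin d) ℝ).toBasis
      (dil s c : EuclideanSpace ℝ (Fin d) →ₗ[ℝ] EuclideanSpace ℝ (Fin d)) =
      Matrix.diagonal fun i => c ^ s i := by
    ext i j
    rw [LinearMap.toMatrix_apply]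
    by_cases h : i = j
    · subst h; simp
    · simp [h]
  rw [← LinearMap.det_toMatrix (EuclideanSpace.basisFun (Fin d) ℝ).toBasis, hM,
    Matrix.det_diagonal, Real.rpow_sum_of_pos hc]

theorem integral_comp_dil {E : Type*} [NormedAddCommGroup E] [NormedSpace ℝ E] (s : Fin d → ℝ)
    {c : ℝ} (hc : 0 < c) (F : EuclideanSpace ℝ (Fin d) → E) :
    ∫ y, F (dil s c y) = (c ^ ∑ i, s i)⁻¹ • ∫ y, F y := by
  have hpos : 0 < c ^ ∑ i, s i := Real.rpow_pos_of_pos hc _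
  have hdet := det_dil s hc
  have hmap := Measure.map_linearMap_addHaar_eq_smul_addHaar
    (volume : Measure (EuclideanSpace ℝ (Fin d)))
    (f := (dil s c : EuclideanSpace ℝ (Fin d) →ₗ[ℝ] EuclideanSpace ℝ (Fin d)))
    (by rw [hdet]; exact hpos.ne')
  have hemb : MeasurableEmbedding (dil s c) := by
    have hh : Topology.IsClosedEmbedding (dil s c) :=
      (Homeomorph.mk ⟨dil s c, dil s c⁻¹, fun z => by
        simpa using dil_dil_inv s (inv_pos.2 hc) z, fun z => dil_dil_inv s hc z⟩
        (dil s c).continuous (dil s c⁻¹).continuous).isClosedEmbedding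
    exact hh.measurableEmbedding
  have h := hemb.integral_map (μ := volume) F
  rw [← h]
  rw [show Measure.map (dil s c) volume = _ from hmap, integral_smul_measure, hdet,
    ENNReal.toReal_ofReal (abs_nonneg _), abs_of_pos (inv_pos.2 hpos)]

theorem scaledNorm_dil {s : Fin d → ℝ} (hs : ∀ i, 1 ≤ s i) {c : ℝ} (hc : 0 < c)
    (z : EuclideanSpace ℝ (Fin d)) : scaledNorm s (dil s c z) = c * scaledNorm s z := by
  unfold scaledNorm
  rw [Finset.mul_sum]
  refine Finset.sum_congr rfl fun i _ => ?_
  have h : s i ≠ 0 := (zero_lt_one.trans_le (hs i)).ne'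
  rw [dil_apply, abs_mul, Real.mul_rpow (abs_nonneg _) (abs_nonneg _),
    abs_of_nonneg (Real.rpow_nonneg hc.le _), ← Real.rpow_mul hc.le, mul_one_div_cancel h,
    Real.rpow_one]

theorem continuous_scaledNorm {s : Fin d → ℝ} (hs : ∀ i, 1 ≤ s i) : Continuous (scaledNorm s) := by
  unfold scaledNorm
  refine continuous_finsetSum _ fun i _ => ?_
  refine Continuous.rpow_const (by fun_prop) fun x => Or.inr ?_
  have := hs i
  positivity

theorem norm_le_of_scaledNorm_lt {s : Fin d → ℝ} (hs : ∀ i, 1 ≤ s i)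
    {y : EuclideanSpace ℝ (Fin d)} (hy : scaledNorm s y < 1) : ‖y‖ ≤ d := by
  have h1 : ∀ i, |y i| ≤ 1 := fun i => by
    have hi : |y i| ^ (1 / s i) ≤ scaledNorm s y :=
      Finset.single_le_sum (f := fun i => |y i| ^ (1 / s i))
        (fun j _ => Real.rpow_nonneg (abs_nonneg _) _) (Finset.mem_univ i)
    by_contra! hlt
    have : 1 < |y i| ^ (1 / s i) :=
      Real.one_lt_rpow hlt (by have := hs i; positivity)
    linarith
  have h2 : ‖y‖ ^ 2 ≤ d := by
    rw [EuclideanSpace.norm_sq_eq]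
    calc ∑ i, ‖y i‖ ^ 2 ≤ ∑ _i : Fin d, (1 : ℝ) := Finset.sum_le_sum fun i _ => by
          rw [Real.norm_eq_abs]; exact pow_le_one₀ (abs_nonneg _) (h1 i)
      _ = d := by simp
  rcases Nat.eq_zero_or_pos d with rfl | hd
  · simpa using h2
  · have : (1 : ℝ) ≤ d := by exact_mod_cast hd
    nlinarith [norm_nonneg y]

/-- Smooth real functions supported in the open unit ball of `|·|_𝔰`. -/
structure IsBump (s : Fin d → ℝ) (η : EuclideanSpace ℝ (Fin d) → ℝ) : Prop where
  smooth : ContDiff ℝ ∞ η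
  supp : tsupport η ⊆ {y | scaledNorm s y < 1}

theorem IsBump.supp_closedBall {s : Fin d → ℝ} (hs : ∀ i, 1 ≤ s i)
    {η : EuclideanSpace ℝ (Fin d) → ℝ} (h : IsBump s η) :
    tsupport η ⊆ Metric.closedBall 0 d := fun y hy => by
  simpa using norm_le_of_scaledNorm_lt hs (h.supp hy)

theorem IsBump.hasCompactSupport {s : Fin d → ℝ} (hs : ∀ i, 1 ≤ s i)
    {η : EuclideanSpace ℝ (Fin d) → ℝ} (h : IsBump s η) : HasCompactSupport η :=
  (isCompact_closedBall 0 (d : ℝ)).of_isClosed_subset (isClosed_tsupport η) (h.supp_closedBall hs)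

theorem IsBump.eq_zero {s : Fin d → ℝ} (hs : ∀ i, 1 ≤ s i)
    {η : EuclideanSpace ℝ (Fin d) → ℝ} (h : IsBump s η) {y : EuclideanSpace ℝ (Fin d)}
    (hy : (d : ℝ) < ‖y‖) : η y = 0 := by
  by_contra h0
  have := h.supp_closedBall hs (subset_tsupport η h0)
  simp at this
  linarith

theorem IsBump.sub {s : Fin d → ℝ} {η χ : EuclideanSpace ℝ (Fin d) → ℝ} (h : IsBump s η)
    (h' : IsBump s χ) : IsBump s (fun y => η y - χ y) :=
  ⟨h.smooth.sub h'.smooth, (tsupport_sub η χ).trans (union_subset h.supp h'.supp)⟩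

theorem IsBump.const_mul {s : Fin d → ℝ} {η : EuclideanSpace ℝ (Fin d) → ℝ} (c : ℝ)
    (h : IsBump s η) : IsBump s (fun y => c * η y) :=
  ⟨contDiff_const.mul h.smooth, (tsupport_mul_subset_right).trans h.supp⟩

/-- The derivative of `ψ` in the direction `v`. -/
def dirDeriv (v : EuclideanSpace ℝ (Fin d)) (ψ : EuclideanSpace ℝ (Fin d) → ℝ) :
    EuclideanSpace ℝ (Fin d) → ℝ := fun y => fderiv ℝ ψ y v

theorem contDiff_dirDeriv {ψ : EuclideanSpace ℝ (Fin d) → ℝ} (h : ContDiff ℝ ∞ ψ)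
    (v : EuclideanSpace ℝ (Fin d)) : ContDiff ℝ ∞ (dirDeriv v ψ) :=
  (h.fderiv_right (m := ∞) (by simp)).clm_apply contDiff_const

theorem tsupport_dirDeriv_subset (ψ : EuclideanSpace ℝ (Fin d) → ℝ)
    (v : EuclideanSpace ℝ (Fin d)) : tsupport (dirDeriv v ψ) ⊆ tsupport ψ :=
  closure_minimal (fun _ hy => support_fderiv_subset ℝ fun h => hy (by simp [dirDeriv, h]))
    (isClosed_tsupport ψ)

theorem IsBump.dirDeriv {s : Fin d → ℝ} {η : EuclideanSpace ℝ (Fin d) → ℝ} (h : IsBump s η)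
    (v : EuclideanSpace ℝ (Fin d)) : IsBump s (dirDeriv v η) :=
  ⟨contDiff_dirDeriv h.smooth v, (tsupport_dirDeriv_subset η v).trans h.supp⟩

theorem norm_iteratedFDeriv_dirDeriv_le {ψ : EuclideanSpace ℝ (Fin d) → ℝ} (h : ContDiff ℝ ∞ ψ)
    (v y : EuclideanSpace ℝ (Fin d)) (j : ℕ) :
    ‖iteratedFDeriv ℝ j (dirDeriv v ψ) y‖ ≤ ‖v‖ * ‖iteratedFDeriv ℝ (j + 1) ψ y‖ := by
  have h1 : dirDeriv v ψ = (ContinuousLinearMap.apply ℝ ℝ v) ∘ fderiv ℝ ψ := rfl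
  have h2 : ContDiff ℝ j (fderiv ℝ ψ) :=
    h.fderiv_right (by exact_mod_cast le_top)
  rw [h1, ContinuousLinearMap.iteratedFDeriv_comp_left _ h2.contDiffAt le_rfl]
  refine (ContinuousLinearMap.norm_compContinuousMultilinearMap_le _ _).trans ?_
  rw [norm_iteratedFDeriv_fderiv]
  gcongr
  refine ContinuousLinearMap.opNorm_le_bound _ (norm_nonneg _) fun L => ?_
  simpa [mul_comm] using L.le_opNorm v

/-- The monomial `y ^ k`. -/
def mono (k : Fin d → ℕ) (y : EuclideanSpace ℝ (Fin d)) : ℝ := ∏ i, y i ^ k i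

/-- `ψ` annihilates all monomials of scaled degree at most `a`. -/
def Vanish (s : Fin d → ℝ) (a : ℝ) (ψ : EuclideanSpace ℝ (Fin d) → ℝ) : Prop :=
  ∀ k : Fin d → ℕ, ∑ i, s i * k i ≤ a → ∫ y, ψ y * mono k y = 0

theorem continuous_mono (k : Fin d → ℕ) : Continuous (mono k) := by
  unfold mono; fun_prop

theorem contDiff_mono (k : Fin d → ℕ) : ContDiff ℝ ∞ (mono k) := by
  unfold mono; fun_prop

theorem mono_dil (s : Fin d → ℝ) {c : ℝ} (hc : 0 < c) (k : Fin d → ℕ)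
    (y : EuclideanSpace ℝ (Fin d)) : mono k (dil s c y) = c ^ (∑ i, s i * k i) * mono k y := by
  simp only [mono, dil_apply, mul_pow, Finset.prod_mul_distrib]
  congr 1
  rw [Real.rpow_sum_of_pos hc]
  refine Finset.prod_congr rfl fun i _ => ?_
  rw [Real.rpow_mul hc.le, Real.rpow_natCast]

theorem fderiv_mono (k : Fin d → ℕ) (y v : EuclideanSpace ℝ (Fin d)) :
    fderiv ℝ (mono k) y v = ∑ i, (k i * v i) * mono (Function.update k i (k i - 1)) y := by
  have h1 : ∀ i, HasFDerivAt (fun y : EuclideanSpace ℝ (Fin d) => y i ^ k i)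
      ((k i * y i ^ (k i - 1)) • (EuclideanSpace.proj i : EuclideanSpace ℝ (Fin d) →L[ℝ] ℝ)) y :=
    fun i => by
      have := (EuclideanSpace.proj i : EuclideanSpace ℝ (Fin d) →L[ℝ] ℝ).hasFDerivAt (x := y)
      simpa [smul_smul] using this.pow (k i)
  have h2 := HasFDerivAt.finsetProd (u := Finset.univ) (fun i _ => h1 i)
  have h3 : HasFDerivAt (mono k) _ y := h2
  rw [h3.fderiv]
  simp only [sum_apply, smul_apply, smul_eq_mul]
  refine Finset.sum_congr rfl fun i _ => ?_
  have : mono (Function.update k i (k i - 1)) y =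
      y i ^ (k i - 1) * ∏ j ∈ Finset.univ.erase i, y j ^ k j := by
    rw [mono, ← Finset.mul_prod_erase _ _ (Finset.mem_univ i)]
    congr 1
    · simp
    · refine Finset.prod_congr rfl fun j hj => ?_
      rw [Function.update_of_ne (Finset.ne_of_mem_erase hj)]
  rw [this]
  simp
  ring

theorem integrable_mul_continuous {ψ g : EuclideanSpace ℝ (Fin d) → ℝ} (hψ : Continuous ψ)
    (hc : HasCompactSupport ψ) (hg : Continuous g) : Integrable (fun y => ψ y * g y) :=
  (hψ.mul hg).integrable_of_hasCompactSupport hc.mul_right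

theorem hasCompactSupport_dirDeriv {ψ : EuclideanSpace ℝ (Fin d) → ℝ} (hc : HasCompactSupport ψ)
    (v : EuclideanSpace ℝ (Fin d)) : HasCompactSupport (dirDeriv v ψ) :=
  hc.of_isClosed_subset (isClosed_tsupport _) (tsupport_dirDeriv_subset ψ v)

theorem integral_dirDeriv_mul {ψ g : EuclideanSpace ℝ (Fin d) → ℝ} (hψ : ContDiff ℝ ∞ ψ)
    (hc : HasCompactSupport ψ) (hg : ContDiff ℝ ∞ g) (v : EuclideanSpace ℝ (Fin d)) :
    ∫ y, dirDeriv v ψ y * g y = -∫ y, ψ y * fderiv ℝ g y v := by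
  have h := integral_mul_fderiv_eq_neg_fderiv_mul_of_integrable (μ := volume) (f := ψ) (g := g)
    (v := v)
    (integrable_mul_continuous (contDiff_dirDeriv hψ v).continuous
      (hasCompactSupport_dirDeriv hc v) hg.continuous)
    (integrable_mul_continuous hψ.continuous hc (contDiff_dirDeriv hg v).continuous)
    (integrable_mul_continuous hψ.continuous hc hg.continuous)
    (fun x _ => (hψ.differentiable (by simp)).differentiableAt)
    (fun x _ => (hg.differentiable (by simp)).differentiableAt)
  rw [h, neg_neg]
  rfl

theorem Vanish.dirDeriv {s : Fin d → ℝ} (hs : ∀ i, 1 ≤ s i) {a : ℝ}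
    {ψ : EuclideanSpace ℝ (Fin d) → ℝ} (hψ : ContDiff ℝ ∞ ψ) (hc : HasCompactSupport ψ)
    (h : Vanish s a ψ) (v : EuclideanSpace ℝ (Fin d)) : Vanish s a (dirDeriv v ψ) := by
  intro k hk
  rw [integral_dirDeriv_mul hψ hc (contDiff_mono k) v]
  simp only [fderiv_mono, Finset.mul_sum]
  rw [integral_finsetSum]
  · rw [neg_eq_zero]
    refine Finset.sum_eq_zero fun i _ => ?_
    have : ∀ y, ψ y * (k i * v i * mono (Function.update k i (k i - 1)) y) =
        (k i * v i) * (ψ y * mono (Function.update k i (k i - 1)) y) := fun y => by ring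
    simp only [this]
    rw [integral_const_mul, h, mul_zero]
    refine le_trans (Finset.sum_le_sum fun j _ => ?_) hk
    have := hs j
    gcongr
    by_cases hj : j = i
    · subst hj; simp
    · simp [hj]
  · intro i _
    have := integrable_mul_continuous hψ.continuous hc
      ((continuous_mono (Function.update k i (k i - 1))).const_mul (k i * v i))
    exact this

theorem Vanish.mono_le {s : Fin d → ℝ} {a b : ℝ} (hab : a ≤ b)
    {ψ : EuclideanSpace ℝ (Fin d) → ℝ} (h : Vanish s b ψ) : Vanish s a ψ :=
  fun k hk => h k (hk.trans hab)

theorem Vanish.const_mul {s : Fin d → ℝ} {a : ℝ} {ψ : EuclideanSpace ℝ (Fin d) → ℝ} (c : ℝ)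
    (h : Vanish s a ψ) : Vanish s a (fun y => c * ψ y) := fun k hk => by
  simp only [mul_assoc]
  rw [integral_const_mul, h k hk, mul_zero]

end

/-! ### Mollifiers with vanishing moments and Taylor expansion -/

section

variable {d : ℕ}

theorem scaledNorm_nonneg (s : Fin d → ℝ) (y : EuclideanSpace ℝ (Fin d)) : 0 ≤ scaledNorm s y :=
  Finset.sum_nonneg fun _ _ => Real.rpow_nonneg (abs_nonneg _) _

/-- `η` concentrated by a factor `2`, with the same integral. -/
def shr (s : Fin d → ℝ) (η : EuclideanSpace ℝ (Fin d) → ℝ) (y : EuclideanSpace ℝ (Fin d)) : ℝ :=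
  2 ^ (∑ i, s i) * η (dil s 2 y)

theorem IsBump.shr {s : Fin d → ℝ} (hs : ∀ i, 1 ≤ s i) {η : EuclideanSpace ℝ (Fin d) → ℝ}
    (h : IsBump s η) : IsBump s (shr s η) := by
  refine ⟨contDiff_const.mul (h.smooth.comp (dil s 2).contDiff), ?_⟩
  refine (tsupport_mul_subset_right).trans fun y hy => ?_
  have h1 : dil s 2 y ∈ tsupport η :=
    tsupport_comp_subset_preimage η (dil s 2).continuous hy
  have h2 : scaledNorm s (dil s 2 y) < 1 := h.supp h1
  rw [scaledNorm_dil hs two_pos] at h2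
  have := scaledNorm_nonneg s y
  simp only [mem_ofPred_eq]
  linarith

theorem integral_shr_smul {E : Type*} [NormedAddCommGroup E] [NormedSpace ℝ E] (s : Fin d → ℝ)
    (η : EuclideanSpace ℝ (Fin d) → ℝ) (F : EuclideanSpace ℝ (Fin d) → E) :
    ∫ y, shr s η y • F y = ∫ y, η y • F (dil s 2⁻¹ y) := by
  have h := integral_comp_dil s two_pos (fun y => η y • F (dil s 2⁻¹ y))
  have h2 : ∀ y, dil s 2⁻¹ (dil s 2 y) = y := fun y => by
    simpa using dil_dil_inv s (inv_pos.2 (two_pos (α := ℝ))) y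
  simp only [h2] at h
  have hpos : (0 : ℝ) < 2 ^ ∑ i, s i := Real.rpow_pos_of_pos two_pos _
  simp only [shr, mul_smul]
  rw [integral_smul, h, smul_smul, mul_inv_cancel₀ hpos.ne', one_smul]

theorem moment_shr (s : Fin d → ℝ) (η : EuclideanSpace ℝ (Fin d) → ℝ) (k : Fin d → ℕ) :
    ∫ y, shr s η y * mono k y = 2⁻¹ ^ (∑ i, s i * k i) * ∫ y, η y * mono k y := by
  have h := integral_shr_smul s η (mono k)
  simp only [smul_eq_mul] at h
  rw [h, ← integral_const_mul]
  refine integral_congr_ae (Eventually.of_forall fun y => ?_)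
  simp only [mono_dil s (inv_pos.2 (two_pos (α := ℝ)))]
  ring

theorem mono_zero (y : EuclideanSpace ℝ (Fin d)) : mono (0 : Fin d → ℕ) y = 1 := by simp [mono]

theorem exists_isBump_nonneg {s : Fin d → ℝ} (hs : ∀ i, 1 ≤ s i) :
    ∃ η : EuclideanSpace ℝ (Fin d) → ℝ, IsBump s η ∧ (∀ y, 0 ≤ η y) ∧ (∀ y, η (-y) = η y) ∧
      ∫ y, η y = 1 := by
  have h0 : scaledNorm s (0 : EuclideanSpace ℝ (Fin d)) < 1 := by
    have : ∀ i, (1 / s i) ≠ 0 := fun i => by have := hs i; positivity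
    simp only [scaledNorm, PiLp.zero_apply, abs_zero]
    rw [Finset.sum_eq_zero fun i _ => Real.zero_rpow (this i)]
    exact one_pos
  have hopen : {y : EuclideanSpace ℝ (Fin d) | scaledNorm s y < 1} ∈ 𝓝 0 :=
    (isOpen_lt (continuous_scaledNorm hs) continuous_const).mem_nhds h0
  obtain ⟨ε, hε, hball⟩ := Metric.mem_nhds_iff.1 hopen
  let f : ContDiffBump (0 : EuclideanSpace ℝ (Fin d)) := ⟨ε / 4, ε / 2, by positivity, by linarith⟩
  refine ⟨f.normed volume, ⟨f.contDiff_normed, ?_⟩, fun y => f.nonneg_normed y,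
    fun y => f.normed_neg y, f.integral_normed⟩
  rw [f.tsupport_normed_eq]
  exact (Metric.closedBall_subset_ball (by change ε / 2 < ε; linarith)).trans hball

/-- Finitely many non-constant moments can be removed one after another, by combining a kernel with its
concentration `shr`, which multiplies the moment `k` by `2 ^ (-|k|_𝔰)`. -/
theorem exists_kernel_finset {s : Fin d → ℝ} (hs : ∀ i, 1 ≤ s i) (T : Finset (Fin d → ℕ))
    (hT : (0 : Fin d → ℕ) ∉ T) :
    ∃ η : EuclideanSpace ℝ (Fin d) → ℝ, IsBump s η ∧ (∀ y, η (-y) = η y) ∧ ∫ y, η y = 1 ∧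
      ∀ k ∈ T, ∫ y, η y * mono k y = 0 := by
  induction T using Finset.induction_on with
  | empty =>
    obtain ⟨η, h1, -, h2, h3⟩ := exists_isBump_nonneg hs
    exact ⟨η, h1, h2, h3, by simp⟩
  | insert k T hk ih =>
    simp only [Finset.mem_insert, not_or] at hT
    obtain ⟨η, hη, heven, hint, hmom⟩ := ih hT.2
    have he : 0 < ∑ i, s i * k i := by
      obtain ⟨i, hi⟩ := Function.ne_iff.1 (Ne.symm hT.1)
      refine Finset.sum_pos' (fun j _ => ?_) ⟨i, Finset.mem_univ i, ?_⟩
      · have := hs j; positivity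
      · have := hs i
        have : (0 : ℝ) < k i := by exact_mod_cast Nat.pos_of_ne_zero hi
        positivity
    set q : ℝ := 2⁻¹ ^ (∑ i, s i * k i) with hq
    have hq1 : q < 1 := Real.rpow_lt_one (by norm_num) (by norm_num) he
    have hne : 1 - q ≠ 0 := by linarith
    -- the combination kills the moment `k`, since `shr` multiplies that moment by `q`
    have hm : ∀ m : Fin d → ℕ,
        ∫ y, (1 - q)⁻¹ * (shr s η y - q * η y) * mono m y =
          (1 - q)⁻¹ * ((2⁻¹ ^ (∑ i, s i * m i) - q) * ∫ y, η y * mono m y) := fun m => by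
      have h1 := integrable_mul_continuous (hη.shr hs).smooth.continuous
        ((hη.shr hs).hasCompactSupport hs) (continuous_mono m)
      have h2 := integrable_mul_continuous hη.smooth.continuous
        (hη.hasCompactSupport hs) (continuous_mono m)
      simp only [mul_assoc, sub_mul]
      rw [integral_const_mul, integral_sub h1 (h2.const_mul q), integral_const_mul, moment_shr]
    refine ⟨fun y => (1 - q)⁻¹ * (shr s η y - q * η y),
      ((hη.shr hs).sub (hη.const_mul q)).const_mul _, fun y => ?_, ?_, ?_⟩
    · simp only [shr, map_neg, heven]
    · have := hm 0
      simp only [mono_zero, mul_one, hint] at this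
      rw [this]
      simp [hne]
    · intro m hmT
      rw [hm m]
      rcases Finset.mem_insert.1 hmT with rfl | hmT
      · rw [← hq]; simp
      · rw [hmom m hmT]; simp

/-- Existence of an even mollifier all of whose non-constant moments of scaled degree at most `M`
vanish. -/
theorem exists_kernel {s : Fin d → ℝ} (hs : ∀ i, 1 ≤ s i) (M : ℝ) :
    ∃ η : EuclideanSpace ℝ (Fin d) → ℝ, IsBump s η ∧ (∀ y, η (-y) = η y) ∧ ∫ y, η y = 1 ∧
      ∀ k : Fin d → ℕ, k ≠ 0 → ∑ i, s i * k i ≤ M → ∫ y, η y * mono k y = 0 := by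
  obtain ⟨η, h1, h2, h3, h4⟩ := exists_kernel_finset hs
    ((Fintype.piFinset fun _ : Fin d => Finset.range (⌊M⌋₊ + 1)).erase 0)
    (Finset.notMem_erase _ _)
  refine ⟨η, h1, h2, h3, fun k hk hkM => h4 k (Finset.mem_erase.2 ⟨hk, ?_⟩)⟩
  rw [Fintype.mem_piFinset]
  intro i
  rw [Finset.mem_range, Nat.lt_succ_iff]
  refine Nat.le_floor (le_trans ?_ hkM)
  calc (k i : ℝ) ≤ s i * k i := le_mul_of_one_le_left (by positivity) (hs i)
    _ ≤ _ := Finset.single_le_sum (f := fun i => s i * (k i : ℝ))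
        (fun j _ => by have := hs j; positivity) (Finset.mem_univ i)

/-- The kernel of the difference of the averages at two successive dyadic scales annihilates all
polynomials up to degree `M`, including the constants. -/
theorem vanish_shr_sub {s : Fin d → ℝ} (hs : ∀ i, 1 ≤ s i) {M : ℝ}
    {η : EuclideanSpace ℝ (Fin d) → ℝ} (hη : IsBump s η)
    (hm : ∀ k : Fin d → ℕ, k ≠ 0 → ∑ i, s i * k i ≤ M → ∫ y, η y * mono k y = 0) :
    Vanish s M (fun y => shr s η y - η y) := by
  intro k hk
  have h1 := integrable_mul_continuous (hη.shr hs).smooth.continuous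
    ((hη.shr hs).hasCompactSupport hs) (continuous_mono k)
  have h2 := integrable_mul_continuous hη.smooth.continuous
    (hη.hasCompactSupport hs) (continuous_mono k)
  simp only [sub_mul]
  rw [integral_sub h1 h2, moment_shr]
  by_cases hk0 : k = 0
  · subst hk0; simp
  · rw [hm k hk0 hk]; simp

section Taylor

variable {F : Type*} [NormedAddCommGroup F] [NormedSpace ℝ F]

/-- The Taylor polynomial of `G` at `0` of degree less than `N`. -/
def taylorPoly (G : EuclideanSpace ℝ (Fin d) → F) (N : ℕ) (y : EuclideanSpace ℝ (Fin d)) : F :=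
  ∑ j ∈ Finset.range N, (j.factorial : ℝ)⁻¹ • iteratedFDeriv ℝ j G 0 (fun _ => y)

theorem norm_sub_taylorPoly_le [CompleteSpace F] {G : EuclideanSpace ℝ (Fin d) → F}
    (hG : ContDiff ℝ ∞ G) (N : ℕ) (y : EuclideanSpace ℝ (Fin d)) {C : ℝ}
    (hC : ∀ t ∈ Icc (0 : ℝ) 1, ‖iteratedFDeriv ℝ N G (t • y)‖ ≤ C) :
    ‖G y - taylorPoly G N y‖ ≤ C * ‖y‖ ^ N := by
  cases N with
  | zero => simpa [taylorPoly] using hC 1 (by simp)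
  | succ n =>
    have h := map_add_eq_sum_add_integral_iteratedFDeriv (f := G) (x := 0) (y := y) (n := n)
      (fun t _ => hG.contDiffAt.of_le (by exact_mod_cast le_top))
    simp only [zero_add] at h
    have hC0 : 0 ≤ C := (norm_nonneg _).trans (hC 0 (by simp))
    rw [taylorPoly, h, add_sub_cancel_left, norm_smul]
    have h1 : ‖((n.factorial : ℝ))⁻¹‖ ≤ 1 := by
      rw [norm_inv, Real.norm_natCast]
      exact inv_le_one_of_one_le₀ (by exact_mod_cast Nat.factorial_pos n)
    have h2 : ‖∫ t in (0 : ℝ)..1, (1 - t) ^ n • iteratedFDeriv ℝ (n + 1) G (t • y) fun _ => y‖ ≤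
        (C * ‖y‖ ^ (n + 1)) * |1 - 0| := by
      refine intervalIntegral.norm_integral_le_of_norm_le_const fun t ht => ?_
      rw [uIoc_of_le zero_le_one] at ht
      rw [norm_smul, norm_pow, Real.norm_of_nonneg (by linarith [ht.2])]
      have h3 := (iteratedFDeriv ℝ (n + 1) G (t • y)).le_opNorm fun _ => y
      simp only [Finset.prod_const, Finset.card_univ, Fintype.card_fin] at h3
      calc (1 - t) ^ n * ‖iteratedFDeriv ℝ (n + 1) G (t • y) fun _ => y‖
          ≤ 1 * (C * ‖y‖ ^ (n + 1)) := by
            refine mul_le_mul (pow_le_one₀ (by linarith [ht.2]) (by linarith [ht.1]))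
              (h3.trans ?_) (norm_nonneg _) zero_le_one
            gcongr
            exact hC t ⟨ht.1.le, ht.2⟩
        _ = _ := one_mul _
    calc _ ≤ 1 * ((C * ‖y‖ ^ (n + 1)) * |1 - 0|) := by gcongr
      _ = _ := by simp

/-- The multi-index counting the values of `κ`. -/
def countIdx {j : ℕ} (κ : Fin j → Fin d) (i : Fin d) : ℕ := (Finset.univ.filter fun l => κ l = i).card

theorem prod_eq_mono {j : ℕ} (κ : Fin j → Fin d) (y : EuclideanSpace ℝ (Fin d)) :
    ∏ l, y (κ l) = mono (countIdx κ) y := by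
  rw [mono, ← Finset.prod_fiberwise' Finset.univ κ (fun i => y i)]
  simp [countIdx]

theorem abs_mono_countIdx_le {j : ℕ} (κ : Fin j → Fin d) (y : EuclideanSpace ℝ (Fin d)) :
    |mono (countIdx κ) y| ≤ ‖y‖ ^ j := by
  rw [← prod_eq_mono, Finset.abs_prod]
  calc ∏ l, |y (κ l)| ≤ ∏ _l : Fin j, ‖y‖ :=
        Finset.prod_le_prod (fun _ _ => abs_nonneg _) fun l _ => PiLp.norm_apply_le y (κ l)
    _ = _ := by simp

theorem iteratedFDeriv_apply_eq_sum (G : EuclideanSpace ℝ (Fin d) → F) (j : ℕ)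
    (x y : EuclideanSpace ℝ (Fin d)) :
    iteratedFDeriv ℝ j G x (fun _ => y) = ∑ κ : Fin j → Fin d, mono (countIdx κ) y •
      iteratedFDeriv ℝ j G x (fun l => EuclideanSpace.single (κ l) 1) := by
  have hy : (fun _ : Fin j => y) = fun _ => ∑ i, y i • EuclideanSpace.single i (1 : ℝ) := by
    funext _
    ext i
    simp [Finset.sum_apply, Pi.single_apply]
  rw [hy, ContinuousMultilinearMap.map_sum]
  refine Finset.sum_congr rfl fun κ _ => ?_
  rw [ContinuousMultilinearMap.map_smul_univ, prod_eq_mono]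

theorem norm_iteratedFDeriv_single_le (G : EuclideanSpace ℝ (Fin d) → F) (j : ℕ)
    (x : EuclideanSpace ℝ (Fin d)) (κ : Fin j → Fin d) :
    ‖iteratedFDeriv ℝ j G x (fun l => EuclideanSpace.single (κ l) 1)‖ ≤ ‖iteratedFDeriv ℝ j G x‖ := by
  simpa using (iteratedFDeriv ℝ j G x).le_opNorm (fun l => EuclideanSpace.single (κ l) (1 : ℝ))

/-- Pairing a kernel with a Taylor polynomial only involves the moments of the kernel. -/
theorem integral_smul_taylorPoly [CompleteSpace F] (G : EuclideanSpace ℝ (Fin d) → F) (N : ℕ)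
    {χ : EuclideanSpace ℝ (Fin d) → ℝ} (hχ : Continuous χ) (hc : HasCompactSupport χ)
    (s : Fin d → ℝ) {t : ℝ} (ht : 0 < t) :
    ∫ y, χ y • taylorPoly G N (dil s t y) = ∑ j ∈ Finset.range N, (j.factorial : ℝ)⁻¹ •
      ∑ κ : Fin j → Fin d, (t ^ (∑ i, s i * countIdx κ i) * ∫ y, χ y * mono (countIdx κ) y) •
        iteratedFDeriv ℝ j G 0 (fun l => EuclideanSpace.single (κ l) 1) := by
  simp only [taylorPoly, iteratedFDeriv_apply_eq_sum, mono_dil s ht, Finset.smul_sum, smul_smul]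
  have hint : ∀ (j : ℕ) (κ : Fin j → Fin d), Integrable fun y =>
      (χ y * ((j.factorial : ℝ)⁻¹ * (t ^ (∑ i, s i * countIdx κ i) * mono (countIdx κ) y))) •
        iteratedFDeriv ℝ j G 0 (fun l => EuclideanSpace.single (κ l) 1) := fun j κ =>
    (integrable_mul_continuous hχ hc
      (((continuous_mono _).const_mul _).const_mul _)).smul_const _
  rw [integral_finsetSum _ fun j _ => integrable_finsetSum _ fun κ _ => hint j κ]
  refine Finset.sum_congr rfl fun j _ => ?_
  rw [integral_finsetSum _ fun κ _ => hint j κ]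
  refine Finset.sum_congr rfl fun κ _ => ?_
  rw [integral_smul_const, ← integral_const_mul, ← integral_const_mul]
  congr 2
  funext y
  ring

theorem norm_integral_smul_le {χ : EuclideanSpace ℝ (Fin d) → ℝ} {H : EuclideanSpace ℝ (Fin d) → F}
    {ρ A B : ℝ} (hρ : ∀ y, ρ < ‖y‖ → χ y = 0) (hA : ∀ y, |χ y| ≤ A)
    (hB : ∀ y, ‖y‖ ≤ ρ → ‖H y‖ ≤ B) :
    ‖∫ y, χ y • H y‖ ≤ A * B * volume.real (Metric.closedBall (0 : EuclideanSpace ℝ (Fin d)) ρ) := by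
  have h0 : 0 ≤ A := (abs_nonneg _).trans (hA 0)
  have h1 : ∫ y, χ y • H y = ∫ y in Metric.closedBall 0 ρ, χ y • H y := by
    rw [setIntegral_eq_integral_of_forall_compl_eq_zero]
    intro y hy
    rw [hρ y (by simpa using hy), zero_smul]
  rw [h1]
  refine norm_setIntegral_le_of_norm_le_const measure_closedBall_lt_top fun y hy => ?_
  rw [norm_smul]
  exact mul_le_mul (hA y) (hB y (by simpa using hy)) (norm_nonneg _) h0

theorem continuous_taylorPoly (G : EuclideanSpace ℝ (Fin d) → F) (N : ℕ) :
    Continuous (taylorPoly G N) := by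
  unfold taylorPoly
  simp only [iteratedFDeriv_apply_eq_sum]
  have := fun (j : ℕ) (κ : Fin j → Fin d) => continuous_mono (countIdx κ)
  fun_prop

theorem integral_smul_eq_taylorPoly_add {G : EuclideanSpace ℝ (Fin d) → F}
    (hG : Continuous G) (N : ℕ)
    {χ : EuclideanSpace ℝ (Fin d) → ℝ} (hχ : Continuous χ) (hc : HasCompactSupport χ)
    (s : Fin d → ℝ) (t : ℝ) :
    ∫ y, χ y • G (dil s t y) = (∫ y, χ y • taylorPoly G N (dil s t y)) +
      ∫ y, χ y • (G (dil s t y) - taylorPoly G N (dil s t y)) := by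
  have hp := continuous_taylorPoly G N
  rw [← integral_add]
  · simp only [← smul_add, add_sub_cancel]
  · exact (hχ.smul (hp.comp (dil s t).continuous)).integrable_of_hasCompactSupport hc.smul_right
  · exact (hχ.smul ((hG.comp (dil s t).continuous).sub
      (hp.comp (dil s t).continuous))).integrable_of_hasCompactSupport hc.smul_right

/-- A mollifier with vanishing moments reproduces `G 0` up to derivatives of order `N`. -/
theorem norm_integral_kernel_sub_le [CompleteSpace F] {s : Fin d → ℝ} (hs : ∀ i, 1 ≤ s i)
    {σ : EuclideanSpace ℝ (Fin d) → ℝ} (hσ : IsBump s σ) (hint : ∫ y, σ y = 1) {N : ℕ}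
    (hm : ∀ k : Fin d → ℕ, k ≠ 0 → ∑ i, s i * k i ≤ N * ∑ i, s i → ∫ y, σ y * mono k y = 0)
    {S : ℝ} (hS : ∀ y, |σ y| ≤ S)
    {G : EuclideanSpace ℝ (Fin d) → F} (hG : ContDiff ℝ ∞ G) {t : ℝ} (ht : 0 < t) (ht1 : t ≤ 1)
    {C : ℝ} (hN : 0 < N)
    (hC : ∀ z, ‖z‖ ≤ d → ‖iteratedFDeriv ℝ N G z‖ ≤ C) :
    ‖(∫ y, σ y • G (dil s t y)) - G 0‖ ≤
      S * (C * (d : ℝ) ^ N) *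
        volume.real (Metric.closedBall (0 : EuclideanSpace ℝ (Fin d)) d) := by
  have hpoly : ∫ y, σ y • taylorPoly G N (dil s t y) = G 0 := by
    rw [integral_smul_taylorPoly G N hσ.smooth.continuous (hσ.hasCompactSupport hs) s ht]
    rw [Finset.sum_eq_single_of_mem 0 (Finset.mem_range.2 hN)]
    · have h1 : countIdx (default : Fin 0 → Fin d) = 0 := by funext i; simp [countIdx]
      simp [h1, mono_zero, hint]
    · intro j hj hj0
      rw [Finset.sum_eq_zero, smul_zero]
      intro κ _
      rw [hm, mul_zero, zero_smul]
      · intro h0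
        have := congrFun h0 (κ ⟨0, Nat.pos_of_ne_zero hj0⟩)
        simp only [countIdx, Pi.zero_apply, Finset.card_eq_zero, Finset.filter_eq_empty_iff,
          Finset.mem_univ, true_imp_iff] at this
        exact this rfl
      -- a multi-index of length less than `N` has entries at most `N`
      · rw [Finset.mul_sum]
        refine Finset.sum_le_sum fun i _ => ?_
        rw [mul_comm]
        have := hs i
        have h2 : countIdx κ i ≤ N := (Finset.card_filter_le _ _).trans (by
          simpa using (Finset.mem_range.1 hj).le)
        gcongr
  rw [integral_smul_eq_taylorPoly_add hG.continuous N hσ.smooth.continuous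
    (hσ.hasCompactSupport hs), hpoly, add_sub_cancel_left]
  refine norm_integral_smul_le (fun y hy => hσ.eq_zero hs hy) hS fun y hy => ?_
  have hC0 : 0 ≤ C := (norm_nonneg _).trans (hC 0 (by simp))
  have hdy : ‖dil s t y‖ ≤ d := (norm_dil_le_one hs ht ht1 y).trans hy
  refine (norm_sub_taylorPoly_le hG N _ (C := C) fun τ hτ => hC _ ?_).trans ?_
  · rw [norm_smul, Real.norm_of_nonneg hτ.1]
    exact (mul_le_of_le_one_left (norm_nonneg _) hτ.2).trans hdy
  · gcongr

/-- The scaled degrees above `a` of the terms of a Taylor expansion of order `N > a` are finitely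
many, so they stay away from `a`. -/
theorem exists_gap (s : Fin d → ℝ) (a : ℝ) (N : ℕ) (hN : a < N) :
    ∃ e : ℝ, a < e ∧ e ≤ N ∧ ∀ j < N, ∀ κ : Fin j → Fin d, a < ∑ i, s i * countIdx κ i →
      e ≤ ∑ i, s i * countIdx κ i := by
  let T : Finset ℝ := insert (N : ℝ) ((Finset.range N).biUnion fun j =>
    ((Finset.univ : Finset (Fin j → Fin d)).image fun κ => ∑ i, s i * (countIdx κ i : ℝ)).filter
      fun x => a < x)
  have hT : T.Nonempty := ⟨_, Finset.mem_insert_self _ _⟩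
  refine ⟨T.min' hT, ?_, Finset.min'_le _ _ (Finset.mem_insert_self _ _), fun j hj κ hκ => ?_⟩
  · rcases Finset.mem_insert.1 (T.min'_mem hT) with h | h
    · rw [h]; exact hN
    · obtain ⟨j, -, h⟩ := Finset.mem_biUnion.1 h
      exact (Finset.mem_filter.1 h).2
  · refine Finset.min'_le _ _ (Finset.mem_insert_of_mem (Finset.mem_biUnion.2
      ⟨j, Finset.mem_range.2 hj, Finset.mem_filter.2 ⟨Finset.mem_image.2 ⟨κ, Finset.mem_univ _, rfl⟩, hκ⟩⟩))

/-- A test function that annihilates the polynomials of degree at most `a`, concentrated by a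
factor `t`, sees a smooth function only at order `t ^ e` for some `e > a`. -/
theorem exists_taylor_gain [CompleteSpace F] {s : Fin d → ℝ} (hs : ∀ i, 1 ≤ s i) (a : ℝ) :
    ∃ (N : ℕ) (e A : ℝ), a < e ∧ 0 ≤ A ∧ ∀ (η : EuclideanSpace ℝ (Fin d) → ℝ), IsBump s η →
      (∀ y, |η y| ≤ 1) → Vanish s a η → ∀ (G : EuclideanSpace ℝ (Fin d) → F), ContDiff ℝ ∞ G →
      ∀ (C t : ℝ), 0 < t → t ≤ 1 →
      (∀ j ≤ N, ∀ z, ‖z‖ ≤ d → ‖iteratedFDeriv ℝ j G z‖ ≤ C) →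
      ‖∫ y, η y • G (dil s t y)‖ ≤ A * C * t ^ e := by
  obtain ⟨N, hN⟩ := exists_nat_gt a
  obtain ⟨e, he, heN, hgap⟩ := exists_gap s a N hN
  set V := volume.real (Metric.closedBall (0 : EuclideanSpace ℝ (Fin d)) d) with hV
  have hV0 : 0 ≤ V := measureReal_nonneg
  refine ⟨N, e, (∑ j ∈ Finset.range N, ∑ _κ : Fin j → Fin d, (d : ℝ) ^ j * V) + (d : ℝ) ^ N * V,
    he, by positivity, ?_⟩
  intro η hη hη1 hvan G hG C t ht ht1 hC
  have hC0 : 0 ≤ C := (norm_nonneg _).trans (hC 0 (by simp) 0 (by simp))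
  have hte : 0 ≤ t ^ e := Real.rpow_nonneg ht.le _
  have hcs := hη.hasCompactSupport hs
  rw [integral_smul_eq_taylorPoly_add hG.continuous N hη.smooth.continuous hcs,
    add_mul, add_mul]
  refine (norm_add_le _ _).trans (add_le_add ?_ ?_)
  · rw [integral_smul_taylorPoly G N hη.smooth.continuous hcs s ht, Finset.sum_mul,
      Finset.sum_mul]
    refine norm_sum_le_of_le _ fun j hj => ?_
    have hj' := Finset.mem_range.1 hj
    rw [norm_smul, Finset.sum_mul, Finset.sum_mul]
    have hfac : ‖((j.factorial : ℝ))⁻¹‖ ≤ 1 := by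
      rw [norm_inv, Real.norm_natCast]
      exact inv_le_one_of_one_le₀ (by exact_mod_cast Nat.factorial_pos j)
    refine (mul_le_of_le_one_left (norm_nonneg _) hfac).trans (norm_sum_le_of_le _ fun κ _ => ?_)
    rw [norm_smul, norm_mul, Real.norm_of_nonneg (Real.rpow_nonneg ht.le _)]
    by_cases hdeg : ∑ i, s i * (countIdx κ i : ℝ) ≤ a
    · rw [hvan _ hdeg]
      simp only [norm_zero, mul_zero, zero_mul]
      positivity
    · have h1 : t ^ (∑ i, s i * (countIdx κ i : ℝ)) ≤ t ^ e :=
        Real.rpow_le_rpow_of_exponent_ge ht ht1 (hgap j hj' κ (not_le.1 hdeg))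
      have h2 : ‖∫ y, η y * mono (countIdx κ) y‖ ≤ (d : ℝ) ^ j * V := by
        have := norm_integral_smul_le (χ := η) (H := mono (countIdx κ)) (ρ := d) (A := 1)
          (B := (d : ℝ) ^ j) (fun y hy => hη.eq_zero hs hy) hη1
          (fun y hy => (abs_mono_countIdx_le κ y).trans (by gcongr))
        simpa using this
      have h3 : ‖iteratedFDeriv ℝ j G 0 (fun l => EuclideanSpace.single (κ l) 1)‖ ≤ C :=
        (norm_iteratedFDeriv_single_le G j 0 κ).trans (hC j hj'.le 0 (by simp))
      calc _ ≤ t ^ e * ((d : ℝ) ^ j * V) * C := by gcongr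
        _ = _ := by ring
  · have h := norm_integral_smul_le (χ := η) (ρ := d) (A := 1) (B := C * (t ^ e * (d : ℝ) ^ N))
      (H := fun y => G (dil s t y) - taylorPoly G N (dil s t y))
      (fun y hy => hη.eq_zero hs hy) hη1 (fun y hy => ?_)
    · refine h.trans_eq ?_
      ring
    · have hdy : ‖dil s t y‖ ≤ t * d := (norm_dil_le hs ht ht1 y).trans (by gcongr)
      refine (norm_sub_taylorPoly_le hG N _ (C := C) fun τ hτ => hC N le_rfl _ ?_).trans ?_
      · rw [norm_smul, Real.norm_of_nonneg hτ.1]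
        exact (mul_le_of_le_one_left (norm_nonneg _) hτ.2).trans
          ((norm_dil_le_one hs ht ht1 y).trans hy)
      · have : ‖dil s t y‖ ^ N ≤ t ^ e * (d : ℝ) ^ N := by
          calc _ ≤ (t * d) ^ N := by gcongr
            _ = t ^ (N : ℝ) * (d : ℝ) ^ N := by rw [mul_pow, Real.rpow_natCast]
            _ ≤ _ := by
              gcongr ?_ * _
              exact Real.rpow_le_rpow_of_exponent_ge ht ht1 heN
        gcongr

end Taylor

end

/-! ### Averages and Hölder bounds -/

section

variable {d : ℕ} {E F G : Type*} [NormedAddCommGroup E] [NormedSpace ℝ E]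
  [NormedAddCommGroup F] [NormedSpace ℝ F] [NormedAddCommGroup G] [NormedSpace ℝ G]

theorem exists_bound_iteratedFDeriv {ψ : EuclideanSpace ℝ (Fin d) → E} (h : ContDiff ℝ ∞ ψ)
    (hc : HasCompactSupport ψ) (n : ℕ) :
    ∃ B, 0 ≤ B ∧ ∀ j ≤ n, ∀ y, ‖iteratedFDeriv ℝ j ψ y‖ ≤ B := by
  have h1 : ∀ j : ℕ, ∃ B, ∀ y, ‖iteratedFDeriv ℝ j ψ y‖ ≤ B := fun j =>
    (h.continuous_iteratedFDeriv (m := j) (by exact_mod_cast le_top)).bounded_above_of_compact_support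
      (hc.iteratedFDeriv j)
  choose B hB using h1
  refine ⟨∑ j ∈ Finset.range (n + 1), |B j|, Finset.sum_nonneg fun _ _ => abs_nonneg _,
    fun j hj y => (hB j y).trans ((le_abs_self _).trans ?_)⟩
  exact Finset.single_le_sum (f := fun j => |B j|) (fun _ _ => abs_nonneg _)
    (Finset.mem_range.2 (by omega))

/-- The correlation `z ↦ ∫ ψ(y) f(z + y) dy`. -/
def corr (ψ : EuclideanSpace ℝ (Fin d) → ℝ) (f : EuclideanSpace ℝ (Fin d) → E)
    (z : EuclideanSpace ℝ (Fin d)) : E := ∫ y, ψ y • f (z + y)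

theorem corr_eq_convolution (ψ : EuclideanSpace ℝ (Fin d) → ℝ) (f : EuclideanSpace ℝ (Fin d) → E) :
    corr ψ f = convolution (fun y => ψ (-y)) f (ContinuousLinearMap.lsmul ℝ ℝ) volume := by
  funext z
  rw [convolution, corr, ← integral_neg_eq_self]
  simp [sub_eq_add_neg]

theorem contDiff_corr [CompleteSpace E] {ψ : EuclideanSpace ℝ (Fin d) → ℝ} (hψ : ContDiff ℝ ∞ ψ)
    (hc : HasCompactSupport ψ) {f : EuclideanSpace ℝ (Fin d) → E} (hf : Continuous f) :
    ContDiff ℝ ∞ (corr ψ f) := by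
  rw [corr_eq_convolution]
  exact HasCompactSupport.contDiff_convolution_left _ (hc.comp_homeomorph (Homeomorph.neg _))
    (hψ.comp contDiff_neg) hf.locallyIntegrable

theorem fderiv_corr [CompleteSpace E] {ψ : EuclideanSpace ℝ (Fin d) → ℝ} (hψ : ContDiff ℝ ∞ ψ)
    (hc : HasCompactSupport ψ) {f : EuclideanSpace ℝ (Fin d) → E} (hf : Continuous f)
    (z v : EuclideanSpace ℝ (Fin d)) :
    fderiv ℝ (corr ψ f) z v = corr (fun y => -dirDeriv v ψ y) f z := by
  have hc' : HasCompactSupport fun y => ψ (-y) := hc.comp_homeomorph (Homeomorph.neg _)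
  have hψ' : ContDiff ℝ ∞ fun y => ψ (-y) := hψ.comp contDiff_neg
  have h := HasCompactSupport.hasFDerivAt_convolution_left (μ := volume)
    (ContinuousLinearMap.lsmul ℝ ℝ : ℝ →L[ℝ] E →L[ℝ] E) hc' (hψ'.of_le (by simp))
    hf.locallyIntegrable z
  have hfd : Continuous (fderiv ℝ fun y => ψ (-y)) := hψ'.continuous_fderiv (by simp)
  rw [corr_eq_convolution, h.fderiv, convolution, ContinuousLinearMap.integral_apply]
  · rw [corr, ← integral_neg_eq_self]
    refine integral_congr_ae (Eventually.of_forall fun t => ?_)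
    have hneg : fderiv ℝ (fun y => ψ (-y)) (-t) v = -dirDeriv v ψ t := by
      have h2 : HasFDerivAt (fun y => ψ (-y)) ((fderiv ℝ ψ (- -t)).comp (-ContinuousLinearMap.id ℝ _)) (-t) :=
        ((hψ.differentiable (by simp)) (- -t)).hasFDerivAt.comp (-t)
          (hasFDerivAt_id (-t)).neg
      rw [h2.fderiv]
      simp [dirDeriv]
    simp [hneg, ContinuousLinearMap.precompL_apply]
  · have := (hc'.fderiv (𝕜 := ℝ)).convolutionExists_left
      (L := (ContinuousLinearMap.lsmul ℝ ℝ : ℝ →L[ℝ] E →L[ℝ] E).precompL (EuclideanSpace ℝ (Fin d)))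
      (μ := volume) hfd (g := f) hf.locallyIntegrable z
    exact this

/-- Iterated directional derivatives of `ψ`, with the sign from moving them off a correlation. -/
def iterDir : {j : ℕ} → (Fin j → EuclideanSpace ℝ (Fin d)) → (EuclideanSpace ℝ (Fin d) → ℝ) →
    EuclideanSpace ℝ (Fin d) → ℝ
  | 0, _, ψ => ψ
  | _ + 1, m, ψ => fun y => -dirDeriv (m 0) (iterDir (Fin.tail m) ψ) y

theorem IsBump.neg {s : Fin d → ℝ} {η : EuclideanSpace ℝ (Fin d) → ℝ} (h : IsBump s η) :
    IsBump s (fun y => -η y) := by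
  simpa using h.const_mul (-1)

theorem IsBump.iterDir {s : Fin d → ℝ} {ψ : EuclideanSpace ℝ (Fin d) → ℝ} (h : IsBump s ψ) :
    ∀ {j : ℕ} (m : Fin j → EuclideanSpace ℝ (Fin d)), IsBump s (iterDir m ψ)
  | 0, _ => h
  | _ + 1, m => ((h.iterDir (Fin.tail m)).dirDeriv (m 0)).neg

theorem Vanish.iterDir {s : Fin d → ℝ} (hs : ∀ i, 1 ≤ s i) {a : ℝ}
    {ψ : EuclideanSpace ℝ (Fin d) → ℝ} (h : IsBump s ψ) (hv : Vanish s a ψ) :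
    ∀ {j : ℕ} (m : Fin j → EuclideanSpace ℝ (Fin d)), Vanish s a (iterDir m ψ)
  | 0, _ => hv
  | _ + 1, m => by
    have h1 := (hv.iterDir hs h (Fin.tail m)).dirDeriv hs (h.iterDir _).smooth
      ((h.iterDir _).hasCompactSupport hs) (m 0)
    have h2 := h1.const_mul (-1)
    simp only [neg_one_mul] at h2
    exact h2

theorem norm_iteratedFDeriv_iterDir_le {s : Fin d → ℝ} {ψ : EuclideanSpace ℝ (Fin d) → ℝ}
    (h : IsBump s ψ) (y : EuclideanSpace ℝ (Fin d)) :
    ∀ {j : ℕ} (m : Fin j → EuclideanSpace ℝ (Fin d)) (i : ℕ),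
      ‖iteratedFDeriv ℝ i (iterDir m ψ) y‖ ≤ (∏ l, ‖m l‖) * ‖iteratedFDeriv ℝ (i + j) ψ y‖
  | 0, _, i => by simp [iterDir]
  | j + 1, m, i => by
    have h1 : iteratedFDeriv ℝ i (iterDir m ψ) y =
        -iteratedFDeriv ℝ i (dirDeriv (m 0) (iterDir (Fin.tail m) ψ)) y :=
      iteratedFDeriv_neg_apply
    rw [h1, norm_neg]
    refine (norm_iteratedFDeriv_dirDeriv_le (h.iterDir _).smooth _ y i).trans ?_
    have h2 := norm_iteratedFDeriv_iterDir_le h y (Fin.tail m) (i + 1)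
    rw [Fin.prod_univ_succ, show i + (j + 1) = i + 1 + j by ring, mul_assoc]
    gcongr
    exact h2

theorem iteratedFDeriv_corr [CompleteSpace E] {s : Fin d → ℝ} (hs : ∀ i, 1 ≤ s i)
    {ψ : EuclideanSpace ℝ (Fin d) → ℝ} (hψ : IsBump s ψ)
    {f : EuclideanSpace ℝ (Fin d) → E} (hf : Continuous f) :
    ∀ {j : ℕ} (m : Fin j → EuclideanSpace ℝ (Fin d)) (z : EuclideanSpace ℝ (Fin d)),
      iteratedFDeriv ℝ j (corr ψ f) z m = corr (iterDir m ψ) f z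
  | 0, m, z => by simp [iterDir]
  | j + 1, m, z => by
    have hsm := contDiff_corr hψ.smooth (hψ.hasCompactSupport hs) hf
    have hd : DifferentiableAt ℝ (iteratedFDeriv ℝ j (corr ψ f)) z :=
      (hsm.differentiable_iteratedFDeriv (m := j) (by exact_mod_cast ENat.natCast_lt_top j)) z
    rw [iteratedFDeriv_succ_apply_left]
    have h1 : (fun z => iteratedFDeriv ℝ j (corr ψ f) z (Fin.tail m)) =
        corr (iterDir (Fin.tail m) ψ) f := funext fun z => iteratedFDeriv_corr hs hψ hf (Fin.tail m) z
    have h2 : fderiv ℝ (fun z => iteratedFDeriv ℝ j (corr ψ f) z (Fin.tail m)) z (m 0) =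
        (fderiv ℝ (iteratedFDeriv ℝ j (corr ψ f)) z (m 0)) (Fin.tail m) := by
      have := (ContinuousMultilinearMap.apply ℝ (fun _ : Fin j => EuclideanSpace ℝ (Fin d)) E
        (Fin.tail m)).hasFDerivAt.comp z hd.hasFDerivAt
      have h3 : fderiv ℝ (fun z => iteratedFDeriv ℝ j (corr ψ f) z (Fin.tail m)) z = _ := this.fderiv
      rw [h3]
      rfl
    rw [← h2, h1, fderiv_corr (hψ.iterDir _).smooth ((hψ.iterDir _).hasCompactSupport hs) hf]
    rfl

/-- The average `∫ ψ(z) f(x + c ^ 𝔰 z) dz` of `f` around `x` at scale `c`: the pairing of `f` with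
the rescaled and recentred kernel `ψ`. -/
def avg (s : Fin d → ℝ) (ψ : EuclideanSpace ℝ (Fin d) → ℝ) (c : ℝ)
    (f : EuclideanSpace ℝ (Fin d) → E) (x : EuclideanSpace ℝ (Fin d)) : E :=
  ∫ z, ψ z • f (x + dil s c z)

theorem avg_add_dil (s : Fin d → ℝ) (ψ : EuclideanSpace ℝ (Fin d) → ℝ) (c : ℝ)
    (f : EuclideanSpace ℝ (Fin d) → E) (x z : EuclideanSpace ℝ (Fin d)) :
    avg s ψ c f (x + dil s c z) = corr ψ (fun y => f (x + dil s c y)) z := by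
  simp only [avg, corr, map_add, add_assoc]

theorem avg_eq_corr (s : Fin d → ℝ) (ψ : EuclideanSpace ℝ (Fin d) → ℝ) (c : ℝ)
    (f : EuclideanSpace ℝ (Fin d) → E) (x : EuclideanSpace ℝ (Fin d)) :
    avg s ψ c f x = corr ψ (fun y => f (x + dil s c y)) 0 := by
  simp [avg, corr]

variable {s : Fin d → ℝ}

theorem contDiff_avg [CompleteSpace E] (hs : ∀ i, 1 ≤ s i) {ψ : EuclideanSpace ℝ (Fin d) → ℝ}
    (hψ : IsBump s ψ) {c : ℝ} (hc : 0 < c) {f : EuclideanSpace ℝ (Fin d) → E} (hf : Continuous f) :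
    ContDiff ℝ ∞ (avg s ψ c f) := by
  have h : avg s ψ c f = fun x => corr ψ (fun y => f (0 + dil s c y)) (dil s c⁻¹ x) := by
    funext x
    rw [← avg_add_dil, dil_dil_inv s hc, zero_add]
  rw [h]
  exact (contDiff_corr hψ.smooth (hψ.hasCompactSupport hs) (by fun_prop)).comp
    (dil s c⁻¹).contDiff

theorem avg_comm (hs : ∀ i, 1 ≤ s i) {ψ χ : EuclideanSpace ℝ (Fin d) → ℝ}
    (hψ : IsBump s ψ) (hχ : IsBump s χ) (a b : ℝ) {f : EuclideanSpace ℝ (Fin d) → E}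
    (hf : Continuous f) (x : EuclideanSpace ℝ (Fin d)) :
    avg s ψ a (avg s χ b f) x = avg s χ b (avg s ψ a f) x := by
  simp only [avg, ← integral_smul]
  have hψc := hψ.smooth.continuous
  have hχc := hχ.smooth.continuous
  rw [integral_integral_swap_of_hasCompactSupport]
  · simp only [smul_comm (χ _) (ψ _), add_right_comm]
  · fun_prop
  · refine HasCompactSupport.intro (((hψ.hasCompactSupport hs).isCompact).prod
      (hχ.hasCompactSupport hs).isCompact) fun p hp => ?_
    rw [mem_prod, not_and_or] at hp
    rcases hp with hp | hp
    · have h : ψ p.1 = 0 := image_eq_zero_of_notMem_tsupport hp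
      simp [Function.uncurry_def, h]
    · have h : χ p.2 = 0 := image_eq_zero_of_notMem_tsupport hp
      simp [Function.uncurry_def, h]

theorem norm_avg_le (hs : ∀ i, 1 ≤ s i) {σ : EuclideanSpace ℝ (Fin d) → ℝ}
    (hσ : IsBump s σ) {A : ℝ} (hA : ∀ y, |σ y| ≤ A) {c : ℝ} (h0 : 0 < c) (h1 : c ≤ 1)
    {f : EuclideanSpace ℝ (Fin d) → E} {R B : ℝ} (hB : ∀ x, ‖x‖ ≤ R + d → ‖f x‖ ≤ B)
    {x : EuclideanSpace ℝ (Fin d)} (hx : ‖x‖ ≤ R) :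
    ‖avg s σ c f x‖ ≤ A * B * volume.real (Metric.closedBall (0 : EuclideanSpace ℝ (Fin d)) d) :=
  norm_integral_smul_le (fun _ hy => hσ.eq_zero hs hy) hA fun y hy => hB _
    ((norm_add_le _ _).trans (add_le_add hx ((norm_dil_le_one hs h0 h1 y).trans hy)))

/-- The Hölder bound with constant `C` on the closed ball of radius `R`, for functions with values
in a real normed space and real test functions: oscillating test functions are tested at every scale
in `(0, 1]`, all test functions at scale one. -/
def HolderBd (s : Fin d → ℝ) (α : ℝ) (r : ℕ) (f : EuclideanSpace ℝ (Fin d) → E) (R C : ℝ) : Prop :=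
  (∀ x, ‖x‖ ≤ R → ∀ η, IsBump s η → (∀ j ≤ r, ∀ y, ‖iteratedFDeriv ℝ j η y‖ ≤ 1) →
    Vanish s α η → ∀ l, 0 < l → l ≤ 1 → ‖avg s η l f x‖ ≤ C * l ^ α) ∧
  ∀ x, ‖x‖ ≤ R → ∀ η, IsBump s η → (∀ j ≤ r, ∀ y, ‖iteratedFDeriv ℝ j η y‖ ≤ 1) →
    ‖avg s η 1 f x‖ ≤ C

/-- The derivatives of `H` up to order `N`, measured at scale `c`, are bounded by `C` on the closed
ball of radius `R`. -/
def ScaledBd (s : Fin d → ℝ) (H : EuclideanSpace ℝ (Fin d) → E) (c R : ℝ) (N : ℕ) (C : ℝ) : Prop :=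
  ∀ x, ‖x‖ ≤ R → ∀ j ≤ N, ‖iteratedFDeriv ℝ j (fun z => H (x + dil s c z)) 0‖ ≤ C

theorem avg_const_mul (s : Fin d → ℝ) (a : ℝ) (ψ : EuclideanSpace ℝ (Fin d) → ℝ) (c : ℝ)
    (f : EuclideanSpace ℝ (Fin d) → E) (x : EuclideanSpace ℝ (Fin d)) :
    avg s (fun y => a * ψ y) c f x = a • avg s ψ c f x := by
  simp only [avg, mul_smul, integral_smul]

/-- By homogeneity, a bound on averages against normalised test functions gives one for all test
functions. -/
theorem norm_avg_le_of_normalized {η : EuclideanSpace ℝ (Fin d) → ℝ} {r : ℕ} {B D l : ℝ}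
    {f : EuclideanSpace ℝ (Fin d) → E} {x : EuclideanSpace ℝ (Fin d)} (hη : IsBump s η)
    (hB : ∀ j ≤ r, ∀ y, ‖iteratedFDeriv ℝ j η y‖ ≤ B)
    (h : 0 < B → (∀ j ≤ r, ∀ y, ‖iteratedFDeriv ℝ j (fun y => B⁻¹ * η y) y‖ ≤ 1) →
      ‖avg s (fun y => B⁻¹ * η y) l f x‖ ≤ D) :
    ‖avg s η l f x‖ ≤ B * D := by
  have hB0 : 0 ≤ B := (norm_nonneg _).trans (hB 0 (Nat.zero_le _) 0)
  rcases hB0.eq_or_lt with h0 | h0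
  · have : ∀ y, η y = 0 := fun y => by
      have := hB 0 (Nat.zero_le _) y
      rw [norm_iteratedFDeriv_zero, ← h0] at this
      simpa using this
    simp [avg, this, ← h0]
  · have h1 : ∀ j ≤ r, ∀ y, ‖iteratedFDeriv ℝ j (fun y => B⁻¹ * η y) y‖ ≤ 1 := fun j hj y => by
      have h2 : iteratedFDeriv ℝ j (fun y => B⁻¹ * η y) y = B⁻¹ • iteratedFDeriv ℝ j η y := by
        change iteratedFDeriv ℝ j (B⁻¹ • η) y = _
        exact iteratedFDeriv_const_smul_apply (hη.smooth.contDiffAt.of_le (by exact_mod_cast le_top))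
      rw [h2, norm_smul, norm_inv, Real.norm_of_nonneg h0.le]
      exact inv_mul_le_one_of_le₀ (hB j hj y) h0.le
    have h3 := h h0 h1
    rw [avg_const_mul, norm_smul, norm_inv, Real.norm_of_nonneg h0.le] at h3
    exact (inv_mul_le_iff₀ h0).1 h3

theorem HolderBd.norm_avg_le {α : ℝ} {r : ℕ} {f : EuclideanSpace ℝ (Fin d) → E} {R C : ℝ}
    (h : HolderBd s α r f R C) {η : EuclideanSpace ℝ (Fin d) → ℝ} (hη : IsBump s η) {B : ℝ}
    (hB : ∀ j ≤ r, ∀ y, ‖iteratedFDeriv ℝ j η y‖ ≤ B) (hv : Vanish s α η)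
    {x : EuclideanSpace ℝ (Fin d)} (hx : ‖x‖ ≤ R) {l : ℝ} (h0 : 0 < l) (h1 : l ≤ 1) :
    ‖avg s η l f x‖ ≤ B * (C * l ^ α) :=
  norm_avg_le_of_normalized hη hB fun _ hb =>
    h.1 x hx _ (hη.const_mul _) hb (hv.const_mul _) l h0 h1

theorem HolderBd.norm_avg_one_le {α : ℝ} {r : ℕ} {f : EuclideanSpace ℝ (Fin d) → E} {R C : ℝ}
    (h : HolderBd s α r f R C) {η : EuclideanSpace ℝ (Fin d) → ℝ} (hη : IsBump s η) {B : ℝ}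
    (hB : ∀ j ≤ r, ∀ y, ‖iteratedFDeriv ℝ j η y‖ ≤ B)
    {x : EuclideanSpace ℝ (Fin d)} (hx : ‖x‖ ≤ R) :
    ‖avg s η 1 f x‖ ≤ B * C :=
  norm_avg_le_of_normalized hη hB fun _ hb => h.2 x hx _ (hη.const_mul _) hb

/-- The derivatives of an average at scale `c`, measured at scale `c`, are again averages. -/
theorem norm_iteratedFDeriv_avg_le [CompleteSpace E] (hs : ∀ i, 1 ≤ s i)
    {ψ : EuclideanSpace ℝ (Fin d) → ℝ} (hψ : IsBump s ψ)
    {f : EuclideanSpace ℝ (Fin d) → E} (hf : Continuous f) {c D : ℝ} {j : ℕ} (hD : 0 ≤ D)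
    {x : EuclideanSpace ℝ (Fin d)}
    (h : ∀ m : Fin j → EuclideanSpace ℝ (Fin d),
      ‖avg s (iterDir m ψ) c f x‖ ≤ (∏ l, ‖m l‖) * D) :
    ‖iteratedFDeriv ℝ j (fun z => avg s ψ c f (x + dil s c z)) 0‖ ≤ D := by
  refine ContinuousMultilinearMap.opNorm_le_bound hD fun m => ?_
  simp only [avg_add_dil]
  rw [show (fun z => corr ψ (fun y => f (x + dil s c y)) z) =
    corr ψ (fun y => f (x + dil s c y)) from rfl,
    iteratedFDeriv_corr hs hψ (by fun_prop) m 0, ← avg_eq_corr, mul_comm]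
  exact h m

/-- Smoothness of averages at their own scale: every derivative falls on the kernel, and the derivatives
of the kernel are again admissible test functions. -/
theorem HolderBd.scaledBd_avg [CompleteSpace E] (hs : ∀ i, 1 ≤ s i) {α : ℝ} {r : ℕ}
    {f : EuclideanSpace ℝ (Fin d) → E} {R C : ℝ} (hC : 0 ≤ C)
    (h : HolderBd s α r f R C) (hf : Continuous f) {ψ : EuclideanSpace ℝ (Fin d) → ℝ}
    (hψ : IsBump s ψ) (hv : Vanish s α ψ) {N : ℕ} {B : ℝ}
    (hB : ∀ j ≤ N + r, ∀ y, ‖iteratedFDeriv ℝ j ψ y‖ ≤ B) {c : ℝ} (h0 : 0 < c) (h1 : c ≤ 1) :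
    ScaledBd s (avg s ψ c f) c R N (B * C * c ^ α) := by
  have hB0 : 0 ≤ B := (norm_nonneg _).trans (hB 0 (Nat.zero_le _) 0)
  intro x hx j hj
  refine norm_iteratedFDeriv_avg_le hs hψ hf
    (mul_nonneg (mul_nonneg hB0 hC) (Real.rpow_nonneg h0.le _)) fun m => ?_
  refine (h.norm_avg_le (B := (∏ l, ‖m l‖) * B) (hψ.iterDir m) (fun i hi y => ?_)
    (hv.iterDir hs hψ m) hx h0 h1).trans_eq (by ring)
  refine (norm_iteratedFDeriv_iterDir_le hψ y m i).trans ?_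
  gcongr
  exact hB _ (by omega) y

theorem HolderBd.scaledBd_avg_one [CompleteSpace E] (hs : ∀ i, 1 ≤ s i) {α : ℝ} {r : ℕ}
    {f : EuclideanSpace ℝ (Fin d) → E} {R C : ℝ} (hC : 0 ≤ C)
    (h : HolderBd s α r f R C) (hf : Continuous f) {ψ : EuclideanSpace ℝ (Fin d) → ℝ}
    (hψ : IsBump s ψ) {N : ℕ} {B : ℝ}
    (hB : ∀ j ≤ N + r, ∀ y, ‖iteratedFDeriv ℝ j ψ y‖ ≤ B) :
    ScaledBd s (avg s ψ 1 f) 1 R N (B * C) := by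
  have hB0 : 0 ≤ B := (norm_nonneg _).trans (hB 0 (Nat.zero_le _) 0)
  intro x hx j hj
  refine norm_iteratedFDeriv_avg_le hs hψ hf (mul_nonneg hB0 hC) fun m => ?_
  refine (h.norm_avg_one_le (B := (∏ l, ‖m l‖) * B) (hψ.iterDir m) (fun i hi y => ?_)
    hx).trans_eq (by ring)
  refine (norm_iteratedFDeriv_iterDir_le hψ y m i).trans ?_
  gcongr
  exact hB _ (by omega) y

theorem avg_sub_fun (hs : ∀ i, 1 ≤ s i) {ψ : EuclideanSpace ℝ (Fin d) → ℝ} (hψ : IsBump s ψ)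
    (c : ℝ) {f g : EuclideanSpace ℝ (Fin d) → E} (hf : Continuous f) (hg : Continuous g)
    (x : EuclideanSpace ℝ (Fin d)) :
    avg s ψ c (fun y => f y - g y) x = avg s ψ c f x - avg s ψ c g x := by
  simp only [avg, smul_sub]
  have hψc := hψ.smooth.continuous
  have hcs := hψ.hasCompactSupport hs
  exact integral_sub
    ((hψc.smul (by fun_prop : Continuous fun z => f (x + dil s c z))).integrable_of_hasCompactSupport
      hcs.smul_right)
    ((hψc.smul (by fun_prop : Continuous fun z => g (x + dil s c z))).integrable_of_hasCompactSupport
      hcs.smul_right)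

theorem HolderBd.sub (hs : ∀ i, 1 ≤ s i) {α : ℝ} {r : ℕ} {f g : EuclideanSpace ℝ (Fin d) → E}
    {R C D : ℝ} (hf : HolderBd s α r f R C) (hg : HolderBd s α r g R D) (hfc : Continuous f)
    (hgc : Continuous g) : HolderBd s α r (fun y => f y - g y) R (C + D) := by
  refine ⟨fun x hx η hη hb hv l h0 h1 => ?_, fun x hx η hη hb => ?_⟩
  · rw [avg_sub_fun hs hη l hfc hgc, add_mul]
    exact (norm_sub_le _ _).trans (add_le_add (hf.1 x hx η hη hb hv l h0 h1)
      (hg.1 x hx η hη hb hv l h0 h1))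
  · rw [avg_sub_fun hs hη 1 hfc hgc]
    exact (norm_sub_le _ _).trans (add_le_add (hf.2 x hx η hη hb) (hg.2 x hx η hη hb))

theorem HolderBd.mono {α : ℝ} {r : ℕ} {f : EuclideanSpace ℝ (Fin d) → E} {R R' C : ℝ}
    (h : HolderBd s α r f R C) (hR : R' ≤ R) : HolderBd s α r f R' C :=
  ⟨fun x hx => h.1 x (hx.trans hR), fun x hx => h.2 x (hx.trans hR)⟩

/-- Averages commute, so averaging preserves Hölder bounds. -/
theorem HolderBd.avg (hs : ∀ i, 1 ≤ s i) {α : ℝ} {r : ℕ} {f : EuclideanSpace ℝ (Fin d) → E}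
    {R C : ℝ} (h : HolderBd s α r f (R + d) C) (hf : Continuous f)
    {σ : EuclideanSpace ℝ (Fin d) → ℝ} (hσ : IsBump s σ) {A : ℝ} (hA : ∀ y, |σ y| ≤ A)
    {c : ℝ} (h0 : 0 < c) (h1 : c ≤ 1) :
    HolderBd s α r (avg s σ c f) R
      (A * volume.real (Metric.closedBall (0 : EuclideanSpace ℝ (Fin d)) d) * C) := by
  refine ⟨fun x hx η hη hb hv l hl hl1 => ?_, fun x hx η hη hb => ?_⟩
  · rw [avg_comm hs hη hσ l c hf]
    refine (VecHolder.norm_avg_le hs hσ hA h0 h1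
      (fun x hx => h.1 x hx η hη hb hv l hl hl1) hx).trans_eq (by ring)
  · rw [avg_comm hs hη hσ 1 c hf]
    refine (VecHolder.norm_avg_le hs hσ hA h0 h1
      (fun x hx => h.2 x hx η hη hb) hx).trans_eq (by ring)

end

/-! ### Functions that are smooth at a given scale, and the resonant estimate -/

section

variable {d : ℕ} {E F G : Type*} [NormedAddCommGroup E] [NormedSpace ℝ E]
  [NormedAddCommGroup F] [NormedSpace ℝ F] [NormedAddCommGroup G] [NormedSpace ℝ G]
  {s : Fin d → ℝ}

theorem norm_iteratedFDeriv_comp_dil_le (hs : ∀ i, 1 ≤ s i) {g : EuclideanSpace ℝ (Fin d) → E}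
    (hg : ContDiff ℝ ∞ g) {t : ℝ} (h0 : 0 < t) (h1 : t ≤ 1) (j : ℕ)
    (z : EuclideanSpace ℝ (Fin d)) :
    ‖iteratedFDeriv ℝ j (fun z => g (dil s t z)) z‖ ≤ t ^ j * ‖iteratedFDeriv ℝ j g (dil s t z)‖ := by
  have h := (dil s t).iteratedFDeriv_comp_right hg z (i := j) (by exact_mod_cast le_top)
  change ‖iteratedFDeriv ℝ j (g ∘ dil s t) z‖ ≤ _
  rw [h]
  refine (ContinuousMultilinearMap.norm_compContinuousLinearMap_le _ _).trans ?_
  rw [mul_comm]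
  gcongr
  simp only [Finset.prod_const, Finset.card_univ, Fintype.card_fin]
  exact pow_le_pow_left₀ (norm_nonneg _) (opNorm_dil_le hs h0 h1) j

theorem contDiff_comp_add_dil {H : EuclideanSpace ℝ (Fin d) → E} (hH : ContDiff ℝ ∞ H)
    (x : EuclideanSpace ℝ (Fin d)) (c : ℝ) : ContDiff ℝ ∞ fun z => H (x + dil s c z) :=
  hH.comp (contDiff_const.add (dil s c).contDiff)

theorem iteratedFDeriv_add_dil (H : EuclideanSpace ℝ (Fin d) → E) (c : ℝ) (j : ℕ)
    (x z : EuclideanSpace ℝ (Fin d)) :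
    iteratedFDeriv ℝ j (fun z => H (x + dil s c z)) z =
      iteratedFDeriv ℝ j (fun w => H (x + dil s c z + dil s c w)) 0 := by
  have h := iteratedFDeriv_comp_add_left (𝕜 := ℝ) (f := fun z => H (x + dil s c z)) j z 0
  rw [add_zero] at h
  rw [← h]
  simp only [map_add, add_assoc]

namespace ScaledBd

variable {H : EuclideanSpace ℝ (Fin d) → E} {c R C : ℝ} {N : ℕ}

theorem norm_le (h : ScaledBd s H c R N C) {x : EuclideanSpace ℝ (Fin d)} (hx : ‖x‖ ≤ R) :
    ‖H x‖ ≤ C := by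
  simpa using h x hx 0 (Nat.zero_le _)

theorem nonneg (h : ScaledBd s H c R N C) (hR : 0 ≤ R) : 0 ≤ C :=
  (norm_nonneg _).trans (h.norm_le (x := 0) (by simpa using hR))

theorem weaken (h : ScaledBd s H c R N C) {R' C' : ℝ} (hR : R' ≤ R) (hC : C ≤ C') :
    ScaledBd s H c R' N C' := fun x hx j hj => (h x (hx.trans hR) j hj).trans hC

theorem norm_le_at (h : ScaledBd s H c R N C) {x z : EuclideanSpace ℝ (Fin d)} {j : ℕ}
    (hj : j ≤ N) (hx : ‖x + dil s c z‖ ≤ R) :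
    ‖iteratedFDeriv ℝ j (fun z => H (x + dil s c z)) z‖ ≤ C := by
  rw [iteratedFDeriv_add_dil]
  exact h _ hx j hj

/-- Passing to the finer scale `c'`, a derivative of order `j` gains the factor `(c' / c) ^ j`. -/
theorem norm_le_finer (hs : ∀ i, 1 ≤ s i) (h : ScaledBd s H c R N C) (hH : ContDiff ℝ ∞ H)
    (hc : 0 < c) {c' : ℝ} (h0 : 0 < c') (h1 : c' ≤ c) {x z : EuclideanSpace ℝ (Fin d)} {j : ℕ}
    (hj : j ≤ N) (hx : ‖x + dil s c' z‖ ≤ R) :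
    ‖iteratedFDeriv ℝ j (fun z => H (x + dil s c' z)) z‖ ≤ (c' / c) ^ j * C := by
  have hq : 0 < c' / c := div_pos h0 hc
  have h2 : ∀ z, dil s c' z = dil s c (dil s (c' / c) z) := fun z => by
    rw [← dil_mul s hc.le hq.le, mul_div_cancel₀ _ hc.ne']
  rw [h2] at hx
  simp only [h2]
  refine (norm_iteratedFDeriv_comp_dil_le hs (contDiff_comp_add_dil (s := s) hH x c) hq
    ((div_le_one hc).2 h1) j z).trans ?_
  gcongr
  exact h.norm_le_at hj hx

theorem finer (hs : ∀ i, 1 ≤ s i) (h : ScaledBd s H c R N C) (hH : ContDiff ℝ ∞ H)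
    (hc : 0 < c) {c' : ℝ} (h0 : 0 < c') (h1 : c' ≤ c) : ScaledBd s H c' R N C := by
  intro x hx j hj
  refine (h.norm_le_finer hs hH hc h0 h1 hj (by simpa using hx)).trans ?_
  have : 0 ≤ C := (norm_nonneg _).trans (h x hx 0 (Nat.zero_le _))
  exact mul_le_of_le_one_left this
    (pow_le_one₀ (div_pos h0 hc).le ((div_le_one hc).2 h1))

theorem add {H' : EuclideanSpace ℝ (Fin d) → E} {C' : ℝ} (h : ScaledBd s H c R N C)
    (h' : ScaledBd s H' c R N C') (hH : ContDiff ℝ ∞ H) (hH' : ContDiff ℝ ∞ H') :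
    ScaledBd s (fun x => H x + H' x) c R N (C + C') := by
  intro x hx j hj
  have h1 := iteratedFDeriv_add_apply (𝕜 := ℝ) (i := j) (x := (0 : EuclideanSpace ℝ (Fin d)))
    ((contDiff_comp_add_dil (s := s) hH x c).contDiffAt.of_le (by exact_mod_cast le_top))
    ((contDiff_comp_add_dil (s := s) hH' x c).contDiffAt.of_le (by exact_mod_cast le_top))
  change ‖iteratedFDeriv ℝ j ((fun z => H (x + dil s c z)) + fun z => H' (x + dil s c z)) 0‖ ≤ _
  rw [h1]
  exact (norm_add_le _ _).trans (add_le_add (h x hx j hj) (h' x hx j hj))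

theorem sum {ι : Type*} (T : Finset ι) {K : ι → EuclideanSpace ℝ (Fin d) → E} {D : ι → ℝ}
    (h : ∀ k ∈ T, ScaledBd s (K k) c R N (D k)) (hK : ∀ k ∈ T, ContDiff ℝ ∞ (K k)) :
    ScaledBd s (fun x => ∑ k ∈ T, K k x) c R N (∑ k ∈ T, D k) := by
  classical
  induction T using Finset.induction_on with
  | empty =>
    intro x hx j hj
    simp
  | insert k T hk ih =>
    simp only [Finset.sum_insert hk]
    simp only [Finset.mem_insert, forall_eq_or_imp] at h hK
    exact h.1.add (ih h.2 hK.2) hK.1 (ContDiff.sum fun k hk => hK.2 k hk)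

/-- Leibniz' rule at a fixed scale; `2 ^ N` is the sum of the binomial coefficients. -/
theorem bilin {H' : EuclideanSpace ℝ (Fin d) → F} {C' : ℝ} (h : ScaledBd s H c R N C)
    (h' : ScaledBd s H' c R N C') (hH : ContDiff ℝ ∞ H) (hH' : ContDiff ℝ ∞ H')
    (b : E →L[ℝ] F →L[ℝ] G) (hb : ‖b‖ ≤ 1) :
    ScaledBd s (fun x => b (H x) (H' x)) c R N (2 ^ N * (C * C')) := by
  intro x hx j hj
  have hC : 0 ≤ C := (norm_nonneg _).trans (h x hx 0 (Nat.zero_le _))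
  have hC' : 0 ≤ C' := (norm_nonneg _).trans (h' x hx 0 (Nat.zero_le _))
  refine (b.norm_iteratedFDeriv_le_of_bilinear_of_le_one (contDiff_comp_add_dil (s := s) hH x c)
    (contDiff_comp_add_dil (s := s) hH' x c) 0 (by exact_mod_cast le_top) hb).trans ?_
  calc _ ≤ ∑ i ∈ Finset.range (j + 1), (j.choose i : ℝ) * C * C' := by
        refine Finset.sum_le_sum fun i hi => ?_
        have := Finset.mem_range.1 hi
        gcongr
        · exact h x hx i (by omega)
        · exact h' x hx (j - i) (by omega)
    _ = 2 ^ j * (C * C') := by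
        simp only [mul_assoc]
        rw [← Finset.sum_mul]
        congr 1
        exact_mod_cast Nat.sum_range_choose j
    _ ≤ _ := by
        gcongr
        norm_num

end ScaledBd

/-- A test function at scale `l` annihilating the polynomials of degree at most `a` sees a function
living at the coarser scale `c` only at order `(l / c) ^ e` for some `e > a`. -/
theorem exists_avg_gain [CompleteSpace G] (hs : ∀ i, 1 ≤ s i) (a : ℝ) :
    ∃ (N : ℕ) (e A : ℝ), a < e ∧ 0 ≤ A ∧ ∀ (η : EuclideanSpace ℝ (Fin d) → ℝ), IsBump s η →
      (∀ y, |η y| ≤ 1) → Vanish s a η → ∀ (H : EuclideanSpace ℝ (Fin d) → G), ContDiff ℝ ∞ H →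
      ∀ (C c l R : ℝ), 0 < l → l ≤ c → c ≤ 1 → ScaledBd s H c (R + d) N C →
      ∀ x, ‖x‖ ≤ R → ‖avg s η l H x‖ ≤ A * C * (l / c) ^ e := by
  obtain ⟨N, e, A, he, hA, h⟩ := exists_taylor_gain (F := G) hs a
  refine ⟨N, e, A, he, hA, fun η hη hη1 hv H hH C c l R hl hlc hc1 hB x hx => ?_⟩
  have hc : 0 < c := hl.trans_le hlc
  have hq : 0 < l / c := div_pos hl hc
  have h2 : ∀ z, dil s l z = dil s c (dil s (l / c) z) := fun z => by
    rw [← dil_mul s hc.le hq.le, mul_div_cancel₀ _ hc.ne']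
  simp only [avg, h2]
  refine h η hη hη1 hv (fun z => H (x + dil s c z)) (contDiff_comp_add_dil hH x c) C (l / c) hq
    ((div_le_one hc).2 hlc) fun j hj z hz => hB.norm_le_at hj ?_
  exact (norm_add_le _ _).trans (add_le_add hx ((norm_dil_le_one hs hc hc1 z).trans hz))

/-- Averages against an even kernel are self-adjoint. -/
theorem integral_avg_adjoint (hs : ∀ i, 1 ≤ s i) {σ : EuclideanSpace ℝ (Fin d) → ℝ}
    (hσ : IsBump s σ) (heven : ∀ y, σ (-y) = σ y) {t : ℝ} (ht : 0 < t) (ht1 : t ≤ 1)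
    [CompleteSpace E] [CompleteSpace G]
    {h : EuclideanSpace ℝ (Fin d) → E →L[ℝ] G} (hh : Continuous h)
    (hsupp : ∀ y, (d : ℝ) < ‖y‖ → h y = 0) {v : EuclideanSpace ℝ (Fin d) → E}
    (hv : Continuous v) :
    ∫ y, h y (avg s σ t v y) = ∫ y, avg s σ t h y (v y) := by
  have hσc := hσ.smooth.continuous
  have hσs := hσ.hasCompactSupport hs
  have e1 : ∀ y, h y (avg s σ t v y) = ∫ z, σ z • h y (v (y + dil s t z)) := fun y => by
    rw [avg, ← ContinuousLinearMap.integral_comp_comm]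
    · simp only [map_smul]
    · exact (hσc.smul (by fun_prop : Continuous fun z =>
        v (y + dil s t z))).integrable_of_hasCompactSupport hσs.smul_right
  have e2 : ∀ y, avg s σ t h y (v y) = ∫ z, σ z • h (y - dil s t z) (v y) := fun y => by
    rw [avg, ContinuousLinearMap.integral_apply, ← integral_neg_eq_self]
    · simp only [heven, map_neg, ← sub_eq_add_neg, smul_apply]
    · exact (hσc.smul (by fun_prop : Continuous fun z =>
        h (y + dil s t z))).integrable_of_hasCompactSupport hσs.smul_right
  have s1 : ∫ y, ∫ z, σ z • h y (v (y + dil s t z)) =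
      ∫ z, ∫ y, σ z • h y (v (y + dil s t z)) := by
    refine integral_integral_swap_of_hasCompactSupport (by fun_prop) ?_
    refine HasCompactSupport.intro ((isCompact_closedBall (0 : EuclideanSpace ℝ (Fin d))
        (d : ℝ)).prod (isCompact_closedBall (0 : EuclideanSpace ℝ (Fin d)) (d : ℝ))) fun p hp => ?_
    simp only [mem_prod, mem_closedBall_zero_iff, not_and_or, not_le] at hp
    simp only [Function.uncurry_def]
    rcases hp with hp | hp
    · rw [hsupp _ hp]; simp
    · rw [hσ.eq_zero hs hp, zero_smul]
  have s2 : ∫ y, ∫ z, σ z • h (y - dil s t z) (v y) =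
      ∫ z, ∫ y, σ z • h (y - dil s t z) (v y) := by
    refine integral_integral_swap_of_hasCompactSupport (by fun_prop) ?_
    refine HasCompactSupport.intro ((isCompact_closedBall (0 : EuclideanSpace ℝ (Fin d))
      (d + d : ℝ)).prod (isCompact_closedBall (0 : EuclideanSpace ℝ (Fin d)) (d : ℝ))) fun p hp => ?_
    simp only [mem_prod, mem_closedBall_zero_iff, not_and_or, not_le] at hp
    simp only [Function.uncurry_def]
    by_cases hz : (d : ℝ) < ‖p.2‖
    · rw [hσ.eq_zero hs hz, zero_smul]
    · have h1 : (d : ℝ) < ‖p.1 - dil s t p.2‖ := by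
        have h2 := norm_sub_norm_le p.1 (dil s t p.2)
        have h3 := norm_dil_le_one hs ht ht1 p.2
        rcases hp with hp | hp <;> linarith
      rw [hsupp _ h1]
      simp
  simp only [e1, e2]
  rw [s1, s2]
  congr 1
  funext z
  rw [← integral_add_right_eq_self (fun y => σ z • h (y - dil s t z) (v y)) (dil s t z)]
  simp only [add_sub_cancel_right]

/-- `norm_integral_kernel_sub_le` at scale one, including the trivial order `N = 0`. -/
theorem norm_avg_kernel_sub_le [CompleteSpace F] (hs : ∀ i, 1 ≤ s i)
    {σ : EuclideanSpace ℝ (Fin d) → ℝ} (hσ : IsBump s σ) (hint : ∫ y, σ y = 1) {N : ℕ}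
    (hm : ∀ k : Fin d → ℕ, k ≠ 0 → ∑ i, s i * k i ≤ N * ∑ i, s i → ∫ y, σ y * mono k y = 0)
    {S : ℝ} (hS : ∀ y, |σ y| ≤ S)
    {G : EuclideanSpace ℝ (Fin d) → F} (hG : ContDiff ℝ ∞ G) {C : ℝ}
    (hC : ∀ z, ‖z‖ ≤ d → ‖iteratedFDeriv ℝ N G z‖ ≤ C) :
    ‖(∫ y, σ y • G y) - G 0‖ ≤
      (S * (d : ℝ) ^ N * volume.real (Metric.closedBall (0 : EuclideanSpace ℝ (Fin d)) d) + 1) * C := by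
  have hC0 : 0 ≤ C := (norm_nonneg _).trans (hC 0 (by simp))
  rcases Nat.eq_zero_or_pos N with rfl | hN
  · simp only [norm_iteratedFDeriv_zero] at hC
    have h1 := norm_integral_smul_le (χ := σ) (H := G) (fun y hy => hσ.eq_zero hs hy) hS hC
    have h2 := hC 0 (by simp)
    refine (norm_sub_le _ _).trans ((add_le_add h1 h2).trans_eq ?_)
    ring
  · have h := norm_integral_kernel_sub_le hs hσ hint hm hS hG one_pos le_rfl hN hC
    simp only [dil_one] at h
    refine h.trans ?_
    rw [add_mul, one_mul]
    refine le_add_of_le_of_nonneg (le_of_eq (by ring)) hC0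

theorem pow_mul_pow_le_add {a b : ℝ} (ha : 0 ≤ a) (hb : 0 ≤ b) {r i : ℕ} (hi : i ≤ r) :
    a ^ i * b ^ (r - i) ≤ a ^ r + b ^ r := by
  rcases le_total a b with h | h
  · calc a ^ i * b ^ (r - i) ≤ b ^ i * b ^ (r - i) := by gcongr
      _ = b ^ r := by rw [← pow_add]; congr 1; omega
      _ ≤ _ := le_add_of_nonneg_left (pow_nonneg ha r)
  · calc a ^ i * b ^ (r - i) ≤ a ^ i * a ^ (r - i) := by gcongr
      _ = a ^ r := by rw [← pow_add]; congr 1; omega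
      _ ≤ _ := le_add_of_nonneg_right (pow_nonneg hb r)

/-- The resonant estimate. The oscillation `v - avg σ μ v` of `v` at the scale `μ` is paired with
the product of a test function at scale `l ≥ μ` and a function `W` at scale `ν ≥ μ`; moving the
operator `1 - avg σ μ` to these coarser factors gains `r` derivatives. -/
theorem exists_resonant [CompleteSpace E] [CompleteSpace G] (hs : ∀ i, 1 ≤ s i)
    {σ : EuclideanSpace ℝ (Fin d) → ℝ} (hσ : IsBump s σ) (heven : ∀ y, σ (-y) = σ y)
    (hint : ∫ y, σ y = 1) {r : ℕ}
    (hm : ∀ k : Fin d → ℕ, k ≠ 0 → ∑ i, s i * k i ≤ r * ∑ i, s i → ∫ y, σ y * mono k y = 0) :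
    ∃ A : ℝ, 0 ≤ A ∧ ∀ (η : EuclideanSpace ℝ (Fin d) → ℝ), IsBump s η →
      (∀ j ≤ r, ∀ y, ‖iteratedFDeriv ℝ j η y‖ ≤ 1) → ∀ (b : E →L[ℝ] F →L[ℝ] G), ‖b‖ ≤ 1 →
      ∀ (v : EuclideanSpace ℝ (Fin d) → E), Continuous v →
      ∀ (W : EuclideanSpace ℝ (Fin d) → F), ContDiff ℝ ∞ W →
      ∀ (l μ ν R V D : ℝ), 0 < μ → μ ≤ l → l ≤ 1 → μ ≤ ν → ν ≤ 1 →
      (∀ x, ‖x‖ ≤ R + 3 * d → ‖v x‖ ≤ V) → ScaledBd s W ν (R + 3 * d) r D →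
      ∀ x, ‖x‖ ≤ R → ‖avg s η l (fun y => b (v y - avg s σ μ v y) (W y)) x‖ ≤
        A * (V * D * ((μ / l) ^ r + (μ / ν) ^ r)) := by
  obtain ⟨S, hS0, hS⟩ := exists_bound_iteratedFDeriv hσ.smooth (hσ.hasCompactSupport hs) 0
  have hS : ∀ y, |σ y| ≤ S := fun y => by simpa using hS 0 le_rfl y
  set V1 := volume.real (Metric.closedBall (0 : EuclideanSpace ℝ (Fin d)) d)
  set V2 := volume.real (Metric.closedBall (0 : EuclideanSpace ℝ (Fin d)) (d + d))
  have hV1 : 0 ≤ V1 := measureReal_nonneg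
  have hV2 : 0 ≤ V2 := measureReal_nonneg
  refine ⟨(S * (d : ℝ) ^ r * V1 + 1) * 2 ^ r * V2, by positivity, ?_⟩
  intro η hη hη1 b hb v hv W hW l μ ν R V D hμ hμl hl1 hμν hν1 hvV hWD x hx
  have hl : 0 < l := hμ.trans_le hμl
  have hν : 0 < ν := hμ.trans_le hμν
  have hμ1 : μ ≤ 1 := hμl.trans hl1
  set t := μ / l with ht
  have ht0 : 0 < t := div_pos hμ hl
  have ht1 : t ≤ 1 := (div_le_one hl).2 hμl
  have hdil : ∀ z, dil s l (dil s t z) = dil s μ z := fun z => by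
    rw [← dil_mul s hl.le ht0.le, ht, mul_div_cancel₀ _ hl.ne']
  have hηc := hη.smooth.continuous
  have hηs := hη.hasCompactSupport hs
  let h : EuclideanSpace ℝ (Fin d) → E →L[ℝ] G := fun y => η y • b.flip (W (x + dil s l y))
  have hhsm : ContDiff ℝ ∞ h :=
    hη.smooth.smul (b.flip.contDiff.comp (contDiff_comp_add_dil hW x l))
  have hh0 : ∀ y, (d : ℝ) < ‖y‖ → h y = 0 := fun y hy => by
    simp only [h, hη.eq_zero hs hy, zero_smul]
  let w : EuclideanSpace ℝ (Fin d) → E := fun y => v (x + dil s l y)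
  have hwc : Continuous w := by fun_prop
  have hhs : HasCompactSupport h :=
    HasCompactSupport.intro (isCompact_closedBall (0 : EuclideanSpace ℝ (Fin d)) (d : ℝ))
      fun y hy => hh0 y (by simpa using hy)
  have hav : ∀ y, avg s σ μ v (x + dil s l y) = avg s σ t w y := fun y => by
    simp only [avg, w, map_add, hdil, add_assoc]
  have hawc : Continuous (avg s σ t w) := (contDiff_avg hs hσ ht0 hwc).continuous
  have hahc : Continuous (avg s σ t h) := (contDiff_avg hs hσ ht0 hhsm.continuous).continuous
  have hahs : ∀ y, (d + d : ℝ) < ‖y‖ → avg s σ t h y = 0 := fun y hy => by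
    rw [avg]
    refine integral_eq_zero_of_ae (Eventually.of_forall fun z => ?_)
    by_cases hz : (d : ℝ) < ‖z‖
    · simp [hσ.eq_zero hs hz]
    · have h1 : (d : ℝ) < ‖y + dil s t z‖ := by
        have h2 := norm_sub_le (y + dil s t z) (dil s t z)
        rw [add_sub_cancel_right] at h2
        have h3 := norm_dil_le_one hs ht0 ht1 z
        linarith
      simp [hh0 _ h1]
  have key : avg s η l (fun y => b (v y - avg s σ μ v y) (W y)) x =
      ∫ y, (h y - avg s σ t h y) (w y) := by
    have i1 : Integrable fun y => h y (w y) :=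
      (hhsm.continuous.clm_apply hwc).integrable_of_hasCompactSupport
        (hhs.mono fun y hy h0 => hy (by simp [h0]))
    have i2 : Integrable fun y => h y (avg s σ t w y) :=
      (hhsm.continuous.clm_apply hawc).integrable_of_hasCompactSupport
        (hhs.mono fun y hy h0 => hy (by simp [h0]))
    have i3 : Integrable fun y => avg s σ t h y (w y) := by
      refine (hahc.clm_apply hwc).integrable_of_hasCompactSupport
        (HasCompactSupport.intro (isCompact_closedBall (0 : EuclideanSpace ℝ (Fin d)) (d + d : ℝ))
          fun y hy => ?_)
      rw [hahs y (by simpa using hy)]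
      simp
    simp only [sub_apply]
    rw [integral_sub i1 i3, ← integral_avg_adjoint hs hσ heven ht0 ht1 hhsm.continuous hh0 hwc,
      ← integral_sub i1 i2, avg]
    refine integral_congr_ae (Eventually.of_forall fun y => ?_)
    simp only [hav, h, w, smul_apply, ContinuousLinearMap.flip_apply, map_sub,
      sub_apply, smul_sub]
  have hR : ∀ y z : EuclideanSpace ℝ (Fin d), ‖y‖ ≤ d + d → ‖z‖ ≤ d →
      ‖x + dil s l y + dil s μ z‖ ≤ R + 3 * d := fun y z hy hz => by
    have h1 := norm_add₃_le (a := x) (b := dil s l y) (c := dil s μ z)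
    have h2 := norm_dil_le_one hs hl hl1 y
    have h3 := norm_dil_le_one hs hμ hμ1 z
    linarith
  have hD0 : 0 ≤ D := (norm_nonneg _).trans (hWD.norm_le (x := x) (by
    have : (0 : ℝ) ≤ d := Nat.cast_nonneg d
    linarith))
  have hbf : ‖b.flip‖ ≤ 1 := by rwa [ContinuousLinearMap.opNorm_flip]
  set Q := (μ / l) ^ r + (μ / ν) ^ r with hQ
  have hderiv : ∀ y z : EuclideanSpace ℝ (Fin d), ‖y‖ ≤ d + d → ‖z‖ ≤ d →
      ‖iteratedFDeriv ℝ r (fun z => h (y + dil s t z)) z‖ ≤ 2 ^ r * (D * Q) := fun y z hy hz => by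
    have hfun : (fun z => h (y + dil s t z)) = fun z => η (y + dil s t z) •
        b.flip (W (x + dil s l y + dil s μ z)) := by
      funext z
      simp only [h, map_add, hdil, add_assoc]
    have c1 : ContDiff ℝ ∞ fun z => η (y + dil s t z) := contDiff_comp_add_dil hη.smooth y t
    have c2 : ContDiff ℝ ∞ fun z => W (x + dil s l y + dil s μ z) := contDiff_comp_add_dil hW _ μ
    rw [hfun]
    refine (norm_iteratedFDeriv_smul_le (n := r) c1 (b.flip.contDiff.comp c2) z
      (by exact_mod_cast le_top)).trans ?_
    calc _ ≤ ∑ i ∈ Finset.range (r + 1), (r.choose i : ℝ) * (D * Q) := by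
          refine Finset.sum_le_sum fun i hi => ?_
          have hi' : i ≤ r := Nat.lt_succ_iff.1 (Finset.mem_range.1 hi)
          have n1 : ‖iteratedFDeriv ℝ i (fun z => η (y + dil s t z)) z‖ ≤ t ^ i := by
            have := norm_iteratedFDeriv_comp_dil_le hs
              (g := fun z => η (y + z)) (hη.smooth.comp (contDiff_const.add contDiff_id)) ht0 ht1 i z
            refine this.trans (mul_le_of_le_one_right (pow_nonneg ht0.le i) ?_)
            rw [iteratedFDeriv_comp_add_left]
            exact hη1 i hi' _
          have n2 : ‖iteratedFDeriv ℝ (r - i)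
              (fun z => b.flip (W (x + dil s l y + dil s μ z))) z‖ ≤ (μ / ν) ^ (r - i) * D := by
            refine (b.flip.norm_iteratedFDeriv_comp_left (N := ∞) c2.contDiffAt
              (WithTop.coe_le_coe.2 (le_top : ((r - i : ℕ) : ℕ∞) ≤ ⊤))).trans ?_
            refine (mul_le_of_le_one_left (norm_nonneg _) hbf).trans ?_
            exact hWD.norm_le_finer hs hW hν hμ hμν (Nat.sub_le r i) (hR y z hy hz)
          have n3 := pow_mul_pow_le_add ht0.le (div_pos hμ hν).le hi'
          calc _ ≤ (r.choose i : ℝ) * t ^ i * ((μ / ν) ^ (r - i) * D) := by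
                gcongr
                exact n2
            _ = (r.choose i : ℝ) * (D * (t ^ i * (μ / ν) ^ (r - i))) := by ring
            _ ≤ _ := by gcongr
      _ = _ := by
          rw [← Finset.sum_mul]
          congr 1
          exact_mod_cast Nat.sum_range_choose r
  have hdiff : ∀ y, ‖y‖ ≤ d + d → ‖(h y - avg s σ t h y) (w y)‖ ≤
      ((S * (d : ℝ) ^ r * V1 + 1) * (2 ^ r * (D * Q))) * V := fun y hy => by
    have h1 := norm_avg_kernel_sub_le hs hσ hint hm hS
      (contDiff_comp_add_dil (s := s) hhsm y t) (fun z hz => hderiv y z hy hz)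
    simp only [map_zero, add_zero] at h1
    refine (ContinuousLinearMap.le_opNorm _ _).trans ?_
    have h2 : ‖w y‖ ≤ V := hvV _ (by simpa using hR y 0 hy (by simp))
    rw [norm_sub_rev]
    have : 0 ≤ ‖avg s σ t h y - h y‖ := norm_nonneg _
    exact mul_le_mul h1 h2 (norm_nonneg _) (this.trans h1)
  rw [key]
  have hset : ∫ y, (h y - avg s σ t h y) (w y) =
      ∫ y in Metric.closedBall (0 : EuclideanSpace ℝ (Fin d)) (d + d),
        (h y - avg s σ t h y) (w y) := by
    rw [setIntegral_eq_integral_of_forall_compl_eq_zero]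
    intro y hy
    have hy' : (d + d : ℝ) < ‖y‖ := by simpa using hy
    have hd0 : (0 : ℝ) ≤ d := Nat.cast_nonneg d
    rw [hahs y hy', hh0 y (by linarith)]
    simp
  rw [hset]
  refine (norm_setIntegral_le_of_norm_le_const measure_closedBall_lt_top
    fun y hy => hdiff y (by simpa using hy)).trans_eq ?_
  simp only [V1, V2]
  ring

end

/-! ### Littlewood–Paley decomposition -/

section

variable {d : ℕ} {E F G : Type*} [NormedAddCommGroup E] [NormedSpace ℝ E]
  [NormedAddCommGroup F] [NormedSpace ℝ F] [NormedAddCommGroup G] [NormedSpace ℝ G]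
  {s : Fin d → ℝ}

/-- The dyadic scale `2 ^ (-n)`. -/
def dy (n : ℕ) : ℝ := 2⁻¹ ^ n

theorem dy_pos (n : ℕ) : 0 < dy n := by unfold dy; positivity

theorem dy_le_one (n : ℕ) : dy n ≤ 1 := pow_le_one₀ (by norm_num) (by norm_num)

theorem dy_zero : dy 0 = 1 := by simp [dy]

theorem dy_succ (n : ℕ) : dy (n + 1) = dy n * 2⁻¹ := pow_succ _ _

theorem dy_succ_le (n : ℕ) : dy (n + 1) ≤ dy n := by
  rw [dy_succ]; have := dy_pos n; linarith

theorem dy_anti : Antitone dy := antitone_nat_of_succ_le dy_succ_le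

theorem tendsto_dy : Tendsto dy atTop (𝓝 0) :=
  tendsto_pow_atTop_nhds_zero_of_lt_one (by norm_num) (by norm_num)

theorem dy_rpow (n : ℕ) (p : ℝ) : dy n ^ p = ((2⁻¹ : ℝ) ^ p) ^ n := by
  rw [dy, ← Real.rpow_natCast, ← Real.rpow_natCast, ← Real.rpow_mul (by norm_num),
    ← Real.rpow_mul (by norm_num), mul_comm]

/-- Positive powers of the dyadic scales finer than `l` sum to the power of `l`. -/
theorem sum_dy_rpow_fine {p : ℝ} (hp : 0 < p) :
    ∃ A, 0 ≤ A ∧ ∀ (T : Finset ℕ) (l : ℝ), 0 < l → (∀ k ∈ T, dy k ≤ l) →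
      ∑ k ∈ T, dy k ^ p ≤ A * l ^ p := by
  set q : ℝ := (2⁻¹ : ℝ) ^ p with hq
  have hq0 : 0 ≤ q := Real.rpow_nonneg (by norm_num) _
  have hq1 : q < 1 := Real.rpow_lt_one (by norm_num) (by norm_num) hp
  have hsum := summable_geometric_of_lt_one hq0 hq1
  refine ⟨(1 - q)⁻¹, by rw [inv_nonneg]; linarith, fun T l hl hT => ?_⟩
  rcases T.eq_empty_or_nonempty with rfl | hne
  · have : 0 < 1 - q := by linarith
    simp only [Finset.sum_empty]
    positivity
  · set k0 := T.min' hne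
    have h1 : ∑ k ∈ T, dy k ^ p = q ^ k0 * ∑ k ∈ T, q ^ (k - k0) := by
      rw [Finset.mul_sum]
      refine Finset.sum_congr rfl fun k hk => ?_
      rw [dy_rpow, ← hq, ← pow_add, Nat.add_sub_cancel' (T.min'_le k hk)]
    have h2 : ∑ k ∈ T, q ^ (k - k0) ≤ (1 - q)⁻¹ := by
      rw [← tsum_geometric_of_lt_one hq0 hq1]
      rw [← Finset.sum_image (f := fun k => q ^ k) (g := fun k => k - k0) (s := T)]
      · exact hsum.sum_le_tsum _ fun _ _ => pow_nonneg hq0 _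
      · intro a ha b hb hab
        have h3 := T.min'_le a ha
        have h4 := T.min'_le b hb
        simp only at hab
        omega
    rw [h1, mul_comm, hq, ← dy_rpow]
    have h3 : dy k0 ^ p ≤ l ^ p :=
      Real.rpow_le_rpow (dy_pos _).le (hT k0 (T.min'_mem hne)) hp.le
    have h4 : 0 ≤ dy k0 ^ p := Real.rpow_nonneg (dy_pos _).le _
    rw [← hq]
    have : 0 ≤ (1 - q)⁻¹ := by rw [inv_nonneg]; linarith
    exact mul_le_mul h2 h3 h4 this

/-- Negative powers of the dyadic scales coarser than `l` sum to the power of `l`. -/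
theorem sum_dy_rpow_coarse {p : ℝ} (hp : p < 0) :
    ∃ A, 0 ≤ A ∧ ∀ (T : Finset ℕ) (l : ℝ), 0 < l → (∀ k ∈ T, l ≤ dy k) →
      ∑ k ∈ T, dy k ^ p ≤ A * l ^ p := by
  set q : ℝ := (2⁻¹ : ℝ) ^ (-p) with hq
  have hq0 : 0 < q := Real.rpow_pos_of_pos (by norm_num) _
  have hq1 : q < 1 := Real.rpow_lt_one (by norm_num) (by norm_num) (by linarith)
  have hsum := summable_geometric_of_lt_one hq0.le hq1
  have hinv : ∀ k, dy k ^ p = (q ^ k)⁻¹ := fun k => by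
    rw [hq, ← dy_rpow, ← Real.rpow_neg (dy_pos k).le, neg_neg]
  refine ⟨(1 - q)⁻¹, by rw [inv_nonneg]; linarith, fun T l hl hT => ?_⟩
  rcases T.eq_empty_or_nonempty with rfl | hne
  · have : 0 < 1 - q := by linarith
    simp only [Finset.sum_empty]
    positivity
  · set k0 := T.max' hne
    have h1 : ∑ k ∈ T, dy k ^ p = (q ^ k0)⁻¹ * ∑ k ∈ T, q ^ (k0 - k) := by
      rw [Finset.mul_sum]
      refine Finset.sum_congr rfl fun k hk => ?_
      rw [hinv, pow_sub₀ q hq0.ne' (T.le_max' k hk)]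
      field_simp
      rfl
    have h2 : ∑ k ∈ T, q ^ (k0 - k) ≤ (1 - q)⁻¹ := by
      rw [← tsum_geometric_of_lt_one hq0.le hq1]
      rw [← Finset.sum_image (f := fun k => q ^ k) (g := fun k => k0 - k) (s := T)]
      · exact hsum.sum_le_tsum _ fun _ _ => pow_nonneg hq0.le _
      · intro a ha b hb hab
        have h3 := T.le_max' a ha
        have h4 := T.le_max' b hb
        simp only at hab
        omega
    rw [h1, mul_comm, ← hinv]
    have h3 : dy k0 ^ p ≤ l ^ p :=
      Real.rpow_le_rpow_of_nonpos hl (hT k0 (T.max'_mem hne)) hp.le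
    have h4 : 0 ≤ dy k0 ^ p := Real.rpow_nonneg (dy_pos _).le _
    have : 0 ≤ (1 - q)⁻¹ := by rw [inv_nonneg]; linarith
    exact mul_le_mul h2 h3 h4 this

/-- An even mollifier whose non-constant moments of scaled degree at most `M` vanish. -/
structure IsMollifier (s : Fin d → ℝ) (M : ℝ) (σ : EuclideanSpace ℝ (Fin d) → ℝ) : Prop where
  isBump : IsBump s σ
  even : ∀ y, σ (-y) = σ y
  integral_eq : ∫ y, σ y = 1
  moment : ∀ k : Fin d → ℕ, k ≠ 0 → ∑ i, s i * k i ≤ M → ∫ y, σ y * mono k y = 0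

/-- The difference of the averages at the scales `2 ^ (-n - 1)` and `2 ^ (-n)`, as an average. -/
def lpV (s : Fin d → ℝ) (σ : EuclideanSpace ℝ (Fin d) → ℝ) (n : ℕ)
    (f : EuclideanSpace ℝ (Fin d) → E) : EuclideanSpace ℝ (Fin d) → E :=
  avg s (fun y => shr s σ y - σ y) (dy n) f

/-- The Littlewood–Paley block `lpP (n + 1) - lpP n`. -/
def lpU (s : Fin d → ℝ) (σ : EuclideanSpace ℝ (Fin d) → ℝ) (n : ℕ)
    (f : EuclideanSpace ℝ (Fin d) → E) (x : EuclideanSpace ℝ (Fin d)) : E :=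
  (lpV s σ n f x - avg s σ (dy n) (lpV s σ n f) x) +
    (lpV s σ n f x - avg s σ (dy (n + 1)) (lpV s σ n f) x)

/-- The approximation `1 - (1 - a) ^ 2` of the identity, where `a` is averaging at the scale
`2 ^ (-n)`. The square provides each block `lpU` with two oscillating factors. -/
def lpP (s : Fin d → ℝ) (σ : EuclideanSpace ℝ (Fin d) → ℝ) (n : ℕ)
    (f : EuclideanSpace ℝ (Fin d) → E) (x : EuclideanSpace ℝ (Fin d)) : E :=
  avg s σ (dy n) f x - (avg s σ (dy n) (avg s σ (dy n) f) x - avg s σ (dy n) f x)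

section LP

variable {σ : EuclideanSpace ℝ (Fin d) → ℝ} {M : ℝ}

theorem contDiff_lpV [CompleteSpace E] (hs : ∀ i, 1 ≤ s i) (hσ : IsBump s σ) (n : ℕ)
    {f : EuclideanSpace ℝ (Fin d) → E} (hf : Continuous f) : ContDiff ℝ ∞ (lpV s σ n f) :=
  contDiff_avg hs ((hσ.shr hs).sub hσ) (dy_pos n) hf

theorem contDiff_lpU [CompleteSpace E] (hs : ∀ i, 1 ≤ s i) (hσ : IsBump s σ) (n : ℕ)
    {f : EuclideanSpace ℝ (Fin d) → E} (hf : Continuous f) : ContDiff ℝ ∞ (lpU s σ n f) :=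
  have h := contDiff_lpV hs hσ n hf
  (h.sub (contDiff_avg hs hσ (dy_pos n) h.continuous)).add
    (h.sub (contDiff_avg hs hσ (dy_pos (n + 1)) h.continuous))

theorem contDiff_lpP [CompleteSpace E] (hs : ∀ i, 1 ≤ s i) (hσ : IsBump s σ) (n : ℕ)
    {f : EuclideanSpace ℝ (Fin d) → E} (hf : Continuous f) : ContDiff ℝ ∞ (lpP s σ n f) :=
  have h := contDiff_avg hs hσ (dy_pos n) hf
  h.sub ((contDiff_avg hs hσ (dy_pos n) h.continuous).sub h)

theorem avg_shr (s : Fin d → ℝ) (σ : EuclideanSpace ℝ (Fin d) → ℝ) (n : ℕ)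
    (f : EuclideanSpace ℝ (Fin d) → E) (x : EuclideanSpace ℝ (Fin d)) :
    avg s (shr s σ) (dy n) f x = avg s σ (dy (n + 1)) f x := by
  rw [avg, integral_shr_smul s σ fun z => f (x + dil s (dy n) z), avg]
  simp only [dy_succ, dil_mul s (dy_pos n).le (by norm_num : (0 : ℝ) ≤ 2⁻¹)]

theorem lpV_eq (hs : ∀ i, 1 ≤ s i) (hσ : IsBump s σ) (n : ℕ)
    {f : EuclideanSpace ℝ (Fin d) → E} (hf : Continuous f) :
    lpV s σ n f = fun x => avg s σ (dy (n + 1)) f x - avg s σ (dy n) f x := by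
  funext x
  rw [← avg_shr, lpV]
  simp only [avg, sub_smul]
  exact integral_sub
    (((hσ.shr hs).smooth.continuous.smul (by fun_prop : Continuous fun z =>
      f (x + dil s (dy n) z))).integrable_of_hasCompactSupport
      ((hσ.shr hs).hasCompactSupport hs).smul_right)
    ((hσ.smooth.continuous.smul (by fun_prop : Continuous fun z =>
      f (x + dil s (dy n) z))).integrable_of_hasCompactSupport
      (hσ.hasCompactSupport hs).smul_right)

theorem lpP_succ_sub [CompleteSpace E] (hs : ∀ i, 1 ≤ s i) (hσ : IsBump s σ) (n : ℕ)
    {f : EuclideanSpace ℝ (Fin d) → E} (hf : Continuous f) (x : EuclideanSpace ℝ (Fin d)) :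
    lpP s σ (n + 1) f x = lpP s σ n f x + lpU s σ n f x := by
  have h1 := (contDiff_avg hs hσ (dy_pos n) hf).continuous
  have h2 := (contDiff_avg hs hσ (dy_pos (n + 1)) hf).continuous
  simp only [lpP, lpU, lpV_eq hs hσ n hf, avg_sub_fun hs hσ _ h2 h1]
  rw [avg_comm hs hσ hσ (dy (n + 1)) (dy n) hf]
  abel

theorem lpP_eq_sum [CompleteSpace E] (hs : ∀ i, 1 ≤ s i) (hσ : IsBump s σ) (n : ℕ)
    {f : EuclideanSpace ℝ (Fin d) → E} (hf : Continuous f) (x : EuclideanSpace ℝ (Fin d)) :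
    lpP s σ n f x = lpP s σ 0 f x + ∑ k ∈ Finset.range n, lpU s σ k f x := by
  induction n with
  | zero => simp
  | succ n ih => rw [lpP_succ_sub hs hσ n hf, ih, Finset.sum_range_succ, add_assoc]

theorem exists_abs_le (hs : ∀ i, 1 ≤ s i) (hσ : IsBump s σ) : ∃ S, 0 ≤ S ∧ ∀ y, |σ y| ≤ S := by
  obtain ⟨S, hS0, hS⟩ := exists_bound_iteratedFDeriv hσ.smooth (hσ.hasCompactSupport hs) 0
  exact ⟨S, hS0, fun y => by simpa using hS 0 le_rfl y⟩

/-- The blocks of a function of regularity `α` have size `2 ^ (-n α)`, with all derivatives at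
scale `2 ^ (-n)`. -/
theorem exists_scaledBd_lpU [CompleteSpace E] (hs : ∀ i, 1 ≤ s i) (hσ : IsMollifier s M σ)
    {α : ℝ} (hα : α ≤ M) (r N : ℕ) :
    ∃ A, 0 ≤ A ∧ ∀ (f : EuclideanSpace ℝ (Fin d) → E), Continuous f → ∀ (R C : ℝ), 0 ≤ C →
      HolderBd s α r f (R + d) C → ∀ n, ScaledBd s (lpU s σ n f) (dy n) R N (A * C * dy n ^ α) := by
  obtain ⟨S, hS0, hS⟩ := exists_abs_le hs hσ.isBump
  have hψ := (hσ.isBump.shr hs).sub hσ.isBump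
  obtain ⟨B, hB0, hB⟩ := exists_bound_iteratedFDeriv hψ.smooth (hψ.hasCompactSupport hs) (N + r)
  set V := volume.real (Metric.closedBall (0 : EuclideanSpace ℝ (Fin d)) d)
  have hV : 0 ≤ V := measureReal_nonneg
  refine ⟨B * ((1 + S * V) + (S * V + 1)), by positivity, fun f hf R C hC h n => ?_⟩
  have hR : HolderBd s α r f R C := h.mono (by simp)
  have h1 := h.avg hs hf hσ.isBump hS (dy_pos n) (dy_le_one n)
  have h2 := h.avg hs hf hσ.isBump hS (dy_pos (n + 1)) (dy_le_one (n + 1))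
  have c1 := (contDiff_avg hs hσ.isBump (dy_pos n) hf).continuous
  have c2 := (contDiff_avg hs hσ.isBump (dy_pos (n + 1)) hf).continuous
  have h3 := (hR.sub hs h1 hf c1).sub hs (h2.sub hs hR c2 hf) (hf.sub c1) (c2.sub hf)
  have h4 := h3.scaledBd_avg hs (by positivity) ((hf.sub c1).sub (c2.sub hf)) hψ
    ((vanish_shr_sub hs hσ.isBump hσ.moment).mono_le hα) hB (dy_pos n) (dy_le_one n)
  -- averages commute, so the block is an average of `f` minus averages of `f`, against the kernel with
  -- vanishing moments
  have h5 : lpU s σ n f = avg s (fun y => shr s σ y - σ y) (dy n)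
      (fun y => (f y - avg s σ (dy n) f y) - (avg s σ (dy (n + 1)) f y - f y)) := by
    funext x
    have c3 : Continuous fun y => f y - avg s σ (dy n) f y := hf.sub c1
    have c4 : Continuous fun y => avg s σ (dy (n + 1)) f y - f y := c2.sub hf
    rw [avg_sub_fun hs hψ _ c3 c4, avg_sub_fun hs hψ _ hf c1,
      avg_sub_fun hs hψ _ c2 hf, avg_comm hs hψ hσ.isBump _ _ hf,
      avg_comm hs hψ hσ.isBump _ _ hf, lpU, lpV]
    abel
  rw [h5]
  refine h4.weaken le_rfl (le_of_eq ?_)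
  simp only [V]
  ring

/-- The low frequency part at scale one is controlled by the part of the Hölder bound that concerns test
functions without vanishing moments. -/
theorem exists_scaledBd_lpP_zero [CompleteSpace E] (hs : ∀ i, 1 ≤ s i) (hσ : IsMollifier s M σ)
    (α : ℝ) (r N : ℕ) :
    ∃ A, 0 ≤ A ∧ ∀ (f : EuclideanSpace ℝ (Fin d) → E), Continuous f → ∀ (R C : ℝ), 0 ≤ C →
      HolderBd s α r f (R + d) C → ScaledBd s (lpP s σ 0 f) 1 R N (A * C) := by
  obtain ⟨S, hS0, hS⟩ := exists_abs_le hs hσ.isBump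
  obtain ⟨B, hB0, hB⟩ := exists_bound_iteratedFDeriv hσ.isBump.smooth
    (hσ.isBump.hasCompactSupport hs) (N + r)
  set V := volume.real (Metric.closedBall (0 : EuclideanSpace ℝ (Fin d)) d)
  have hV : 0 ≤ V := measureReal_nonneg
  refine ⟨B * (1 + (S * V + 1)), by positivity, fun f hf R C hC h => ?_⟩
  have hR : HolderBd s α r f R C := h.mono (by simp)
  have h1 := h.avg hs hf hσ.isBump hS one_pos le_rfl
  have c1 := (contDiff_avg hs hσ.isBump one_pos hf).continuous
  have h3 := hR.sub hs (h1.sub hs hR c1 hf) hf (c1.sub hf)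
  have h4 := h3.scaledBd_avg_one hs (by positivity) (hf.sub (c1.sub hf)) hσ.isBump hB
  have h5 : lpP s σ 0 f = avg s σ 1 (fun y => f y - (avg s σ 1 f y - f y)) := by
    funext x
    have c3 : Continuous fun y => avg s σ 1 f y - f y := c1.sub hf
    rw [avg_sub_fun hs hσ.isBump _ hf c3, avg_sub_fun hs hσ.isBump _ c1 hf, lpP, dy_zero]
  rw [h5]
  refine h4.weaken le_rfl (le_of_eq ?_)
  simp only [V]
  ring

theorem exists_norm_lpV_le [CompleteSpace E] (hs : ∀ i, 1 ≤ s i) (hσ : IsMollifier s M σ)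
    {α : ℝ} (hα : α ≤ M) (r : ℕ) :
    ∃ A, 0 ≤ A ∧ ∀ (f : EuclideanSpace ℝ (Fin d) → E), Continuous f → ∀ (R C : ℝ), 0 ≤ C →
      HolderBd s α r f R C → ∀ n x, ‖x‖ ≤ R → ‖lpV s σ n f x‖ ≤ A * C * dy n ^ α := by
  have hψ := (hσ.isBump.shr hs).sub hσ.isBump
  obtain ⟨B, hB0, hB⟩ := exists_bound_iteratedFDeriv hψ.smooth (hψ.hasCompactSupport hs) r
  refine ⟨B, hB0, fun f hf R C hC h n x hx => ?_⟩
  exact (h.scaledBd_avg hs hC hf hψ ((vanish_shr_sub hs hσ.isBump hσ.moment).mono_le hα)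
    (N := 0) (by simpa using hB) (dy_pos n) (dy_le_one n)).norm_le hx

theorem exists_avg_approx [CompleteSpace E] (hs : ∀ i, 1 ≤ s i) (hσ : IsBump s σ)
    (hint : ∫ y, σ y = 1) {f : EuclideanSpace ℝ (Fin d) → E} (hf : Continuous f) (R : ℝ) {ε : ℝ}
    (hε : 0 < ε) :
    ∃ n₀, ∀ n ≥ n₀, ∀ x, ‖x‖ ≤ R → ‖avg s σ (dy n) f x - f x‖ ≤ ε := by
  obtain ⟨S, hS0, hS⟩ := exists_abs_le hs hσ
  set V := volume.real (Metric.closedBall (0 : EuclideanSpace ℝ (Fin d)) d) with hVdef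
  have hV : 0 ≤ V := measureReal_nonneg
  have huc := (isCompact_closedBall (0 : EuclideanSpace ℝ (Fin d)) (R + d)).uniformContinuousOn_of_continuous
    hf.continuousOn
  rw [Metric.uniformContinuousOn_iff] at huc
  obtain ⟨δ, hδ, huc⟩ := huc (ε / (S * V + 1)) (by positivity)
  have hev : ∀ᶠ n in atTop, dy n < δ / (d + 1) := tendsto_dy.eventually_lt_const (by positivity)
  obtain ⟨n₀, hn₀⟩ := eventually_atTop.1 hev
  refine ⟨n₀, fun n hn x hx => ?_⟩
  have hσi : Integrable σ := hσ.smooth.continuous.integrable_of_hasCompactSupport (hσ.hasCompactSupport hs)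
  have h1 : avg s σ (dy n) f x - f x = ∫ z, σ z • (f (x + dil s (dy n) z) - f x) := by
    simp only [smul_sub]
    rw [integral_sub, integral_smul_const, hint, one_smul, avg]
    · exact (hσ.smooth.continuous.smul (by fun_prop : Continuous fun z =>
        f (x + dil s (dy n) z))).integrable_of_hasCompactSupport (hσ.hasCompactSupport hs).smul_right
    · exact hσi.smul_const _
  rw [h1]
  have hd0 : (0 : ℝ) ≤ d := Nat.cast_nonneg d
  refine (norm_integral_smul_le (fun y hy => hσ.eq_zero hs hy) hS (B := ε / (S * V + 1))
    fun z hz => ?_).trans ?_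
  · rw [← dist_eq_norm]
    have h2 := norm_dil_le hs (dy_pos n) (dy_le_one n) z
    have h3 : ‖dil s (dy n) z‖ < δ := by
      have h4 := hn₀ n hn
      rw [lt_div_iff₀ (by positivity)] at h4
      have h5 : dy n * ‖z‖ ≤ dy n * d := by have := dy_pos n; gcongr
      have := dy_pos n
      linarith
    refine (huc _ ?_ _ ?_ ?_).le
    · rw [mem_closedBall_zero_iff]
      refine (norm_add_le _ _).trans (add_le_add hx ?_)
      exact (norm_dil_le_one hs (dy_pos n) (dy_le_one n) z).trans hz
    · rw [mem_closedBall_zero_iff]; linarith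
    · simpa [dist_eq_norm] using h3
  · rw [← hVdef]
    have : S * (ε / (S * V + 1)) * V = ε * ((S * V) / (S * V + 1)) := by ring
    rw [this]
    refine mul_le_of_le_one_right hε.le ?_
    rw [div_le_one (by positivity)]
    linarith

theorem exists_lpP_approx [CompleteSpace E] (hs : ∀ i, 1 ≤ s i) (hσ : IsBump s σ)
    (hint : ∫ y, σ y = 1) {f : EuclideanSpace ℝ (Fin d) → E} (hf : Continuous f) (R : ℝ) {ε : ℝ}
    (hε : 0 < ε) :
    ∃ n₀, ∀ n ≥ n₀, ∀ x, ‖x‖ ≤ R → ‖lpP s σ n f x - f x‖ ≤ ε := by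
  obtain ⟨S, hS0, hS⟩ := exists_abs_le hs hσ
  set V := volume.real (Metric.closedBall (0 : EuclideanSpace ℝ (Fin d)) d) with hVdef
  have hV : 0 ≤ V := measureReal_nonneg
  have hε' : 0 < ε / (S * V + 1) := by positivity
  obtain ⟨n₀, hn₀⟩ := exists_avg_approx hs hσ hint hf (R + d) hε'
  refine ⟨n₀, fun n hn x hx => ?_⟩
  have hd0 : (0 : ℝ) ≤ d := Nat.cast_nonneg d
  have c1 := (contDiff_avg hs hσ (dy_pos n) hf).continuous
  have h1 := norm_avg_le hs hσ hS (dy_pos n) (dy_le_one n) (R := R)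
    (f := fun y => avg s σ (dy n) f y - f y) (hn₀ n hn) hx
  rw [avg_sub_fun hs hσ _ c1 hf] at h1
  have h2 := hn₀ n hn x (by linarith)
  have h3 : lpP s σ n f x - f x = (avg s σ (dy n) f x - f x) -
      (avg s σ (dy n) (avg s σ (dy n) f) x - avg s σ (dy n) f x) := by
    rw [lpP]; abel
  rw [h3]
  refine (norm_sub_le _ _).trans ((add_le_add h2 h1).trans_eq ?_)
  rw [← hVdef]
  field_simp
  ring

theorem tendsto_lpP [CompleteSpace E] (hs : ∀ i, 1 ≤ s i) (hσ : IsBump s σ)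
    (hint : ∫ y, σ y = 1) {f : EuclideanSpace ℝ (Fin d) → E} (hf : Continuous f)
    (x : EuclideanSpace ℝ (Fin d)) : Tendsto (fun n => lpP s σ n f x) atTop (𝓝 (f x)) := by
  rw [Metric.tendsto_atTop]
  intro ε hε
  obtain ⟨n₀, h⟩ := exists_lpP_approx hs hσ hint hf ‖x‖ (half_pos hε)
  exact ⟨n₀, fun n hn => by
    rw [dist_eq_norm]
    linarith [h n hn x le_rfl]⟩

theorem eventually_norm_lpP_le [CompleteSpace E] (hs : ∀ i, 1 ≤ s i) (hσ : IsBump s σ)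
    (hint : ∫ y, σ y = 1) {f : EuclideanSpace ℝ (Fin d) → E} (hf : Continuous f) (R : ℝ) :
    ∃ B, 0 ≤ B ∧ ∀ᶠ n in atTop, ∀ x, ‖x‖ ≤ R → ‖lpP s σ n f x‖ ≤ B := by
  obtain ⟨n₀, h⟩ := exists_lpP_approx hs hσ hint hf R one_pos
  obtain ⟨B, hB⟩ := (isCompact_closedBall (0 : EuclideanSpace ℝ (Fin d)) R).exists_bound_of_continuousOn
    hf.continuousOn
  refine ⟨|B| + 1, by positivity, eventually_atTop.2 ⟨n₀, fun n hn x hx => ?_⟩⟩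
  have h1 := hB x (by simpa using hx)
  have h2 := h n hn x hx
  have h3 := norm_sub_norm_le (lpP s σ n f x) (f x)
  have := le_abs_self B
  linarith

/-- The regularised products converge to the product, when averaged. -/
theorem tendsto_avg_bilin_lpP [CompleteSpace E] [CompleteSpace F] [CompleteSpace G]
    (hs : ∀ i, 1 ≤ s i) (hσ : IsBump s σ)
    (hint : ∫ y, σ y = 1) {f : EuclideanSpace ℝ (Fin d) → E} (hf : Continuous f)
    {g : EuclideanSpace ℝ (Fin d) → F} (hg : Continuous g) (b : E →L[ℝ] F →L[ℝ] G)
    {η : EuclideanSpace ℝ (Fin d) → ℝ} (hη : IsBump s η) {l : ℝ} (hl : 0 < l) (hl1 : l ≤ 1)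
    (x : EuclideanSpace ℝ (Fin d)) :
    Tendsto (fun n => avg s η l (fun y => b (lpP s σ n f y) (lpP s σ n g y)) x) atTop
      (𝓝 (avg s η l (fun y => b (f y) (g y)) x)) := by
  obtain ⟨B, hB0, hB⟩ := eventually_norm_lpP_le hs hσ hint hf (‖x‖ + d)
  obtain ⟨B', hB'0, hB'⟩ := eventually_norm_lpP_le hs hσ hint hg (‖x‖ + d)
  have hηc := hη.smooth.continuous
  have hηi : Integrable η := hηc.integrable_of_hasCompactSupport (hη.hasCompactSupport hs)
  unfold avg
  refine tendsto_integral_filter_of_dominated_convergence (fun z => ‖η z‖ * (‖b‖ * B * B')) ?_ ?_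
    (hηi.norm.mul_const _) ?_
  · refine Eventually.of_forall fun n => Continuous.aestronglyMeasurable ?_
    have c1 := (contDiff_lpP hs hσ n hf).continuous
    have c2 := (contDiff_lpP hs hσ n hg).continuous
    fun_prop
  · filter_upwards [hB, hB'] with n h1 h2
    refine Eventually.of_forall fun z => ?_
    rw [norm_smul]
    by_cases hz : (d : ℝ) < ‖z‖
    · simp [hη.eq_zero hs hz]
    · have hR : ‖x + dil s l z‖ ≤ ‖x‖ + d := (norm_add_le _ _).trans
        (add_le_add le_rfl ((norm_dil_le_one hs hl hl1 z).trans (not_lt.1 hz)))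
      refine mul_le_mul_of_nonneg_left ((b.le_opNorm₂ _ _).trans ?_) (norm_nonneg _)
      gcongr
      · exact h1 _ hR
      · exact h2 _ hR
  · refine Eventually.of_forall fun z => ?_
    refine Tendsto.const_smul ?_ _
    have h1 := tendsto_lpP hs hσ hint hf (x + dil s l z)
    have h2 := tendsto_lpP hs hσ hint hg (x + dil s l z)
    exact ((b.continuous₂.tendsto (f (x + dil s l z), g (x + dil s l z))).comp (h1.prodMk_nhds h2))

end LP

end

/-! ### Young's product estimate -/

section

variable {d : ℕ} {E F G : Type*} [NormedAddCommGroup E] [NormedSpace ℝ E]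
  [NormedAddCommGroup F] [NormedSpace ℝ F] [NormedAddCommGroup G] [NormedSpace ℝ G]
  {s : Fin d → ℝ}

theorem exists_sum_dy_rpow_le {p : ℝ} (hp : 0 < p) :
    ∃ A, 0 ≤ A ∧ ∀ T : Finset ℕ, ∑ k ∈ T, dy k ^ p ≤ A := by
  obtain ⟨A, hA, h⟩ := sum_dy_rpow_fine hp
  exact ⟨A, hA, fun T => by simpa using h T 1 one_pos fun k _ => dy_le_one k⟩

/-- The products of a block of `g` with the low frequencies of `f` are summable: their size is a
positive power of the scale, whatever the sign of `α`. -/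
theorem exists_low_high_exponent {α β : ℝ} (hαβ : α ≤ β) (hpos : 0 < α + β) :
    ∃ δ A, 0 < δ ∧ α ≤ δ ∧ 0 ≤ A ∧ ∀ k,
      (1 + ∑ i ∈ Finset.range (k + 1), dy i ^ α) * dy k ^ β ≤ A * dy k ^ δ := by
  have hβ : 0 < β := by linarith
  rcases lt_or_ge 0 α with hα | hα
  · obtain ⟨A, hA, h⟩ := exists_sum_dy_rpow_le hα
    refine ⟨β, 1 + A, hβ, hαβ, by linarith, fun k => ?_⟩
    have := Real.rpow_nonneg (dy_pos k).le β
    gcongr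
    exact h _
  · have hneg : (α - β) / 2 < 0 := by linarith
    -- the negative exponent `(α - β) / 2` lies below `α`, which may be zero, and the factor
    -- `dy k ^ β` turns it into the positive exponent `(α + β) / 2`
    obtain ⟨A, hA, h⟩ := sum_dy_rpow_coarse hneg
    refine ⟨(α + β) / 2, 1 + A, by linarith, by linarith, by linarith, fun k => ?_⟩
    have h1 : ∑ i ∈ Finset.range (k + 1), dy i ^ α ≤ A * dy k ^ ((α - β) / 2) := by
      refine le_trans (Finset.sum_le_sum fun i _ => ?_)
        (h (Finset.range (k + 1)) (dy k) (dy_pos k) fun i hi =>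
          dy_anti (Nat.lt_succ_iff.1 (Finset.mem_range.1 hi)))
      exact Real.rpow_le_rpow_of_exponent_ge (dy_pos i) (dy_le_one i) (by linarith)
    have h2 : 1 ≤ dy k ^ ((α - β) / 2) :=
      Real.one_le_rpow_of_pos_of_le_one_of_nonpos (dy_pos k) (dy_le_one k) hneg.le
    have h3 := Real.rpow_nonneg (dy_pos k).le β
    calc _ ≤ ((1 + A) * dy k ^ ((α - β) / 2)) * dy k ^ β := by
          gcongr
          linarith
      _ = (1 + A) * dy k ^ ((α + β) / 2) := by
          rw [mul_assoc, ← Real.rpow_add (dy_pos k)]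
          congr 2
          ring

/-- Summation of the resonant estimate over the coarser blocks of `g`. -/
theorem exists_resonant_exponent {α β : ℝ} {r : ℕ} (hr : 0 < r + α) (hβ : 0 < β)
    (hpos : 0 < α + β) :
    ∃ β' A, 0 < β' ∧ 0 < α + β' ∧ 0 ≤ A ∧ ∀ k l, dy k ≤ l → l ≤ 1 →
      ((dy k / l) ^ r + dy k ^ r) +
        ∑ i ∈ Finset.range k, dy i ^ β * ((dy k / l) ^ r + (dy k / dy i) ^ r) ≤
      A * ((dy k / l) ^ r + dy k ^ β') := by
  obtain ⟨A, hA, h⟩ := exists_sum_dy_rpow_le hβ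
  rcases Nat.eq_zero_or_pos r with rfl | hr0
  · refine ⟨β, 2 + A * 2, hβ, hpos, by linarith, fun k l _ _ => ?_⟩
    simp only [pow_zero, ← Finset.sum_mul]
    have h1 := h (Finset.range k)
    have h2 := Real.rpow_nonneg (dy_pos k).le β
    nlinarith
  · have hr1 : (0 : ℝ) < r := by exact_mod_cast hr0
    -- lowering `β` below `r` makes the sum over the coarser scales geometric, without losing
    -- `α + β' > 0`
    obtain ⟨β', hb1, hb2⟩ : ∃ β', max (-α) 0 < β' ∧ β' < min β r :=
      exists_between (max_lt (lt_min (by linarith) (by linarith)) (lt_min hβ hr1))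
    rw [max_lt_iff] at hb1
    rw [lt_min_iff] at hb2
    obtain ⟨A', hA', h'⟩ := sum_dy_rpow_coarse (p := β' - r) (by linarith)
    refine ⟨β', 2 + A + A', hb1.2, by linarith, by linarith, fun k l hkl hl => ?_⟩
    have hk := dy_pos k
    have hl0 : 0 < l := hk.trans_le hkl
    have e1 : dy k ^ r ≤ (dy k / l) ^ r := by
      refine pow_le_pow_left₀ hk.le ?_ r
      rw [le_div_iff₀ hl0]
      exact mul_le_of_le_one_right hk.le hl
    have e2 : ∑ i ∈ Finset.range k, dy i ^ β * (dy k / l) ^ r ≤ A * (dy k / l) ^ r := by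
      rw [← Finset.sum_mul]
      gcongr
      exact h _
    have e3 : ∑ i ∈ Finset.range k, dy i ^ β * (dy k / dy i) ^ r ≤ A' * dy k ^ β' := by
      calc _ ≤ ∑ i ∈ Finset.range k, dy k ^ r * dy i ^ (β' - r) := by
            refine Finset.sum_le_sum fun i _ => ?_
            have hi := dy_pos i
            rw [Real.rpow_sub hi, Real.rpow_natCast, div_pow]
            have : dy i ^ β ≤ dy i ^ β' :=
              Real.rpow_le_rpow_of_exponent_ge hi (dy_le_one i) hb2.1.le
            calc _ ≤ dy i ^ β' * (dy k ^ r / dy i ^ r) := by gcongr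
              _ = _ := by ring
        _ ≤ dy k ^ r * (A' * dy k ^ (β' - r)) := by
            rw [← Finset.mul_sum]
            gcongr
            exact h' _ _ hk fun i hi => dy_anti (Finset.mem_range.1 hi).le
        _ = A' * dy k ^ β' := by
            rw [Real.rpow_sub hk, Real.rpow_natCast]
            field_simp
    simp only [mul_add, Finset.sum_add_distrib]
    have e4 := Real.rpow_nonneg hk.le β'
    have e5 : 0 ≤ (dy k / l) ^ r := by positivity
    nlinarith

theorem avg_add_fun (hs : ∀ i, 1 ≤ s i) {ψ : EuclideanSpace ℝ (Fin d) → ℝ} (hψ : IsBump s ψ)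
    (c : ℝ) {f g : EuclideanSpace ℝ (Fin d) → E} (hf : Continuous f) (hg : Continuous g)
    (x : EuclideanSpace ℝ (Fin d)) :
    avg s ψ c (fun y => f y + g y) x = avg s ψ c f x + avg s ψ c g x := by
  have h := avg_sub_fun hs hψ c (f := fun y => f y + g y) (hf.add hg) hg x
  simp only [add_sub_cancel_right] at h
  rw [h, sub_add_cancel]

section Young

variable {σ : EuclideanSpace ℝ (Fin d) → ℝ} {M : ℝ}

/-- The low frequency part of a function of regularity `α`, as the sum of the coarser blocks. All bounds
are expressed at a common finer scale `c`. -/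
theorem exists_scaledBd_lpP [CompleteSpace E] (hs : ∀ i, 1 ≤ s i) (hσ : IsMollifier s M σ)
    {α : ℝ} (hα : α ≤ M) (r N : ℕ) :
    ∃ A, 0 ≤ A ∧ ∀ (f : EuclideanSpace ℝ (Fin d) → E), Continuous f → ∀ (R C : ℝ), 0 ≤ C →
      HolderBd s α r f (R + d) C → ∀ n c, 0 < c → c ≤ 1 → (∀ i < n, c ≤ dy i) →
      ScaledBd s (lpP s σ n f) c R N (A * C * (1 + ∑ i ∈ Finset.range n, dy i ^ α)) := by
  obtain ⟨A, hA, h⟩ := exists_scaledBd_lpU (E := E) hs hσ hα r N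
  obtain ⟨A', hA', h'⟩ := exists_scaledBd_lpP_zero (E := E) hs hσ α r N
  refine ⟨A + A', by positivity, fun f hf R C hC hol n c hc hc1 hcn => ?_⟩
  have h1 := (h' f hf R C hC hol).finer hs (contDiff_lpP hs hσ.isBump 0 hf) one_pos hc hc1
  have h2 := ScaledBd.sum (Finset.range n) (fun k hk => (h f hf R C hC hol k).finer hs
    (contDiff_lpU hs hσ.isBump k hf) (dy_pos k) hc (hcn k (Finset.mem_range.1 hk)))
    (fun k _ => contDiff_lpU hs hσ.isBump k hf)
  have h3 := h1.add h2 (contDiff_lpP hs hσ.isBump 0 hf)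
    (ContDiff.sum fun k _ => contDiff_lpU hs hσ.isBump k hf)
  have h4 : lpP s σ n f = fun x => lpP s σ 0 f x + ∑ k ∈ Finset.range n, lpU s σ k f x :=
    funext fun x => lpP_eq_sum hs hσ.isBump n hf x
  rw [h4]
  refine h3.weaken le_rfl ?_
  rw [← Finset.mul_sum]
  have h5 : 0 ≤ ∑ i ∈ Finset.range n, dy i ^ α :=
    Finset.sum_nonneg fun i _ => Real.rpow_nonneg (dy_pos i).le _
  have h6 : 0 ≤ A * C := by positivity
  have h7 : 0 ≤ A' * C := by positivity
  nlinarith [mul_nonneg h7 h5]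

/-- Blocks of `f` against low frequencies of `g`, tested at a scale `l` coarser than the block. -/
theorem exists_norm_avg_high_low_le [CompleteSpace E] [CompleteSpace F] [CompleteSpace G]
    (hs : ∀ i, 1 ≤ s i)
    {α β : ℝ} {r : ℕ} (hσ : IsMollifier s M σ) (hα : α ≤ M) (hβM : β ≤ M)
    (hrM : r * ∑ i, s i ≤ M) (hr : 0 < r + α) (hβ : 0 < β)
    (hpos : 0 < α + β) (rf rg : ℕ) :
    ∃ A β', 0 ≤ A ∧ 0 < β' ∧ 0 < α + β' ∧
      ∀ (η : EuclideanSpace ℝ (Fin d) → ℝ), IsBump s η →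
      (∀ j ≤ r, ∀ y, ‖iteratedFDeriv ℝ j η y‖ ≤ 1) → ∀ (b : E →L[ℝ] F →L[ℝ] G), ‖b‖ ≤ 1 →
      ∀ (f : EuclideanSpace ℝ (Fin d) → E), Continuous f →
      ∀ (g : EuclideanSpace ℝ (Fin d) → F), Continuous g → ∀ (R Cf Cg : ℝ), 0 ≤ Cf → 0 ≤ Cg →
      HolderBd s α rf f (R + 4 * d) Cf → HolderBd s β rg g (R + 4 * d) Cg →
      ∀ k l, dy k ≤ l → l ≤ 1 → ∀ x, ‖x‖ ≤ R →
      ‖avg s η l (fun y => b (lpU s σ k f y) (lpP s σ k g y)) x‖ ≤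
        A * (Cf * Cg) * (dy k ^ α * ((dy k / l) ^ r + dy k ^ β')) := by
  obtain ⟨β', A₁, hb1, hb2, hA₁, h₁⟩ := exists_resonant_exponent hr hβ hpos
  obtain ⟨A₂, hA₂, h₂⟩ := exists_resonant (E := E) (F := F) (G := G) hs hσ.isBump hσ.even
    hσ.integral_eq (r := r) fun k hk hkr => hσ.moment k hk (hkr.trans hrM)
  obtain ⟨A₃, hA₃, h₃⟩ := exists_norm_lpV_le (E := E) hs hσ hα rf
  obtain ⟨A₄, hA₄, h₄⟩ := exists_scaledBd_lpU (E := F) hs hσ hβM rg r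
  obtain ⟨A₅, hA₅, h₅⟩ := exists_scaledBd_lpP_zero (E := F) hs hσ β rg r
  refine ⟨2 * A₂ * A₃ * (A₄ + A₅) * A₁, β', by positivity, hb1, hb2, ?_⟩
  intro η hη hη1 b hb f hf g hg R Cf Cg hCf hCg hHf hHg k l hkl hl1 x hx
  have hd0 : (0 : ℝ) ≤ d := Nat.cast_nonneg d
  have hk := dy_pos k
  have hl0 : 0 < l := hk.trans_le hkl
  have hV : ∀ x, ‖x‖ ≤ R + 3 * d → ‖lpV s σ k f x‖ ≤ A₃ * Cf * dy k ^ α := fun x hx =>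
    h₃ f hf (R + 3 * d) Cf hCf (hHf.mono (by linarith)) k x hx
  have hVc := (contDiff_lpV hs hσ.isBump k hf).continuous
  have hV0 : 0 ≤ A₃ * Cf * dy k ^ α :=
    mul_nonneg (mul_nonneg hA₃ hCf) (Real.rpow_nonneg hk.le _)
  have hvc1 : Continuous fun y => lpV s σ k f y - avg s σ (dy k) (lpV s σ k f) y :=
    hVc.sub (contDiff_avg hs hσ.isBump hk hVc).continuous
  have hvc2 : Continuous fun y => lpV s σ k f y - avg s σ (dy (k + 1)) (lpV s σ k f) y :=
    hVc.sub (contDiff_avg hs hσ.isBump (dy_pos _) hVc).continuous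
  -- the resonant estimate for both oscillating parts of the block
  have hW : ∀ (W : EuclideanSpace ℝ (Fin d) → F), ContDiff ℝ ∞ W → ∀ ν D, dy k ≤ ν → ν ≤ 1 →
      ScaledBd s W ν (R + 3 * d) r D → ‖avg s η l (fun y => b (lpU s σ k f y) (W y)) x‖ ≤
        2 * A₂ * (A₃ * Cf * dy k ^ α) * (D * ((dy k / l) ^ r + (dy k / ν) ^ r)) := by
    intro W hWc ν D hkν hν1 hWD
    have hν : 0 < ν := hk.trans_le hkν
    have hD : 0 ≤ D := hWD.nonneg (by linarith [norm_nonneg x])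
    have hk1 := dy_pos (k + 1)
    have i1 := h₂ η hη hη1 b hb _ hVc W hWc l (dy k) ν R _ D hk hkl hl1 hkν hν1 hV hWD x hx
    have i2 := h₂ η hη hη1 b hb _ hVc W hWc l (dy (k + 1)) ν R _ D hk1
      ((dy_succ_le k).trans hkl) hl1 ((dy_succ_le k).trans hkν) hν1 hV hWD x hx
    have i3 : (dy (k + 1) / l) ^ r + (dy (k + 1) / ν) ^ r ≤ (dy k / l) ^ r + (dy k / ν) ^ r := by
      have := dy_succ_le k
      gcongr
    have i4 : (fun y => b (lpU s σ k f y) (W y)) =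
        fun y => b (lpV s σ k f y - avg s σ (dy k) (lpV s σ k f) y) (W y) +
          b (lpV s σ k f y - avg s σ (dy (k + 1)) (lpV s σ k f) y) (W y) := by
      funext y
      rw [lpU, map_add, add_apply]
    have hWcont := hWc.continuous
    rw [i4, avg_add_fun hs hη _ (by fun_prop) (by fun_prop)]
    refine (norm_add_le _ _).trans ((add_le_add i1 (i2.trans (mul_le_mul_of_nonneg_left
      (mul_le_mul_of_nonneg_left i3 (mul_nonneg hV0 hD)) hA₂))).trans_eq ?_)
    ring
  have hU := fun i => h₄ g hg (R + 3 * d) Cg hCg (hHg.mono (by linarith)) i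
  have hP := h₅ g hg (R + 3 * d) Cg hCg (hHg.mono (by linarith))
  have hUc := (contDiff_lpU hs hσ.isBump k hf).continuous
  -- the low frequencies of `g` are built up block by block
  have hind : ∀ j ≤ k, ‖avg s η l (fun y => b (lpU s σ k f y) (lpP s σ j g y)) x‖ ≤
      2 * A₂ * (A₃ * Cf * dy k ^ α) * ((A₄ + A₅) * Cg) * (((dy k / l) ^ r + dy k ^ r) +
        ∑ i ∈ Finset.range j, dy i ^ β * ((dy k / l) ^ r + (dy k / dy i) ^ r)) := by
    intro j
    induction j with
    | zero =>
      intro _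
      refine (hW _ (contDiff_lpP hs hσ.isBump 0 hg) 1 _ (dy_le_one k) le_rfl hP).trans ?_
      simp only [div_one, Finset.range_zero, Finset.sum_empty, add_zero]
      rw [mul_assoc (2 * A₂ * (A₃ * Cf * dy k ^ α))]
      have : 0 ≤ (dy k / l) ^ r + dy k ^ r := by positivity
      gcongr
      linarith
    | succ j ih =>
      intro hj
      have c1 := (contDiff_lpP hs hσ.isBump j hg).continuous
      have c2 := (contDiff_lpU hs hσ.isBump j hg).continuous
      have i1 : (fun y => b (lpU s σ k f y) (lpP s σ (j + 1) g y)) =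
          fun y => b (lpU s σ k f y) (lpP s σ j g y) + b (lpU s σ k f y) (lpU s σ j g y) := by
        funext y
        rw [lpP_succ_sub hs hσ.isBump j hg, map_add]
      rw [i1, avg_add_fun hs hη _ (by fun_prop) (by fun_prop), Finset.sum_range_succ,
        ← add_assoc, mul_add]
      refine (norm_add_le _ _).trans (add_le_add (ih (by omega)) ?_)
      refine (hW _ (contDiff_lpU hs hσ.isBump j hg) _ _ (dy_anti (by omega)) (dy_le_one j)
        (hU j)).trans ?_
      have hj0 := dy_pos j
      have i2 : 0 ≤ (dy k / l) ^ r + (dy k / dy j) ^ r := by positivity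
      have i3 : 0 ≤ dy j ^ β := Real.rpow_nonneg hj0.le _
      have i4 : 0 ≤ dy k ^ α := Real.rpow_nonneg (dy_pos k).le _
      calc _ = 2 * A₂ * (A₃ * Cf * dy k ^ α) * (A₄ * Cg) *
            (dy j ^ β * ((dy k / l) ^ r + (dy k / dy j) ^ r)) := by ring
        _ ≤ _ := by
          refine mul_le_mul_of_nonneg_right (mul_le_mul_of_nonneg_left
            (mul_le_mul_of_nonneg_right ?_ hCg) (by positivity)) (by positivity)
          linarith
  refine (hind k le_rfl).trans ?_
  have hfin := h₁ k l hkl hl1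
  calc _ ≤ 2 * A₂ * (A₃ * Cf * dy k ^ α) * ((A₄ + A₅) * Cg) *
        (A₁ * ((dy k / l) ^ r + dy k ^ β')) := by gcongr
    _ = _ := by ring

/-- The two paraproduct blocks are smooth at the scale of the block. -/
theorem exists_scaledBd_blocks [CompleteSpace E] [CompleteSpace F]
    (hs : ∀ i, 1 ≤ s i) {α β : ℝ} (hσ : IsMollifier s M σ) (hα : α ≤ M) (hβM : β ≤ M)
    (hαβ : α ≤ β) (hpos : 0 < α + β) (rf rg N : ℕ) :
    ∃ A δ, 0 ≤ A ∧ 0 < δ ∧ α ≤ δ ∧ ∀ (b : E →L[ℝ] F →L[ℝ] G), ‖b‖ ≤ 1 →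
      ∀ (f : EuclideanSpace ℝ (Fin d) → E), Continuous f →
      ∀ (g : EuclideanSpace ℝ (Fin d) → F), Continuous g → ∀ (R Cf Cg : ℝ), 0 ≤ Cf → 0 ≤ Cg →
      HolderBd s α rf f (R + d) Cf → HolderBd s β rg g (R + d) Cg →
      ScaledBd s (fun y => b (lpP s σ 0 f y) (lpP s σ 0 g y)) 1 R N (A * (Cf * Cg)) ∧
      ∀ k, ScaledBd s (fun y => b (lpU s σ k f y) (lpP s σ k g y)) (dy k) R N
          (A * (Cf * Cg) * dy k ^ α) ∧
        ScaledBd s (fun y => b (lpP s σ (k + 1) f y) (lpU s σ k g y)) (dy k) R N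
          (A * (Cf * Cg) * dy k ^ δ) := by
  have hβ : 0 < β := by linarith
  obtain ⟨δ, A₁, hδ, hαδ, hA₁, h₁⟩ := exists_low_high_exponent hαβ hpos
  obtain ⟨A₂, hA₂, h₂⟩ := exists_scaledBd_lpP (E := E) hs hσ hα rf N
  obtain ⟨A₃, hA₃, h₃⟩ := exists_scaledBd_lpP (E := F) hs hσ hβM rg N
  obtain ⟨A₄, hA₄, h₄⟩ := exists_scaledBd_lpU (E := E) hs hσ hα rf N
  obtain ⟨A₅, hA₅, h₅⟩ := exists_scaledBd_lpU (E := F) hs hσ hβM rg N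
  obtain ⟨A₆, hA₆, h₆⟩ := exists_sum_dy_rpow_le hβ
  refine ⟨2 ^ N * (A₂ * A₃ + A₄ * A₃ * (1 + A₆) + A₂ * A₅ * A₁), δ, by positivity, hδ, hαδ, ?_⟩
  intro b hb f hf g hg R Cf Cg hCf hCg hHf hHg
  have hCC : 0 ≤ Cf * Cg := mul_nonneg hCf hCg
  have hf0 := contDiff_lpP (E := E) hs hσ.isBump (f := f)
  have n1 : 0 ≤ A₂ * A₃ := by positivity
  have n2 : 0 ≤ A₄ * A₃ * (1 + A₆) := by positivity
  have n3 : 0 ≤ A₂ * A₅ * A₁ := by positivity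
  refine ⟨?_, fun k => ⟨?_, ?_⟩⟩
  · have i1 := h₂ f hf R Cf hCf hHf 0 1 one_pos le_rfl (by simp)
    have i2 := h₃ g hg R Cg hCg hHg 0 1 one_pos le_rfl (by simp)
    refine (i1.bilin i2 (contDiff_lpP hs hσ.isBump 0 hf) (contDiff_lpP hs hσ.isBump 0 hg)
      b hb).weaken le_rfl ?_
    simp only [Finset.range_zero, Finset.sum_empty, add_zero, mul_one]
    calc _ = 2 ^ N * (A₂ * A₃) * (Cf * Cg) := by ring
      _ ≤ _ := by gcongr; linarith
  · have i1 := h₄ f hf R Cf hCf hHf k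
    have i2 := h₃ g hg R Cg hCg hHg k (dy k) (dy_pos k) (dy_le_one k) fun i hi => dy_anti hi.le
    refine (i1.bilin i2 (contDiff_lpU hs hσ.isBump k hf) (contDiff_lpP hs hσ.isBump k hg)
      b hb).weaken le_rfl ?_
    have hk := Real.rpow_nonneg (dy_pos k).le α
    calc _ ≤ 2 ^ N * (A₄ * Cf * dy k ^ α * (A₃ * Cg * (1 + A₆))) := by
          gcongr
          exact h₆ _
      _ = 2 ^ N * (A₄ * A₃ * (1 + A₆)) * (Cf * Cg) * dy k ^ α := by ring
      _ ≤ _ := by gcongr; linarith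
  · have i1 := h₂ f hf R Cf hCf hHf (k + 1) (dy k) (dy_pos k) (dy_le_one k)
      fun i hi => dy_anti (Nat.lt_succ_iff.1 hi)
    have i2 := h₅ g hg R Cg hCg hHg k
    refine (i1.bilin i2 (contDiff_lpP hs hσ.isBump (k + 1) hf) (contDiff_lpU hs hσ.isBump k hg)
      b hb).weaken le_rfl ?_
    have hk := Real.rpow_nonneg (dy_pos k).le δ
    calc _ = 2 ^ N * (A₂ * A₅ * (Cf * Cg)) *
          ((1 + ∑ i ∈ Finset.range (k + 1), dy i ^ α) * dy k ^ β) := by ring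
      _ ≤ 2 ^ N * (A₂ * A₅ * (Cf * Cg)) * (A₁ * dy k ^ δ) := by
          exact mul_le_mul_of_nonneg_left (h₁ k) (by positivity)
      _ = 2 ^ N * (A₂ * A₅ * A₁) * (Cf * Cg) * dy k ^ δ := by ring
      _ ≤ _ := by gcongr; linarith

/-- The telescoped product: each step in frequency contributes a block of `f` times low frequencies of `g`
and low frequencies of `f` times a block of `g`. -/
theorem norm_avg_bilin_lpP_le [CompleteSpace E] [CompleteSpace F] [CompleteSpace G]
    (hs : ∀ i, 1 ≤ s i) (hσ : IsBump s σ) {η : EuclideanSpace ℝ (Fin d) → ℝ} (hη : IsBump s η)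
    (b : E →L[ℝ] F →L[ℝ] G) {f : EuclideanSpace ℝ (Fin d) → E} (hf : Continuous f)
    {g : EuclideanSpace ℝ (Fin d) → F} (hg : Continuous g) (l : ℝ) (x : EuclideanSpace ℝ (Fin d))
    (n : ℕ) :
    ‖avg s η l (fun y => b (lpP s σ n f y) (lpP s σ n g y)) x‖ ≤
      ‖avg s η l (fun y => b (lpP s σ 0 f y) (lpP s σ 0 g y)) x‖ +
      ∑ k ∈ Finset.range n, (‖avg s η l (fun y => b (lpU s σ k f y) (lpP s σ k g y)) x‖ +
        ‖avg s η l (fun y => b (lpP s σ (k + 1) f y) (lpU s σ k g y)) x‖) := by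
  induction n with
  | zero => simp
  | succ n ih =>
    have c1 := (contDiff_lpP hs hσ n hf).continuous
    have c2 := (contDiff_lpP hs hσ n hg).continuous
    have c3 := (contDiff_lpU hs hσ n hf).continuous
    have c4 := (contDiff_lpU hs hσ n hg).continuous
    have c5 := (contDiff_lpP hs hσ (n + 1) hf).continuous
    have h : (fun y => b (lpP s σ (n + 1) f y) (lpP s σ (n + 1) g y)) =
        fun y => b (lpP s σ n f y) (lpP s σ n g y) + (b (lpU s σ n f y) (lpP s σ n g y) +
          b (lpP s σ (n + 1) f y) (lpU s σ n g y)) := by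
      funext y
      rw [lpP_succ_sub hs hσ n hg, map_add, lpP_succ_sub hs hσ n hf]
      simp only [map_add, add_apply]
      abel
    rw [h, avg_add_fun hs hη _ (by fun_prop) (by fun_prop),
      avg_add_fun hs hη _ (by fun_prop) (by fun_prop), Finset.sum_range_succ]
    refine (norm_add_le _ _).trans ((add_le_add ih (norm_add_le _ _)).trans_eq ?_)
    rw [add_assoc]

theorem exists_isMollifier (hs : ∀ i, 1 ≤ s i) (M : ℝ) : ∃ σ, IsMollifier s M σ := by
  obtain ⟨σ, h1, h2, h3, h4⟩ := exists_kernel hs M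
  exact ⟨σ, h1, h2, h3, h4⟩

/-- Young's product estimate when the first factor is the less regular one. Blocks coarser than the
test function gain by its vanishing moments; finer blocks are summable, those of `f` by the resonant
estimate and those of `g` by size alone. -/
theorem exists_holderBd_bilin_of_le [CompleteSpace E] [CompleteSpace F] [CompleteSpace G]
    (hs : ∀ i, 1 ≤ s i) {α β : ℝ} {r : ℕ} (hαβ : α ≤ β) (hpos : 0 < α + β) (hr : 0 < r + α)
    (rf rg : ℕ) :
    ∃ A, 0 ≤ A ∧ ∀ (b : E →L[ℝ] F →L[ℝ] G), ‖b‖ ≤ 1 →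
      ∀ (f : EuclideanSpace ℝ (Fin d) → E), Continuous f →
      ∀ (g : EuclideanSpace ℝ (Fin d) → F), Continuous g → ∀ (R Cf Cg : ℝ), 0 ≤ Cf → 0 ≤ Cg →
      HolderBd s α rf f (R + 4 * d) Cf → HolderBd s β rg g (R + 4 * d) Cg →
      HolderBd s α r (fun y => b (f y) (g y)) R (A * (Cf * Cg)) := by
  have hβ : 0 < β := by linarith
  have hd0 : (0 : ℝ) ≤ d := Nat.cast_nonneg d
  obtain ⟨σ, hσ⟩ := exists_isMollifier hs (max (max α β) (r * ∑ i, s i))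
  have hαM : α ≤ max (max α β) (r * ∑ i, s i) := (le_max_left _ _).trans (le_max_left _ _)
  have hβM : β ≤ max (max α β) (r * ∑ i, s i) := (le_max_right _ _).trans (le_max_left _ _)
  obtain ⟨N, e, A₁, he, hA₁, h₁⟩ := exists_avg_gain (G := G) hs α
  obtain ⟨A₂, β', hA₂, hβ', hαβ', h₂⟩ := exists_norm_avg_high_low_le (E := E) (F := F) (G := G) hs
    hσ hαM hβM (le_max_right _ _) hr hβ hpos rf rg
  obtain ⟨A₃, δ, hA₃, hδ, hαδ, h₃⟩ := exists_scaledBd_blocks (E := E) (F := F) (G := G) hs hσ hαM hβM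
    hαβ hpos rf rg N
  obtain ⟨S₁, hS₁, t₁⟩ := sum_dy_rpow_fine (p := r + α) hr
  obtain ⟨S₂, hS₂, t₂⟩ := sum_dy_rpow_fine hαβ'
  obtain ⟨S₃, hS₃, t₃⟩ := sum_dy_rpow_fine hδ
  obtain ⟨S₄, hS₄, t₄⟩ := sum_dy_rpow_coarse (p := α - e) (by linarith)
  set V := volume.real (Metric.closedBall (0 : EuclideanSpace ℝ (Fin d)) d) with hVdef
  have hV : 0 ≤ V := measureReal_nonneg
  refine ⟨(A₁ * A₃ + V * A₃) + ((A₂ * (S₁ + S₂) + V * A₃ * S₃) + 2 * A₁ * A₃ * S₄), by positivity, ?_⟩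
  intro b hb f hf g hg R Cf Cg hCf hCg hHf hHg
  have hCC : 0 ≤ Cf * Cg := mul_nonneg hCf hCg
  obtain ⟨hP0, hblocks⟩ := h₃ b hb f hf g hg (R + d) Cf Cg hCf hCg (hHf.mono (by linarith))
    (hHg.mono (by linarith))
  have cP := fun n => contDiff_lpP hs hσ.isBump n hf
  have cP' := fun n => contDiff_lpP hs hσ.isBump n hg
  have cU := fun n => contDiff_lpU hs hσ.isBump n hf
  have cU' := fun n => contDiff_lpU hs hσ.isBump n hg
  have cb : ∀ {u : EuclideanSpace ℝ (Fin d) → E} {w : EuclideanSpace ℝ (Fin d) → F},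
      ContDiff ℝ ∞ u → ContDiff ℝ ∞ w → ContDiff ℝ ∞ fun y => b (u y) (w y) :=
    fun hu hw => (b.contDiff.comp hu).clm_apply hw
  -- blocks finer than the test function
  have hsmall : ∀ η, IsBump s η → (∀ j ≤ r, ∀ y, ‖iteratedFDeriv ℝ j η y‖ ≤ 1) →
      ∀ l, 0 < l → l ≤ 1 → ∀ x, ‖x‖ ≤ R → ∀ T : Finset ℕ, (∀ k ∈ T, dy k ≤ l) →
      ∑ k ∈ T, (‖avg s η l (fun y => b (lpU s σ k f y) (lpP s σ k g y)) x‖ +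
        ‖avg s η l (fun y => b (lpP s σ (k + 1) f y) (lpU s σ k g y)) x‖) ≤
      (A₂ * (S₁ + S₂) + V * A₃ * S₃) * (Cf * Cg) * l ^ α := by
    intro η hη hη1 l hl hl1 x hx T hT
    rw [Finset.sum_add_distrib]
    have i1 : ∑ k ∈ T, ‖avg s η l (fun y => b (lpU s σ k f y) (lpP s σ k g y)) x‖ ≤
        A₂ * (Cf * Cg) * ((S₁ + S₂) * l ^ α) := by
      refine (Finset.sum_le_sum fun k hk => h₂ η hη hη1 b hb f hf g hg R Cf Cg hCf hCg hHf hHg k l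
        (hT k hk) hl1 x hx).trans ?_
      rw [← Finset.mul_sum]
      refine mul_le_mul_of_nonneg_left ?_ (mul_nonneg hA₂ hCC)
      have j1 : ∑ k ∈ T, dy k ^ α * (dy k / l) ^ r ≤ S₁ * l ^ α := by
        calc _ = (l ^ r)⁻¹ * ∑ k ∈ T, dy k ^ (r + α) := by
              rw [Finset.mul_sum]
              refine Finset.sum_congr rfl fun k _ => ?_
              rw [Real.rpow_add (dy_pos k), Real.rpow_natCast, div_pow]
              ring
          _ ≤ (l ^ r)⁻¹ * (S₁ * l ^ (r + α)) := by
              gcongr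
              exact t₁ T l hl hT
          _ = S₁ * l ^ α := by
              rw [Real.rpow_add hl, Real.rpow_natCast]
              field_simp
      have j2 : ∑ k ∈ T, dy k ^ α * dy k ^ β' ≤ S₂ * l ^ α := by
        calc _ = ∑ k ∈ T, dy k ^ (α + β') := by
              simp only [Real.rpow_add (dy_pos _)]
          _ ≤ S₂ * l ^ (α + β') := t₂ T l hl hT
          _ ≤ _ := by
              gcongr ?_ * ?_
              exact Real.rpow_le_rpow_of_exponent_ge hl hl1 (by linarith)
      simp only [mul_add, Finset.sum_add_distrib, add_mul]
      exact add_le_add j1 j2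
    have i2 : ∑ k ∈ T, ‖avg s η l (fun y => b (lpP s σ (k + 1) f y) (lpU s σ k g y)) x‖ ≤
        V * A₃ * (Cf * Cg) * (S₃ * l ^ α) := by
      have hη0 : ∀ y, |η y| ≤ 1 := fun y => by simpa using hη1 0 (Nat.zero_le _) y
      refine (Finset.sum_le_sum fun k _ => norm_avg_le hs hη hη0 hl hl1
        (fun y hy => ((hblocks k).2).norm_le hy) hx).trans ?_
      have j1 : ∑ k ∈ T, 1 * (A₃ * (Cf * Cg) * dy k ^ δ) * V =
          V * A₃ * (Cf * Cg) * ∑ k ∈ T, dy k ^ δ := by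
        rw [Finset.mul_sum]
        exact Finset.sum_congr rfl fun k _ => by ring
      rw [j1]
      refine mul_le_mul_of_nonneg_left ((t₃ T l hl hT).trans ?_) (by positivity)
      refine mul_le_mul_of_nonneg_left ?_ hS₃
      exact Real.rpow_le_rpow_of_exponent_ge hl hl1 hαδ
    exact (add_le_add i1 i2).trans_eq (by ring)
  -- blocks coarser than the test function
  have hlarge : ∀ η, IsBump s η → (∀ j ≤ r, ∀ y, ‖iteratedFDeriv ℝ j η y‖ ≤ 1) → Vanish s α η →
      ∀ l, 0 < l → ∀ x, ‖x‖ ≤ R → ∀ T : Finset ℕ, (∀ k ∈ T, l ≤ dy k) →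
      ∑ k ∈ T, (‖avg s η l (fun y => b (lpU s σ k f y) (lpP s σ k g y)) x‖ +
        ‖avg s η l (fun y => b (lpP s σ (k + 1) f y) (lpU s σ k g y)) x‖) ≤
      2 * A₁ * A₃ * S₄ * (Cf * Cg) * l ^ α := by
    intro η hη hη1 hv l hl x hx T hT
    have hη0 : ∀ y, |η y| ≤ 1 := fun y => by simpa using hη1 0 (Nat.zero_le _) y
    have i1 : ∀ k ∈ T, ‖avg s η l (fun y => b (lpU s σ k f y) (lpP s σ k g y)) x‖ +
        ‖avg s η l (fun y => b (lpP s σ (k + 1) f y) (lpU s σ k g y)) x‖ ≤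
        2 * A₁ * A₃ * (Cf * Cg) * l ^ e * dy k ^ (α - e) := fun k hk => by
      have hk0 := dy_pos k
      have j1 := h₁ η hη hη0 hv _ (cb (cU k) (cP' k)) _ (dy k) l R hl (hT k hk) (dy_le_one k)
        (hblocks k).1 x hx
      have j2 := h₁ η hη hη0 hv _ (cb (cP (k + 1)) (cU' k)) _ (dy k) l R hl (hT k hk) (dy_le_one k)
        (hblocks k).2 x hx
      have j3 : dy k ^ δ ≤ dy k ^ α := Real.rpow_le_rpow_of_exponent_ge hk0 (dy_le_one k) hαδ
      have j4 : 0 ≤ (l / dy k) ^ e := Real.rpow_nonneg (div_pos hl hk0).le _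
      have j5 : A₁ * (A₃ * (Cf * Cg) * dy k ^ δ) * (l / dy k) ^ e ≤
          A₁ * (A₃ * (Cf * Cg) * dy k ^ α) * (l / dy k) ^ e := by gcongr
      refine (add_le_add j1 (j2.trans j5)).trans_eq ?_
      rw [Real.div_rpow hl.le hk0.le, Real.rpow_sub hk0]
      ring
    refine (Finset.sum_le_sum i1).trans ?_
    rw [← Finset.mul_sum]
    refine (mul_le_mul_of_nonneg_left (t₄ T l hl hT) ?_).trans_eq ?_
    · have := Real.rpow_nonneg hl.le e
      positivity
    · rw [Real.rpow_sub hl]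
      have := (Real.rpow_pos_of_pos hl e).ne'
      field_simp
  -- the bounds are uniform in the truncation of the decomposition
  refine ⟨fun x hx η hη hη1 hv l hl hl1 => ?_, fun x hx η hη hη1 => ?_⟩
  · refine le_of_tendsto (tendsto_avg_bilin_lpP hs hσ.isBump hσ.integral_eq hf hg b hη hl hl1 x).norm
      (Eventually.of_forall fun n => ?_)
    refine (norm_avg_bilin_lpP_le hs hσ.isBump hη b hf hg l x n).trans ?_
    have hη0 : ∀ y, |η y| ≤ 1 := fun y => by simpa using hη1 0 (Nat.zero_le _) y
    have i0 := h₁ η hη hη0 hv _ (cb (cP 0) (cP' 0)) _ 1 l R hl hl1 le_rfl hP0 x hx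
    rw [div_one] at i0
    have i0' : l ^ e ≤ l ^ α := Real.rpow_le_rpow_of_exponent_ge hl hl1 he.le
    rw [← Finset.sum_filter_add_sum_filter_not (Finset.range n) (fun k => dy k ≤ l)]
    have i1 := hsmall η hη hη1 l hl hl1 x hx ((Finset.range n).filter fun k => dy k ≤ l)
      fun k hk => (Finset.mem_filter.1 hk).2
    have i2 := hlarge η hη hη1 hv l hl x hx ((Finset.range n).filter fun k => ¬ dy k ≤ l)
      fun k hk => (not_le.1 (Finset.mem_filter.1 hk).2).le
    have hlα : 0 ≤ l ^ α := Real.rpow_nonneg hl.le _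
    have i3 : A₁ * (A₃ * (Cf * Cg)) * l ^ e ≤ (A₁ * A₃ + V * A₃) * (Cf * Cg) * l ^ α := by
      calc _ ≤ A₁ * (A₃ * (Cf * Cg)) * l ^ α := by gcongr
        _ = A₁ * A₃ * (Cf * Cg) * l ^ α := by ring
        _ ≤ _ := by gcongr; exact le_add_of_nonneg_right (mul_nonneg hV hA₃)
    refine (add_le_add (i0.trans i3) (add_le_add i1 i2)).trans_eq ?_
    ring
  · refine le_of_tendsto (tendsto_avg_bilin_lpP hs hσ.isBump hσ.integral_eq hf hg b hη one_pos
      le_rfl x).norm (Eventually.of_forall fun n => ?_)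
    refine (norm_avg_bilin_lpP_le hs hσ.isBump hη b hf hg 1 x n).trans ?_
    have hη0 : ∀ y, |η y| ≤ 1 := fun y => by simpa using hη1 0 (Nat.zero_le _) y
    have i0 := norm_avg_le hs hη hη0 one_pos le_rfl (fun y hy => hP0.norm_le hy) hx
    have i1 := hsmall η hη hη1 1 one_pos le_rfl x hx (Finset.range n) fun k _ => dy_le_one k
    rw [Real.one_rpow, mul_one] at i1
    refine (add_le_add i0 i1).trans ?_
    rw [← hVdef]
    have n1 : 0 ≤ A₁ * A₃ * (Cf * Cg) := by positivity
    have n2 : 0 ≤ 2 * A₁ * A₃ * S₄ * (Cf * Cg) := by positivity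
    linarith

/-- Young's product estimate: a bilinear pairing of functions of regularities `α` and `β` with
`α + β > 0` has regularity `min α β`. -/
theorem exists_holderBd_bilin [CompleteSpace E] [CompleteSpace F] [CompleteSpace G]
    (hs : ∀ i, 1 ≤ s i) {α β : ℝ} {r : ℕ} (hpos : 0 < α + β) (hr : 0 < r + min α β)
    (rf rg : ℕ) :
    ∃ A, 0 ≤ A ∧ ∀ (b : E →L[ℝ] F →L[ℝ] G), ‖b‖ ≤ 1 →
      ∀ (f : EuclideanSpace ℝ (Fin d) → E), Continuous f →
      ∀ (g : EuclideanSpace ℝ (Fin d) → F), Continuous g → ∀ (R Cf Cg : ℝ), 0 ≤ Cf → 0 ≤ Cg →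
      HolderBd s α rf f (R + 4 * d) Cf → HolderBd s β rg g (R + 4 * d) Cg →
      HolderBd s (min α β) r (fun y => b (f y) (g y)) R (A * (Cf * Cg)) := by
  rcases le_total α β with h | h
  · rw [min_eq_left h] at hr ⊢
    exact exists_holderBd_bilin_of_le hs h hpos hr rf rg
  · rw [min_eq_right h] at hr ⊢
    obtain ⟨A, hA, hA'⟩ := exists_holderBd_bilin_of_le (E := F) (F := E) (G := G) hs h
      (by linarith) hr rg rf
    refine ⟨A, hA, fun b hb f hf g hg R Cf Cg hCf hCg hHf hHg => ?_⟩
    rw [mul_comm Cf]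
    exact hA' b.flip (by rwa [ContinuousLinearMap.opNorm_flip]) g hg f hf R Cg Cf hCg hCf hHg hHf

end Young

end

/-! ### Duality with general test functions -/

section

section GeneralTest

variable {d : ℕ} {E : Type*} [NormedAddCommGroup E] [NormedSpace ℝ E] {s : Fin d → ℝ}

theorem norm_iteratedFDeriv_mul_le_two_pow {f g : EuclideanSpace ℝ (Fin d) → ℝ}
    (hf : ContDiff ℝ ∞ f) (hg : ContDiff ℝ ∞ g) {r : ℕ} {a b : ℝ}
    (y : EuclideanSpace ℝ (Fin d)) (ha : ∀ j ≤ r, ‖iteratedFDeriv ℝ j f y‖ ≤ a)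
    (hb : ∀ j ≤ r, ‖iteratedFDeriv ℝ j g y‖ ≤ b) {j : ℕ} (hj : j ≤ r) :
    ‖iteratedFDeriv ℝ j (fun y => f y * g y) y‖ ≤ 2 ^ r * (a * b) := by
  have ha0 : 0 ≤ a := (norm_nonneg _).trans (ha 0 (Nat.zero_le _))
  have hb0 : 0 ≤ b := (norm_nonneg _).trans (hb 0 (Nat.zero_le _))
  refine (norm_iteratedFDeriv_mul_le hf hg y (n := j) (by exact_mod_cast le_top)).trans ?_
  calc _ ≤ ∑ i ∈ Finset.range (j + 1), (j.choose i : ℝ) * (a * b) := by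
        refine Finset.sum_le_sum fun i hi => ?_
        rw [mul_assoc]
        have := Finset.mem_range_succ_iff.1 hi
        gcongr
        · exact ha i (by omega)
        · exact hb _ (by omega)
    _ = 2 ^ j * (a * b) := by
        rw [← Finset.sum_mul]
        congr 1
        exact_mod_cast Nat.sum_range_choose j
    _ ≤ _ := by gcongr; exact one_le_two

theorem integral_avg_one (hs : ∀ i, 1 ≤ s i) {ρ₀ : EuclideanSpace ℝ (Fin d) → ℝ}
    (hρ : IsBump s ρ₀) (h1 : ∫ y, ρ₀ y = 1) {F : EuclideanSpace ℝ (Fin d) → E}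
    (hF : Continuous F) (hc : HasCompactSupport F) [CompleteSpace E] :
    ∫ x, avg s ρ₀ 1 F x = ∫ y, F y := by
  have hρc := hρ.smooth.continuous
  simp only [avg, dil_one]
  rw [integral_integral_swap_of_hasCompactSupport]
  · simp only [integral_smul]
    have : ∀ z : EuclideanSpace ℝ (Fin d), ∫ x, F (x + z) = ∫ x, F x := fun z =>
      integral_add_right_eq_self F z
    simp only [this]
    rw [integral_smul_const, h1, one_smul]
  · fun_prop
  · obtain ⟨K, hK, hKF⟩ : ∃ K, IsCompact K ∧ ∀ y ∉ K, F y = 0 :=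
      ⟨tsupport F, hc, fun y hy => image_eq_zero_of_notMem_tsupport hy⟩
    have hK' := (hK.prod (hρ.hasCompactSupport hs).isCompact).image
      (f := fun p => p.1 - p.2) (by fun_prop)
    refine HasCompactSupport.intro (hK'.prod (hρ.hasCompactSupport hs).isCompact) fun p hp => ?_
    by_cases h2 : p.2 ∈ tsupport ρ₀
    · have h3 : p.1 + p.2 ∉ K := fun h =>
        hp ⟨⟨(p.1 + p.2, p.2), ⟨h, h2⟩, by simp⟩, h2⟩
      simp [Function.uncurry_def, hKF _ h3]
    · have h : ρ₀ p.2 = 0 := image_eq_zero_of_notMem_tsupport h2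
      simp [Function.uncurry_def, h]

/-- The Hölder bound controls the pairing with every test function, by writing the test function
as a superposition of translates of functions supported in the unit ball. -/
theorem exists_norm_integral_smul_le [CompleteSpace E] (hs : ∀ i, 1 ≤ s i) (r : ℕ) (ρ : ℝ) :
    ∃ A, 0 ≤ A ∧ ∀ (φ : EuclideanSpace ℝ (Fin d) → ℝ), ContDiff ℝ ∞ φ →
      (∀ y, ρ < ‖y‖ → φ y = 0) → ∀ B, (∀ j ≤ r, ∀ y, ‖iteratedFDeriv ℝ j φ y‖ ≤ B) →
      ∀ (f : EuclideanSpace ℝ (Fin d) → E), Continuous f → ∀ (α C : ℝ),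
      HolderBd s α r f (ρ + d) C → ‖∫ y, φ y • f y‖ ≤ A * (B * C) := by
  obtain ⟨ρ₀, hρ, -, -, h1⟩ := exists_isBump_nonneg hs
  obtain ⟨B₀, hB₀, hB⟩ := exists_bound_iteratedFDeriv hρ.smooth (hρ.hasCompactSupport hs) r
  refine ⟨2 ^ r * B₀ * volume.real (Metric.closedBall (0 : EuclideanSpace ℝ (Fin d)) (ρ + d)),
    by positivity, fun φ hφ hφ0 B hφB f hf α C hol => ?_⟩
  have hc : HasCompactSupport fun y => φ y • f y :=
    (HasCompactSupport.intro (isCompact_closedBall 0 ρ) fun y hy => hφ0 y (by simpa using hy)).smul_right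
  have hcont : Continuous fun y => φ y • f y := hφ.continuous.smul hf
  rw [← integral_avg_one hs hρ h1 hcont hc]
  have h2 : ∀ x, avg s ρ₀ 1 (fun y => φ y • f y) x =
      avg s (fun z => ρ₀ z * φ (x + z)) 1 f x := fun x => by
    simp only [avg, dil_one, mul_smul]
  have h3 : ∀ x, ρ + d < ‖x‖ → avg s ρ₀ 1 (fun y => φ y • f y) x = 0 := fun x hx => by
    rw [h2, avg]
    refine integral_eq_zero_of_ae (Eventually.of_forall fun z => ?_)
    by_cases hz : ‖z‖ ≤ d
    · have : ρ < ‖x + z‖ := by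
        have := norm_sub_le (x + z) z
        rw [add_sub_cancel_right] at this
        linarith
      simp [hφ0 _ this]
    · simp [hρ.eq_zero hs (not_le.1 hz)]
  have h4 : ∀ x, ‖x‖ ≤ ρ + d → ‖avg s ρ₀ 1 (fun y => φ y • f y) x‖ ≤ 2 ^ r * (B₀ * B) * C := by
    intro x hx
    rw [h2]
    have hφx : ContDiff ℝ ∞ fun z => φ (x + z) := hφ.comp (contDiff_const.add contDiff_id)
    refine hol.norm_avg_one_le ⟨hρ.smooth.mul hφx,
      (closure_mono (Function.support_mul_subset_left _ _)).trans hρ.supp⟩ (fun j hj z => ?_) hx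
    refine norm_iteratedFDeriv_mul_le_two_pow hρ.smooth hφx z (fun i hi => hB i hi z)
      (fun i hi => ?_) hj
    rw [iteratedFDeriv_comp_add_left]
    exact hφB i hi _
  have h5 := norm_setIntegral_le_of_norm_le_const
    (s := Metric.closedBall (0 : EuclideanSpace ℝ (Fin d)) (ρ + d))
    (f := avg s ρ₀ 1 (fun y => φ y • f y)) (μ := volume) measure_closedBall_lt_top
    (fun x hx => h4 x (by simpa using hx))
  rw [setIntegral_eq_integral_of_forall_compl_eq_zero fun x hx => h3 x (by simpa using hx)] at h5
  refine h5.trans_eq (by ring)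

end GeneralTest

end

/-! ### Test functions with values in `𝕂` and real test functions -/

section

section Cast

variable {d : ℕ} {𝕂 : Type*} [RCLike 𝕂] {s : Fin d → ℝ}

/-- A real bump regarded as a `𝕂`-valued test function. -/
def IsBump.toTest (𝕂 : Type*) [RCLike 𝕂] {η : EuclideanSpace ℝ (Fin d) → ℝ} (hη : IsBump s η)
    (hs : ∀ i, 1 ≤ s i) : 𝓓((⊤ : Opens (EuclideanSpace ℝ (Fin d))), 𝕂) where
  toFun y := (η y : 𝕂)
  contDiff' := (RCLike.ofRealCLM (K := 𝕂)).contDiff.comp hη.smooth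
  hasCompactSupport' := (hη.hasCompactSupport hs).comp_left RCLike.ofReal_zero
  tsupport_subset' := fun _ _ => trivial

theorem IsBump.toTest_apply {η : EuclideanSpace ℝ (Fin d) → ℝ} (hη : IsBump s η)
    (hs : ∀ i, 1 ≤ s i) (y : EuclideanSpace ℝ (Fin d)) : hη.toTest 𝕂 hs y = (η y : 𝕂) := rfl

theorem IsBump.toTest_mem_testBall {η : EuclideanSpace ℝ (Fin d) → ℝ} (hη : IsBump s η)
    (hs : ∀ i, 1 ≤ s i) {r : ℕ} (h : ∀ j ≤ r, ∀ y, ‖iteratedFDeriv ℝ j η y‖ ≤ 1) :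
    hη.toTest 𝕂 hs ∈ testBall 𝕂 s r := by
  refine ⟨(closure_mono fun y hy => ?_).trans hη.supp, fun j hj y => ?_⟩
  · exact fun h0 => hy (by rw [hη.toTest_apply, h0, RCLike.ofReal_zero])
  · have := (RCLike.ofRealLI (K := 𝕂)).norm_iteratedFDeriv_comp_left (f := η) (x := y) (i := j)
      hη.smooth.contDiffAt (by exact_mod_cast le_top)
    exact this.trans_le (h j hj y)

theorem scaledDegree_equivFun (k : Fin d → ℕ) :
    scaledDegree s (Finsupp.equivFunOnFinite.symm k) = ∑ i, s i * k i := by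
  simp [scaledDegree]

theorem ofReal_mono (k : Fin d → ℕ) (y : EuclideanSpace ℝ (Fin d)) :
    ((mono k y : ℝ) : 𝕂) = ∏ i, ((y i : ℝ) : 𝕂) ^ k i := by
  simp [mono]

theorem integrable_test_mul_mono (η : 𝓓((⊤ : Opens (EuclideanSpace ℝ (Fin d))), 𝕂))
    (k : Fin d → ℕ) : Integrable fun y => η y * ((mono k y : ℝ) : 𝕂) :=
  (η.continuous.mul (RCLike.continuous_ofReal.comp
    (continuous_mono k))).integrable_of_hasCompactSupport η.hasCompactSupport.mul_right

theorem IsBump.toTest_mem_testBallVanishing {η : EuclideanSpace ℝ (Fin d) → ℝ} (hη : IsBump s η)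
    (hs : ∀ i, 1 ≤ s i) {r : ℕ} (h : ∀ j ≤ r, ∀ y, ‖iteratedFDeriv ℝ j η y‖ ≤ 1) {α : ℝ}
    (hv : Vanish s α η) : hη.toTest 𝕂 hs ∈ testBallVanishing 𝕂 s r α := by
  refine ⟨hη.toTest_mem_testBall hs h, fun P hP => ?_⟩
  have h1 : ∀ y : EuclideanSpace ℝ (Fin d), hη.toTest 𝕂 hs y *
      MvPolynomial.eval (fun i => ((y i : ℝ) : 𝕂)) P =
      ∑ k ∈ P.support, P.coeff k * (hη.toTest 𝕂 hs y * ((mono k y : ℝ) : 𝕂)) := fun y => by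
    rw [MvPolynomial.eval_eq', Finset.mul_sum]
    refine Finset.sum_congr rfl fun k _ => ?_
    rw [ofReal_mono]
    ring
  simp only [h1]
  rw [integral_finsetSum _ fun k _ => (integrable_test_mul_mono _ _).const_mul _]
  refine Finset.sum_eq_zero fun k hk => ?_
  rw [integral_const_mul]
  have h2 : ∀ y, hη.toTest 𝕂 hs y * ((mono k y : ℝ) : 𝕂) = ((η y * mono k y : ℝ) : 𝕂) :=
    fun y => by rw [hη.toTest_apply, RCLike.ofReal_mul]
  simp only [h2]
  rw [integral_ofReal, hv k (hP k hk), RCLike.ofReal_zero, mul_zero]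

/-- The real and imaginary parts of a normalised test function are normalised. -/
theorem norm_iteratedFDeriv_clm_comp_le (L : 𝕂 →L[ℝ] ℝ) (hL : ‖L‖ ≤ 1)
    (φ : 𝓓((⊤ : Opens (EuclideanSpace ℝ (Fin d))), 𝕂)) (j : ℕ) (y : EuclideanSpace ℝ (Fin d)) :
    ‖iteratedFDeriv ℝ j (fun y => L (φ y)) y‖ ≤ ‖iteratedFDeriv ℝ j φ y‖ :=
  (L.norm_iteratedFDeriv_comp_left (n := j) (φ.contDiff.contDiffAt)
    (by exact_mod_cast le_top)).trans (mul_le_of_le_one_left (norm_nonneg _) hL)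

theorem contDiff_clm_comp (L : 𝕂 →L[ℝ] ℝ) (φ : 𝓓((⊤ : Opens (EuclideanSpace ℝ (Fin d))), 𝕂)) :
    ContDiff ℝ ∞ fun y => L (φ y) := L.contDiff.comp φ.contDiff

theorem isBump_clm_comp (L : 𝕂 →L[ℝ] ℝ) {η : 𝓓((⊤ : Opens (EuclideanSpace ℝ (Fin d))), 𝕂)}
    {r : ℕ} (hη : η ∈ testBall 𝕂 s r) : IsBump s fun y => L (η y) :=
  ⟨contDiff_clm_comp L η, (closure_mono fun y hy => by
    exact fun h0 => hy (by simp [h0])).trans hη.1⟩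

theorem vanish_clm_comp (L : 𝕂 →L[ℝ] ℝ) {η : 𝓓((⊤ : Opens (EuclideanSpace ℝ (Fin d))), 𝕂)}
    {r : ℕ} {α : ℝ} (hη : η ∈ testBallVanishing 𝕂 s r α) : Vanish s α fun y => L (η y) := by
  intro k hk
  have h1 := hη.2 (MvPolynomial.monomial (Finsupp.equivFunOnFinite.symm k) 1) fun m hm => by
    rw [Finset.mem_singleton.1 (MvPolynomial.support_monomial_subset hm), scaledDegree_equivFun]
    exact hk
  have h2 : ∀ y : EuclideanSpace ℝ (Fin d), η y * MvPolynomial.eval (fun i => ((y i : ℝ) : 𝕂))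
      (MvPolynomial.monomial (Finsupp.equivFunOnFinite.symm k) 1) =
      η y * ((mono k y : ℝ) : 𝕂) := fun y => by
    rw [MvPolynomial.eval_monomial, one_mul, ofReal_mono, Finsupp.prod_fintype _ _ (by simp)]
    simp
  simp only [h2] at h1
  have h3 := L.integral_comp_comm (integrable_test_mul_mono η k)
  rw [h1, map_zero] at h3
  rw [← h3]
  refine integral_congr_ae (Eventually.of_forall fun y => ?_)
  change L (η y) * mono k y = L (η y * _)
  rw [mul_comm (η y), ← RCLike.real_smul_eq_coe_mul, map_smul, smul_eq_mul, mul_comm]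

theorem norm_reCLM_le : ‖(RCLike.reCLM : 𝕂 →L[ℝ] ℝ)‖ ≤ 1 :=
  ContinuousLinearMap.opNorm_le_bound _ zero_le_one fun z => by
    simpa using RCLike.abs_re_le_norm z

theorem norm_imCLM_le : ‖(RCLike.imCLM : 𝕂 →L[ℝ] ℝ)‖ ≤ 1 :=
  ContinuousLinearMap.opNorm_le_bound _ zero_le_one fun z => by
    simpa using RCLike.abs_im_le_norm z

theorem norm_integral_mul_le_re_im {φ : EuclideanSpace ℝ (Fin d) → 𝕂} (hφ : Continuous φ)
    (hc : HasCompactSupport φ) {h : EuclideanSpace ℝ (Fin d) → 𝕂} (hh : Continuous h) :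
    ‖∫ y, φ y * h y‖ ≤ ‖∫ y, (RCLike.reCLM : 𝕂 →L[ℝ] ℝ) (φ y) • h y‖ +
      ‖∫ y, (RCLike.imCLM : 𝕂 →L[ℝ] ℝ) (φ y) • h y‖ := by
  have hi : ∀ L : 𝕂 →L[ℝ] ℝ, Integrable fun y => L (φ y) • h y := fun L =>
    ((L.continuous.comp hφ).smul hh).integrable_of_hasCompactSupport
      (hc.comp_left (map_zero L)).smul_right
  have h1 : ∀ y, φ y * h y = (RCLike.reCLM : 𝕂 →L[ℝ] ℝ) (φ y) • h y +
      RCLike.I * ((RCLike.imCLM : 𝕂 →L[ℝ] ℝ) (φ y) • h y) := fun y => by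
    simp only [RCLike.real_smul_eq_coe_mul, RCLike.reCLM_apply, RCLike.imCLM_apply]
    conv_lhs => rw [← RCLike.re_add_im (φ y)]
    ring
  simp only [h1]
  rw [integral_add (hi _) ((hi _).const_mul _), integral_const_mul]
  refine (norm_add_le _ _).trans ?_
  gcongr
  rw [norm_mul]
  refine mul_le_of_le_one_left (norm_nonneg _) ?_
  rw [RCLike.norm_I]
  split_ifs <;> simp

/-- Pairing with a rescaled test function is an average of the paired function. -/
theorem integral_rescale_smul {E : Type*} [NormedAddCommGroup E] [NormedSpace 𝕂 E]
    [NormedSpace ℝ E] [IsScalarTower ℝ 𝕂 E] (l : Ioc (0 : ℝ) 1) (x : EuclideanSpace ℝ (Fin d))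
    (η : 𝓓((⊤ : Opens (EuclideanSpace ℝ (Fin d))), 𝕂)) (F : EuclideanSpace ℝ (Fin d) → E) :
    ∫ y, rescale s l x η y • F y = ∫ z, η z • F (x + dil s l z) := by
  have hl := l.2.1
  have hp : (0 : ℝ) < (l : ℝ) ^ ∑ i, s i := Real.rpow_pos_of_pos hl _
  rw [← integral_add_left_eq_self _ x]
  have h1 := integral_comp_dil s hl fun y => rescale s l x η (x + y) • F (x + y)
  rw [eq_inv_smul_iff₀ hp.ne'] at h1
  rw [← h1, ← integral_smul]
  congr 1
  funext z
  have h2 : recentre s l x (x + dil s l z) = z := by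
    ext i
    simp only [recentre, PiLp.add_apply, dil_apply, add_sub_cancel_left]
    rw [← mul_assoc, ← Real.rpow_add hl, neg_add_cancel, Real.rpow_zero, one_mul]
  have h3 : rescale s l x η (x + dil s l z) = (((l : ℝ) ^ (-∑ i, s i) : ℝ) : 𝕂) * η z := by
    change _ * η (recentre s l x (x + dil s l z)) = _
    rw [h2]
  rw [h3, mul_smul, ← RCLike.real_smul_eq_coe_smul, smul_smul, Real.rpow_neg hl.le,
    mul_inv_cancel₀ hp.ne', one_smul]

theorem integral_toTest_smul {E : Type*} [NormedAddCommGroup E] [NormedSpace 𝕂 E]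
    [NormedSpace ℝ E] [IsScalarTower ℝ 𝕂 E] {η : EuclideanSpace ℝ (Fin d) → ℝ} (hη : IsBump s η)
    (hs : ∀ i, 1 ≤ s i) (l : Ioc (0 : ℝ) 1) (x : EuclideanSpace ℝ (Fin d))
    (F : EuclideanSpace ℝ (Fin d) → E) :
    ∫ y, rescale s l x (hη.toTest 𝕂 hs) y • F y = avg s η l F x := by
  rw [integral_rescale_smul]
  simp only [hη.toTest_apply, ← RCLike.real_smul_eq_coe_smul, avg]

end Cast

end

/-! ### Seminorms, duality and Hölder bounds -/

section

section Dual

variable {𝕂 : Type*} [RCLike 𝕂] {V : Type*} [AddCommGroup V] [Module 𝕂 V]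

/-- The space `V` as a seminormed space, with the seminorm `p`. -/
def SeminormSpace (_ : Seminorm 𝕂 V) : Type _ := V

instance (p : Seminorm 𝕂 V) : SeminormedAddCommGroup (SeminormSpace p) :=
  p.toAddGroupSeminorm.toSeminormedAddCommGroup

instance (p : Seminorm 𝕂 V) : Module 𝕂 (SeminormSpace p) := inferInstanceAs (Module 𝕂 V)

instance (p : Seminorm 𝕂 V) : NormedSpace 𝕂 (SeminormSpace p) where
  norm_smul_le c x := (map_smul_eq_mul p c x).le

/-- The identity map of `V` into the seminormed space of `p`. -/
def toSeminormSpace (p : Seminorm 𝕂 V) : V →ₗ[𝕂] SeminormSpace p := LinearMap.id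

theorem norm_toSeminormSpace (p : Seminorm 𝕂 V) (x : V) : ‖toSeminormSpace p x‖ = p x := rfl

variable [TopologicalSpace V] [IsTopologicalAddGroup V] {ι : Type*} {P : SeminormFamily 𝕂 V ι}

theorem continuous_of_norm_le_seminorm (hP : WithSeminorms P) (i : ι) {W : Type*}
    [NormedAddCommGroup W] [NormedSpace 𝕂 W] (ℓ : V →ₗ[𝕂] W) (h : ∀ x, ‖ℓ x‖ ≤ P i x) :
    Continuous ℓ := by
  refine continuous_of_continuousAt_zero ℓ ?_
  rw [ContinuousAt, map_zero]
  have hc := (hP.continuous_seminorm i).tendsto 0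
  rw [map_zero] at hc
  exact squeeze_zero_norm h hc

/-- The Hahn–Banach theorem for the seminorm `P i`. -/
theorem exists_dual_eq_seminorm (hP : WithSeminorms P) (i : ι) (a : V) :
    ∃ ℓ : V →L[𝕂] 𝕂, (∀ x, ‖ℓ x‖ ≤ P i x) ∧ ‖ℓ a‖ = P i a := by
  obtain ⟨g, hg, hga⟩ := exists_dual_vector'' 𝕂 (toSeminormSpace (P i) a)
  have hb : ∀ x, ‖(g.toLinearMap ∘ₗ toSeminormSpace (P i)) x‖ ≤ P i x := fun x =>
    (g.le_opNorm _).trans (mul_le_of_le_one_left (norm_nonneg _) hg)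
  refine ⟨⟨g.toLinearMap ∘ₗ toSeminormSpace (P i), continuous_of_norm_le_seminorm hP i _ hb⟩,
    hb, ?_⟩
  change ‖g (toSeminormSpace (P i) a)‖ = _
  rw [hga, RCLike.norm_ofReal, abs_norm, norm_toSeminormSpace]

theorem seminorm_le_of_dual (hP : WithSeminorms P) (i : ι) {a : V} {M : ℝ}
    (h : ∀ ℓ : V →L[𝕂] 𝕂, (∀ x, ‖ℓ x‖ ≤ P i x) → ‖ℓ a‖ ≤ M) : P i a ≤ M := by
  obtain ⟨ℓ, h1, h2⟩ := exists_dual_eq_seminorm hP i a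
  exact h2 ▸ h ℓ h1

theorem eq_of_dual [T1Space V] (hP : WithSeminorms P) {a b : V}
    (h : ∀ ℓ : V →L[𝕂] 𝕂, ℓ a = ℓ b) : a = b := by
  by_contra hab
  obtain ⟨i, hi⟩ := hP.separating_of_T1 (a - b) (sub_ne_zero.2 hab)
  refine hi (le_antisymm (seminorm_le_of_dual hP i fun ℓ _ => ?_) (apply_nonneg _ _))
  rw [map_sub, h, sub_self, norm_zero]

end Dual

section Bridge

variable {d : ℕ} {𝕂 : Type*} [RCLike 𝕂] {s : Fin d → ℝ} {V : Type*} [AddCommGroup V] [Module 𝕂 V]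
  [TopologicalSpace V]

theorem testOrder_add_pos (α : ℝ) : 0 < (testOrder α : ℝ) + α :=
  Nat.sInf_mem (s := {r : ℕ | 0 < (r : ℝ) + α})
    (by
      obtain ⟨n, hn⟩ := exists_nat_gt (-α)
      exact ⟨n, by simp only [mem_ofPred_eq]; linarith⟩)

theorem apply_rescale_le_of_holderNorm_le {α C : ℝ} {p : Seminorm 𝕂 V}
    {K : Compacts (EuclideanSpace ℝ (Fin d))} {ξ : VDist d 𝕂 V}
    (h : holderNorm s α p K ξ ≤ ENNReal.ofReal C) (hC : 0 ≤ C)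
    {x : EuclideanSpace ℝ (Fin d)} (hx : x ∈ K)
    {η : 𝓓((⊤ : Opens (EuclideanSpace ℝ (Fin d))), 𝕂)}
    (hη : η ∈ testBallVanishing 𝕂 s (testOrder α) α) (l : Ioc (0 : ℝ) 1) :
    p (ξ (rescale s l x η)) ≤ C * (l : ℝ) ^ α := by
  have h1 : ENNReal.ofReal ((l : ℝ) ^ (-α) * p (ξ (rescale s l x η))) ≤ ENNReal.ofReal C :=
    le_trans (le_trans (le_trans (le_trans (le_iSup
        (fun l : Ioc (0 : ℝ) 1 => ENNReal.ofReal ((l : ℝ) ^ (-α) * p (ξ (rescale s l x η)))) l)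
        (le_iSup₂ (f := fun η (_ : η ∈ testBallVanishing 𝕂 s (testOrder α) α) =>
          ⨆ l : Ioc (0 : ℝ) 1,
            ENNReal.ofReal ((l : ℝ) ^ (-α) * p (ξ (rescale s l x η)))) η hη))
        (le_iSup₂ (f := fun x (_ : x ∈ K) => ⨆ η ∈ testBallVanishing 𝕂 s (testOrder α) α,
          ⨆ l : Ioc (0 : ℝ) 1,
            ENNReal.ofReal ((l : ℝ) ^ (-α) * p (ξ (rescale s l x η)))) x hx)) le_self_add) h
  have h2 := (ENNReal.ofReal_le_ofReal_iff hC).1 h1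
  rw [Real.rpow_neg l.2.1.le, inv_mul_le_iff₀ (Real.rpow_pos_of_pos l.2.1 _)] at h2
  linarith

theorem apply_rescale_one_le_of_holderNorm_le {α C : ℝ} {p : Seminorm 𝕂 V}
    {K : Compacts (EuclideanSpace ℝ (Fin d))} {ξ : VDist d 𝕂 V}
    (h : holderNorm s α p K ξ ≤ ENNReal.ofReal C) (hC : 0 ≤ C)
    {x : EuclideanSpace ℝ (Fin d)} (hx : x ∈ K)
    {η : 𝓓((⊤ : Opens (EuclideanSpace ℝ (Fin d))), 𝕂)} (hη : η ∈ testBall 𝕂 s (testOrder α)) :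
    p (ξ (rescale s ⟨1, by norm_num⟩ x η)) ≤ C :=
  (ENNReal.ofReal_le_ofReal_iff hC).1 <|
    le_trans (le_trans (le_trans (le_iSup₂ (f := fun η (_ : η ∈ testBall 𝕂 s (testOrder α)) =>
          ENNReal.ofReal (p (ξ (rescale s ⟨1, by norm_num⟩ x η)))) η hη)
        (le_iSup₂ (f := fun x (_ : x ∈ K) => ⨆ η ∈ testBall 𝕂 s (testOrder α),
          ENNReal.ofReal (p (ξ (rescale s ⟨1, by norm_num⟩ x η)))) x hx)) le_add_self) h

theorem holderNorm_le {α C : ℝ} (hC : 0 ≤ C) {p : Seminorm 𝕂 V}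
    {K : Compacts (EuclideanSpace ℝ (Fin d))} {ξ : VDist d 𝕂 V}
    (h1 : ∀ x ∈ K, ∀ η ∈ testBallVanishing 𝕂 s (testOrder α) α, ∀ l : Ioc (0 : ℝ) 1,
      p (ξ (rescale s l x η)) ≤ C * (l : ℝ) ^ α)
    (h2 : ∀ x ∈ K, ∀ η ∈ testBall 𝕂 s (testOrder α),
      p (ξ (rescale s ⟨1, by norm_num⟩ x η)) ≤ C) :
    holderNorm s α p K ξ ≤ ENNReal.ofReal (2 * C) := by
  rw [two_mul, ENNReal.ofReal_add hC hC]
  refine add_le_add (iSup₂_le fun x hx => iSup₂_le fun η hη => iSup_le fun l => ?_)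
    (iSup₂_le fun x hx => iSup₂_le fun η hη => ENNReal.ofReal_le_ofReal (h2 x hx η hη))
  refine ENNReal.ofReal_le_ofReal ?_
  rw [Real.rpow_neg l.2.1.le, inv_mul_le_iff₀ (Real.rpow_pos_of_pos l.2.1 _), mul_comm]
  exact h1 x hx η hη l

theorem map_apply_eq_integral {E : Type*} [NormedAddCommGroup E] [NormedSpace 𝕂 E]
    [NormedSpace ℝ E] [CompleteSpace E] {ξ : VDist d 𝕂 V}
    {f : EuclideanSpace ℝ (Fin d) → V} (hξ : IsGivenBy ξ f) (T : V →L[𝕂] E)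
    (φ : 𝓓((⊤ : Opens (EuclideanSpace ℝ (Fin d))), 𝕂)) :
    T (ξ φ) = ∫ y, φ y • T (f y) := by
  have hi : Integrable fun y => φ y • T (f y) :=
    (φ.continuous.smul (T.continuous.comp hξ.1)).integrable_of_hasCompactSupport
      φ.hasCompactSupport.smul_right
  refine (SeparatingDual.eq_iff_forall_dual_eq (R := 𝕂)).2 fun ℓ => ?_
  rw [← ContinuousLinearMap.integral_comp_comm _ hi]
  refine (hξ.2 φ (ℓ.comp T)).trans ?_
  simp

/-- A finite Hölder norm of a distribution given by a function bounds the averages of every image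
of the function under a linear map dominated by the seminorm. -/
theorem IsGivenBy.holderBd (hs : ∀ i, 1 ≤ s i) {E : Type*} [NormedAddCommGroup E]
    [NormedSpace 𝕂 E] [NormedSpace ℝ E] [IsScalarTower ℝ 𝕂 E] [CompleteSpace E] {ξ : VDist d 𝕂 V}
    {f : EuclideanSpace ℝ (Fin d) → V} (hξ : IsGivenBy ξ f) (T : V →L[𝕂] E) {p : Seminorm 𝕂 V}
    (hT : ∀ a, ‖T a‖ ≤ p a) {α R C : ℝ} (hC : 0 ≤ C) {K : Compacts (EuclideanSpace ℝ (Fin d))}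
    (hK : ∀ x, ‖x‖ ≤ R → x ∈ K) (h : holderNorm s α p K ξ ≤ ENNReal.ofReal C) :
    HolderBd s α (testOrder α) (fun y => T (f y)) R C := by
  have key : ∀ (η : EuclideanSpace ℝ (Fin d) → ℝ) (hη : IsBump s η) (l : Ioc (0 : ℝ) 1) x,
      avg s η l (fun y => T (f y)) x = T (ξ (rescale s l x (hη.toTest 𝕂 hs))) := fun η hη l x => by
    rw [map_apply_eq_integral hξ, integral_toTest_smul]
  refine ⟨fun x hx η hη hη1 hv l hl hl1 => ?_, fun x hx η hη hη1 => ?_⟩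
  · rw [key η hη ⟨l, hl, hl1⟩]
    exact (hT _).trans (apply_rescale_le_of_holderNorm_le h hC (hK x hx)
      (hη.toTest_mem_testBallVanishing hs hη1 hv) _)
  · rw [key η hη ⟨1, by norm_num⟩]
    exact (hT _).trans (apply_rescale_one_le_of_holderNorm_le h hC (hK x hx)
      (hη.toTest_mem_testBall hs hη1))

variable [IsTopologicalAddGroup V] {ι : Type*} {P : SeminormFamily 𝕂 V ι}

theorem norm_integral_rescale_mul_le (l : Ioc (0 : ℝ) 1) (x : EuclideanSpace ℝ (Fin d))
    (η : 𝓓((⊤ : Opens (EuclideanSpace ℝ (Fin d))), 𝕂)) {h : EuclideanSpace ℝ (Fin d) → 𝕂}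
    (hh : Continuous h) :
    ‖∫ y, rescale s l x η y * h y‖ ≤
      ‖avg s (fun y => (RCLike.reCLM : 𝕂 →L[ℝ] ℝ) (η y)) l h x‖ +
      ‖avg s (fun y => (RCLike.imCLM : 𝕂 →L[ℝ] ℝ) (η y)) l h x‖ := by
  have h1 := integral_rescale_smul (s := s) l x η h
  simp only [smul_eq_mul] at h1
  rw [h1]
  exact norm_integral_mul_le_re_im η.continuous η.hasCompactSupport
    (h := fun z => h (x + dil s l z)) (hh.comp (by fun_prop))

/-- Bounds on all scalar components of a weak integral against a rescaled test function. -/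
theorem seminorm_le_of_holderBd (hP : WithSeminorms P) (i : ι)
    {f : EuclideanSpace ℝ (Fin d) → V} (hf : Continuous f) {α R C : ℝ} {r : ℕ}
    (h : ∀ ℓ : V →L[𝕂] 𝕂, (∀ a, ‖ℓ a‖ ≤ P i a) → HolderBd s α r (fun y => ℓ (f y)) R C)
    {x : EuclideanSpace ℝ (Fin d)} (hx : ‖x‖ ≤ R)
    {η : 𝓓((⊤ : Opens (EuclideanSpace ℝ (Fin d))), 𝕂)} (hη : η ∈ testBallVanishing 𝕂 s r α)
    (l : Ioc (0 : ℝ) 1) {a : V}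
    (ha : ∀ ℓ : V →L[𝕂] 𝕂, ℓ a = ∫ y, rescale s l x η y * ℓ (f y)) :
    P i a ≤ 2 * C * (l : ℝ) ^ α := by
  refine seminorm_le_of_dual hP i fun ℓ hℓ => ?_
  rw [ha]
  have hb : ∀ L : 𝕂 →L[ℝ] ℝ, ‖L‖ ≤ 1 →
      ‖avg s (fun y => L (η y)) l (fun y => ℓ (f y)) x‖ ≤ C * (l : ℝ) ^ α := fun L hL =>
    (h ℓ hℓ).1 x hx _ (isBump_clm_comp L hη.1) (fun j hj y =>
      (norm_iteratedFDeriv_clm_comp_le L hL η j y).trans (hη.1.2 j hj y)) (vanish_clm_comp L hη)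
      l l.2.1 l.2.2
  refine (norm_integral_rescale_mul_le l x η (ℓ.continuous.comp hf)).trans
    ((add_le_add (hb _ norm_reCLM_le) (hb _ norm_imCLM_le)).trans_eq ?_)
  ring

theorem seminorm_le_of_holderBd_one (hP : WithSeminorms P) (i : ι)
    {f : EuclideanSpace ℝ (Fin d) → V} (hf : Continuous f) {α R C : ℝ} {r : ℕ}
    (h : ∀ ℓ : V →L[𝕂] 𝕂, (∀ a, ‖ℓ a‖ ≤ P i a) → HolderBd s α r (fun y => ℓ (f y)) R C)
    {x : EuclideanSpace ℝ (Fin d)} (hx : ‖x‖ ≤ R)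
    {η : 𝓓((⊤ : Opens (EuclideanSpace ℝ (Fin d))), 𝕂)} (hη : η ∈ testBall 𝕂 s r) {a : V}
    (ha : ∀ ℓ : V →L[𝕂] 𝕂, ℓ a = ∫ y, rescale s ⟨1, by norm_num⟩ x η y * ℓ (f y)) :
    P i a ≤ 2 * C := by
  refine seminorm_le_of_dual hP i fun ℓ hℓ => ?_
  rw [ha]
  have hb : ∀ L : 𝕂 →L[ℝ] ℝ, ‖L‖ ≤ 1 →
      ‖avg s (fun y => L (η y)) 1 (fun y => ℓ (f y)) x‖ ≤ C := fun L hL =>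
    (h ℓ hℓ).2 x hx _ (isBump_clm_comp L hη) (fun j hj y =>
      (norm_iteratedFDeriv_clm_comp_le L hL η j y).trans (hη.2 j hj y))
  refine (norm_integral_rescale_mul_le _ x η (ℓ.continuous.comp hf)).trans
    ((add_le_add (hb _ norm_reCLM_le) (hb _ norm_imCLM_le)).trans_eq ?_)
  ring

/-- Bounds on all scalar components of a weak integral against an arbitrary test function. -/
theorem exists_seminorm_le_of_holderBd (𝕂 : Type*) [RCLike 𝕂] (hs : ∀ i, 1 ≤ s i) (r : ℕ)
    (ρ : ℝ) :
    ∃ A, 0 ≤ A ∧ ∀ {V : Type*} [AddCommGroup V] [Module 𝕂 V] [TopologicalSpace V]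
      [IsTopologicalAddGroup V] {ι : Type*} {P : SeminormFamily 𝕂 V ι}, WithSeminorms P →
      ∀ (i : ι) (f : EuclideanSpace ℝ (Fin d) → V), Continuous f → ∀ (α C : ℝ),
      (∀ ℓ : V →L[𝕂] 𝕂, (∀ a, ‖ℓ a‖ ≤ P i a) →
        HolderBd s α r (fun y => ℓ (f y)) (ρ + d) C) →
      ∀ (φ : 𝓓((⊤ : Opens (EuclideanSpace ℝ (Fin d))), 𝕂)), (∀ y, ρ < ‖y‖ → φ y = 0) →
      ∀ B, (∀ j ≤ r, ∀ y, ‖iteratedFDeriv ℝ j φ y‖ ≤ B) →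
      ∀ a : V, (∀ ℓ : V →L[𝕂] 𝕂, ℓ a = ∫ y, φ y * ℓ (f y)) → P i a ≤ A * (B * C) := by
  obtain ⟨A, hA, hA'⟩ := exists_norm_integral_smul_le (E := 𝕂) hs r ρ
  refine ⟨2 * A, by positivity, fun hP i f hf α C h φ hφ B hB a ha => ?_⟩
  refine seminorm_le_of_dual hP i fun ℓ hℓ => ?_
  rw [ha]
  have hb : ∀ L : 𝕂 →L[ℝ] ℝ, ‖L‖ ≤ 1 → ‖∫ y, L (φ y) • ℓ (f y)‖ ≤ A * (B * C) := fun L hL =>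
    hA' _ (contDiff_clm_comp L φ) (fun y hy => by rw [hφ y hy, map_zero]) B
      (fun j hj y => (norm_iteratedFDeriv_clm_comp_le L hL φ j y).trans (hB j hj y)) _
      (ℓ.continuous.comp hf) α C (h ℓ hℓ)
  refine (norm_integral_mul_le_re_im φ.continuous φ.hasCompactSupport
    (h := fun y => ℓ (f y)) (ℓ.continuous.comp hf)).trans
    ((add_le_add (hb _ norm_reCLM_le) (hb _ norm_imCLM_le)).trans_eq ?_)
  ring

end Bridge

end

/-! ### Weak integrals and multiplication in complete locally convex spaces -/

section

section WeakIntegral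

variable {d : ℕ} {𝕂 : Type*} [RCLike 𝕂] {V : Type*} [AddCommGroup V] [Module 𝕂 V]
  {ι : Type*} {P : SeminormFamily 𝕂 V ι}

theorem integral_comp_simpleFunc {X Y E : Type*} [MeasurableSpace X] [NormedAddCommGroup E]
    [NormedSpace ℝ E] [CompleteSpace E] (μ : Measure X) [IsFiniteMeasure μ] (S : SimpleFunc X Y)
    (F : Y → E) : ∫ x, F (S x) ∂μ = ∑ y ∈ S.range, μ.real (S ⁻¹' {y}) • F y := by
  have h : ∀ x, F (S x) = ∑ y ∈ S.range, (S ⁻¹' {y}).indicator (fun _ => F y) x := fun x => by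
    rw [Finset.sum_eq_single (S x)]
    · rw [indicator_of_mem (by simp)]
    · intro y _ hy
      rw [indicator_of_notMem (by simpa using hy.symm)]
    · intro h
      exact absurd (S.mem_range_self x) h
  simp only [h]
  rw [integral_finsetSum _ fun y _ =>
    (integrable_const (F y)).indicator (S.measurableSet_preimage _)]
  exact Finset.sum_congr rfl fun y _ => integral_indicator_const _ (S.measurableSet_preimage _)

theorem aestronglyMeasurable_comp_simpleFunc {X Y Z G : Type*} [MeasurableSpace X]
    [TopologicalSpace G] (μ : Measure X) (F : Y → Z → G) (S : SimpleFunc X Y)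
    (T : SimpleFunc X Z) : AEStronglyMeasurable (fun x => F (S x) (T x)) μ :=
  (show AEStronglyMeasurable ((S.pair T).map fun q => F q.1 q.2) μ from
    SimpleFunc.aestronglyMeasurable _)

/-- A continuous function with compact support and values in a complete locally convex space has a
weak integral. It is the limit of the integrals of the compositions with simple functions that
converge pointwise to the identity of `ℝ^d`; these form a Cauchy sequence by Hahn–Banach and
dominated convergence. -/
theorem exists_weak_integral [UniformSpace V] [IsUniformAddGroup V] [CompleteSpace V]
    (hP : WithSeminorms P) {h : EuclideanSpace ℝ (Fin d) → V} (hh : Continuous h)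
    (hc : HasCompactSupport h) : ∃ a : V, ∀ ℓ : V →L[𝕂] 𝕂, ℓ a = ∫ y, ℓ (h y) := by
  let μ : Measure (EuclideanSpace ℝ (Fin d)) := volume.restrict (tsupport h)
  have : IsFiniteMeasure μ := ⟨by
    rw [Measure.restrict_apply_univ]; exact hc.isCompact.measure_lt_top⟩
  let S : ℕ → SimpleFunc (EuclideanSpace ℝ (Fin d)) (EuclideanSpace ℝ (Fin d)) :=
    SimpleFunc.nearestPt (denseSeq _)
  have hS : ∀ x, Tendsto (fun n => S n x) atTop (𝓝 x) := fun x =>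
    SimpleFunc.tendsto_nearestPt (by rw [(denseRange_denseSeq _).closure_range]; trivial)
  let a : ℕ → V := fun n => ∑ y ∈ (S n).range, ((μ.real (S n ⁻¹' {y}) : ℝ) : 𝕂) • h y
  have ha : ∀ (ℓ : V →L[𝕂] 𝕂) n, ℓ (a n) = ∫ x, ℓ (h (S n x)) ∂μ := fun ℓ n => by
    rw [integral_comp_simpleFunc μ (S n) fun y => ℓ (h y), map_sum]
    simp only [map_smul, RCLike.real_smul_eq_coe_mul, smul_eq_mul]
  have hbd : ∀ i, ∃ C, ∀ y, P i (h y) ≤ C := fun i => by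
    obtain ⟨C, hC⟩ := ((hP.continuous_seminorm i).comp hh).bounded_above_of_compact_support
      (hc.comp_left (map_zero (P i)))
    exact ⟨C, fun y => (le_abs_self _).trans (hC y)⟩
  have hcau : CauchySeq a := by
    rw [cauchySeq_iff_tendsto, uniformity_eq_comap_nhds_zero, tendsto_comap_iff]
    refine (hP.tendsto_nhds _ _).2 fun i ε hε => ?_
    obtain ⟨C, hC⟩ := hbd i
    have hD : Tendsto (fun q : ℕ × ℕ => ∫ x, P i (h (S q.2 x) - h (S q.1 x)) ∂μ) atTop
        (𝓝 (∫ _, (0 : ℝ) ∂μ)) := by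
      refine tendsto_integral_filter_of_dominated_convergence (fun _ => C + C)
        (Eventually.of_forall fun q => aestronglyMeasurable_comp_simpleFunc μ (fun u v => P i (h u - h v)) (S q.2) (S q.1))
        (Eventually.of_forall fun q => Eventually.of_forall fun x => ?_) (integrable_const _)
        (Eventually.of_forall fun x => ?_)
      · rw [Real.norm_of_nonneg (apply_nonneg _ _)]
        exact (map_sub_le_add _ _ _).trans (add_le_add (hC _) (hC _))
      · have h1 : Tendsto (fun n => h (S n x)) atTop (𝓝 (h x)) := (hh.tendsto x).comp (hS x)
        rw [← prod_atTop_atTop_eq]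
        have h2 := ((hP.continuous_seminorm i).tendsto _).comp
          ((h1.comp tendsto_snd).sub (h1.comp (tendsto_fst (f := atTop) (g := atTop))))
        rw [sub_self, map_zero] at h2
        exact h2
    rw [integral_zero] at hD
    filter_upwards [hD.eventually (gt_mem_nhds hε)] with q hq
    rw [sub_zero]
    refine lt_of_le_of_lt (seminorm_le_of_dual hP i fun ℓ hℓ => ?_) hq
    change ‖ℓ (a q.2 - a q.1)‖ ≤ _
    have hi : ∀ n, Integrable (fun x => ℓ (h (S n x))) μ := fun n =>
      Integrable.of_bound (aestronglyMeasurable_comp_simpleFunc μ (fun u _ => ℓ (h u)) (S n) (S n)) C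
        (Eventually.of_forall fun x => (hℓ _).trans (hC _))
    rw [map_sub, ha, ha, ← integral_sub (hi _) (hi _)]
    refine norm_integral_le_of_norm_le ?_ (Eventually.of_forall fun x => ?_)
    · refine Integrable.of_bound (aestronglyMeasurable_comp_simpleFunc μ (fun u v => P i (h u - h v)) (S q.2) (S q.1)) (C + C)
        (Eventually.of_forall fun x => ?_)
      rw [Real.norm_of_nonneg (apply_nonneg _ _)]
      exact (map_sub_le_add _ _ _).trans (add_le_add (hC _) (hC _))
    · rw [← map_sub]
      exact hℓ _
  obtain ⟨b, hb⟩ := cauchySeq_tendsto_of_complete hcau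
  refine ⟨b, fun ℓ => ?_⟩
  have h1 : Tendsto (fun n => ℓ (a n)) atTop (𝓝 (ℓ b)) := (ℓ.continuous.tendsto b).comp hb
  have h2 : Tendsto (fun n => ℓ (a n)) atTop (𝓝 (∫ x, ℓ (h x) ∂μ)) := by
    simp only [ha]
    obtain ⟨C, hC⟩ := (ℓ.continuous.comp hh).bounded_above_of_compact_support
      (hc.comp_left (map_zero ℓ))
    exact tendsto_integral_filter_of_dominated_convergence (fun _ => C)
      (Eventually.of_forall fun n => aestronglyMeasurable_comp_simpleFunc μ (fun u _ => ℓ (h u)) (S n) (S n))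
      (Eventually.of_forall fun n => Eventually.of_forall fun x => hC _) (integrable_const _)
      (Eventually.of_forall fun x =>
        (ℓ.continuous.tendsto _).comp ((hh.tendsto x).comp (hS x)))
  rw [tendsto_nhds_unique h1 h2]
  refine setIntegral_eq_integral_of_forall_compl_eq_zero fun x hx => ?_
  rw [image_eq_zero_of_notMem_tsupport hx, map_zero]

/-- A biadditive map is continuous if each seminorm of its values is dominated by the product of
continuous functions of the arguments that vanish at zero. -/
theorem continuous_of_seminorm_le_mul [TopologicalSpace V] [IsTopologicalAddGroup V]
    (hP : WithSeminorms P) {X Y : Type*} [AddCommGroup X] [TopologicalSpace X]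
    [IsTopologicalAddGroup X] [AddCommGroup Y] [TopologicalSpace Y] [IsTopologicalAddGroup Y]
    (b : X →+ Y →+ V)
    (h : ∀ i, ∃ (p : X → ℝ) (q : Y → ℝ), Continuous p ∧ Continuous q ∧ p 0 = 0 ∧ q 0 = 0 ∧
      ∀ x y, P i (b x y) ≤ p x * q y) : Continuous fun z : X × Y => b z.1 z.2 := by
  refine continuous_of_continuousAt_zero₂ b ?_ (fun x => ?_) fun y => ?_
  all_goals
    rw [ContinuousAt]
    simp only [map_zero, AddMonoidHom.zero_apply]
    refine (hP.tendsto_nhds _ _).2 fun i ε hε => ?_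
    obtain ⟨p, q, hp, hq, hp0, hq0, hb⟩ := h i
    simp only [sub_zero]
  · have h1 : Tendsto (fun z : X × Y => p z.1 * q z.2) (𝓝 (0, 0)) (𝓝 0) := by
      have h2 : Continuous fun z : X × Y => p z.1 * q z.2 := by fun_prop
      have := h2.tendsto (0, 0)
      simpa [hp0] using this
    filter_upwards [h1.eventually (gt_mem_nhds hε)] with z hz using (hb _ _).trans_lt hz
  · have h1 : Tendsto (fun y => p x * q y) (𝓝 0) (𝓝 0) := by
      have := (hq.const_mul (p x)).tendsto 0
      simpa [hq0] using this
    filter_upwards [h1.eventually (gt_mem_nhds hε)] with z hz using (hb _ _).trans_lt hz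
  · have h1 : Tendsto (fun x => p x * q y) (𝓝 0) (𝓝 0) := by
      have := (hp.mul_const (q y)).tendsto 0
      simpa [hp0] using this
    filter_upwards [h1.eventually (gt_mem_nhds hε)] with z hz using (hb _ _).trans_lt hz

end WeakIntegral

section Algebra

variable {d : ℕ} {𝕂 : Type*} [RCLike 𝕂] {A : Type*} [NonUnitalRing A] [Module 𝕂 A]
  [TopologicalSpace A] [IsTopologicalAddGroup A] [ContinuousSMul 𝕂 A]

theorem continuousMul_of_seminorms {ι : Type*} {P : SeminormFamily 𝕂 A ι} (hP : WithSeminorms P)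
    (hmul : ∀ (i : ι) (a b : A), P i (a * b) ≤ P i a * P i b) : ContinuousMul A :=
  ⟨continuous_of_seminorm_le_mul hP AddMonoidHom.mul fun i => ⟨P i, P i, hP.continuous_seminorm i,
    hP.continuous_seminorm i, map_zero _, map_zero _, hmul i⟩⟩

theorem IsCk.of_succ {V : Type*} [AddCommGroup V] [Module 𝕂 V] [TopologicalSpace V] {n : ℕ} :
    ∀ {f : EuclideanSpace ℝ (Fin d) → V}, IsCk 𝕂 (n + 1) f → IsCk 𝕂 n f := by
  induction n with
  | zero => exact fun h => h.1
  | succ n ih => exact fun ⟨h1, g, h2, h3⟩ => ⟨h1, g, h2, fun i => ih (h3 i)⟩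

theorem IsCk.mul [ContinuousMul A] [IsScalarTower 𝕂 A A] [SMulCommClass 𝕂 A A] {n : ℕ} :
    ∀ {f g : EuclideanSpace ℝ (Fin d) → A}, IsCk 𝕂 n f → IsCk 𝕂 n g →
      IsCk 𝕂 n fun x => f x * g x := by
  induction n with
  | zero => exact fun hf hg => Continuous.mul hf hg
  | succ n ih =>
    intro f g hf hg
    have hf0 := hf.of_succ
    have hg0 := hg.of_succ
    obtain ⟨hfc, f', hf1, hf2⟩ := hf
    obtain ⟨hgc, g', hg1, hg2⟩ := hg
    refine ⟨hfc.mul hgc, fun i x => f' i x * g x + f x * g' i x, fun i x => ?_,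
      fun i => (ih (hf2 i) hg0).add (ih hf0 (hg2 i))⟩
    have h1 : Tendsto (fun t : ℝ => g (x + t • EuclideanSpace.single i (1 : ℝ))) (𝓝[≠] 0)
        (𝓝 (g x)) := by
      have : Continuous fun t : ℝ => g (x + t • EuclideanSpace.single i (1 : ℝ)) := by fun_prop
      have h := this.tendsto 0
      rw [zero_smul, add_zero] at h
      exact h.mono_left nhdsWithin_le_nhds
    refine (((hf1 i x).mul h1).add ((hg1 i x).const_mul (f x))).congr fun t => ?_
    rw [smul_mul_assoc, mul_smul_comm, ← smul_add]
    congr 1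
    rw [sub_mul, mul_sub]
    abel

theorem IsTest.mul [ContinuousMul A] [IsScalarTower 𝕂 A A] [SMulCommClass 𝕂 A A]
    {f g : EuclideanSpace ℝ (Fin d) → A} (hf : IsTest 𝕂 f) (hg : IsTest 𝕂 g) :
    IsTest 𝕂 fun x => f x * g x :=
  ⟨fun n => (hf.1 n).mul (hg.1 n), hf.2.mul_right⟩

end Algebra

end

/-! ### Extension of bilinear maps, and continuity of distributions -/

section

section Extension

variable {𝕂 : Type*} [RCLike 𝕂] {X Y G : Type*} [AddCommGroup X] [Module 𝕂 X] [TopologicalSpace X]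
  [IsTopologicalAddGroup X] [ContinuousConstSMul 𝕂 X] [AddCommGroup Y] [Module 𝕂 Y]
  [TopologicalSpace Y] [IsTopologicalAddGroup Y] [ContinuousConstSMul 𝕂 Y]

/-- A closed property of pairs holds everywhere if it holds on a product of dense subspaces. -/
theorem dense_bilin_induction {DX : Submodule 𝕂 X} {DY : Submodule 𝕂 Y}
    (hX : Dense (DX : Set X)) (hY : Dense (DY : Set Y)) {p : X → Y → Prop}
    (hp : IsClosed {z : X × Y | p z.1 z.2}) (h : ∀ (x : DX) (y : DY), p x y) (x : X) (y : Y) :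
    p x y :=
  isClosed_property (p := fun z : X × Y => p z.1 z.2)
    (hX.denseRange_val.prodMap hY.denseRange_val) hp (fun z => h z.1 z.2) (x, y)

/-- A continuous bilinear map into a complete space extends from dense subspaces. -/
theorem exists_bilin_extension {DX : Submodule 𝕂 X} {DY : Submodule 𝕂 Y}
    (hX : Dense (DX : Set X)) (hY : Dense (DY : Set Y)) [UniformSpace G] [AddCommGroup G]
    [IsUniformAddGroup G] [T2Space G] [CompleteSpace G] [Module 𝕂 G] [ContinuousConstSMul 𝕂 G]
    (W : DX →ₗ[𝕂] DY →ₗ[𝕂] G) (hW : Continuous fun z : DX × DY => W z.1 z.2) :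
    ∃ B : X →ₗ[𝕂] Y →ₗ[𝕂] G, (Continuous fun z : X × Y => B z.1 z.2) ∧
      ∀ (x : DX) (y : DY), B x y = W x y := by
  let φ : DX →+ DY →+ G := AddMonoidHom.mk' (fun x => (W x).toAddMonoidHom) fun x x' => by
    ext y
    simp
  have de : IsDenseInducing (DX.subtype : DX →+ X) := hX.isDenseInducing_val
  have df : IsDenseInducing (DY.subtype : DY →+ Y) := hY.isDenseInducing_val
  have hφ : Continuous fun p : DX × DY => φ p.1 p.2 := hW
  have hc := IsDenseInducing.extend_Z_bilin de df hφ
  set b := (de.prodMap df).extend fun p : DX × DY => φ p.1 p.2 with hb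
  have hbW : ∀ (x : DX) (y : DY), b (x, y) = W x y := fun x y =>
    (de.prodMap df).extend_eq hφ (x, y)
  have h1 : ∀ x x' y, b (x + x', y) = b (x, y) + b (x', y) := fun x x' y => by
    refine isClosed_property2 (p := fun x x' => b (x + x', y) = b (x, y) + b (x', y))
      hX.denseRange_val (isClosed_eq (by fun_prop) (by fun_prop)) (fun x x' => ?_) x x'
    refine isClosed_property (p := fun y => b (x + x', y) = b (x, y) + b (x', y))
      hY.denseRange_val (isClosed_eq (by fun_prop) (by fun_prop)) (fun y => ?_) y
    rw [← Submodule.coe_add, hbW, hbW, hbW, map_add, LinearMap.add_apply]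
  have h2 : ∀ (c : 𝕂) x y, b (c • x, y) = c • b (x, y) := fun c x y => by
    refine dense_bilin_induction (p := fun x y => b (c • x, y) = c • b (x, y)) hX hY
      (isClosed_eq (by fun_prop) (by fun_prop)) (fun x y => ?_) x y
    rw [← Submodule.coe_smul, hbW, hbW, map_smul, LinearMap.smul_apply]
  have h3 : ∀ x y y', b (x, y + y') = b (x, y) + b (x, y') := fun x y y' => by
    refine isClosed_property2 (p := fun y y' => b (x, y + y') = b (x, y) + b (x, y'))
      hY.denseRange_val (isClosed_eq (by fun_prop) (by fun_prop)) (fun y y' => ?_) y y'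
    refine isClosed_property (p := fun x => b (x, (y : Y) + y') = b (x, y) + b (x, y'))
      hX.denseRange_val (isClosed_eq (by fun_prop) (by fun_prop)) (fun x => ?_) x
    rw [← Submodule.coe_add, hbW, hbW, hbW, map_add]
  have h4 : ∀ (c : 𝕂) x y, b (x, c • y) = c • b (x, y) := fun c x y => by
    refine dense_bilin_induction (p := fun x y => b (x, c • y) = c • b (x, y)) hX hY
      (isClosed_eq (by fun_prop) (by fun_prop)) (fun x y => ?_) x y
    rw [← Submodule.coe_smul, hbW, hbW, map_smul]
  exact ⟨LinearMap.mk₂ 𝕂 (fun x y => b (x, y)) h1 h2 h3 h4, hc, hbW⟩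

end Extension

section Continuity

variable {d : ℕ} {𝕂 : Type*} [RCLike 𝕂] {V : Type*} [AddCommGroup V] [Module 𝕂 V]
  [TopologicalSpace V] [IsTopologicalAddGroup V] [ContinuousSMul 𝕂 V] {ι : Type*}
  {P : SeminormFamily 𝕂 V ι}

/-- A linear map on test functions is a distribution if on each ball its seminorms are bounded by
the supremum of finitely many derivatives. -/
theorem exists_vdist_of_bound (hP : WithSeminorms P)
    (T : 𝓓((⊤ : Opens (EuclideanSpace ℝ (Fin d))), 𝕂) →ₗ[𝕂] V) (r : ℕ)
    (h : ∀ (i : ι) (ρ : ℝ), ∃ A, ∀ (φ : 𝓓((⊤ : Opens (EuclideanSpace ℝ (Fin d))), 𝕂)) (B : ℝ),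
      (∀ y, ρ < ‖y‖ → φ y = 0) → (∀ j ≤ r, ∀ y, ‖iteratedFDeriv ℝ j φ y‖ ≤ B) →
      P i (T φ) ≤ A * B) : ∃ ξ : VDist d 𝕂 V, ∀ φ, ξ φ = T φ := by
  let _ : Module ℝ V := Module.compHom V (algebraMap ℝ 𝕂)
  have : IsScalarTower ℝ 𝕂 V := ⟨fun a b v => by
    rw [Algebra.smul_def, mul_smul]; rfl⟩
  have : ContinuousSMul ℝ V := IsScalarTower.continuousSMul 𝕂
  have : LocallyConvexSpace ℝ V := hP.toLocallyConvexSpace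
  have hc : Continuous T := by
    rw [TestFunction.continuous_iff_continuous_comp]
    intro K hK
    let S : ContDiffMapSupportedIn (EuclideanSpace ℝ (Fin d)) 𝕂 ⊤ K →ₗ[𝕂] V :=
      T ∘ₗ (TestFunction.ofSupportedInCLM 𝕂 hK).toLinearMap
    change Continuous S
    refine WithSeminorms.continuous_of_continuous_comp hP _ fun i => ?_
    obtain ⟨ρ, hρ⟩ := K.isCompact.isBounded.subset_closedBall 0
    obtain ⟨A, hA⟩ := h i ρ
    let N : ℕ → Seminorm 𝕂 (ContDiffMapSupportedIn (EuclideanSpace ℝ (Fin d)) 𝕂 ⊤ K) :=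
      fun j => ContDiffMapSupportedIn.seminorm 𝕂 (EuclideanSpace ℝ (Fin d)) 𝕂 ⊤ K j
    have hN : ∀ j, Continuous (N j) := fun j =>
      (ContDiffMapSupportedIn.withSeminorms 𝕂 _ _ _ _).continuous_seminorm j
    refine Seminorm.continuous_of_continuousAt_zero ?_
    rw [ContinuousAt, map_zero]
    have h0 : Tendsto (fun φ => A * ∑ j ∈ Finset.range (r + 1), N j φ) (𝓝 0) (𝓝 0) := by
      have : Continuous fun φ => A * ∑ j ∈ Finset.range (r + 1), N j φ :=
        continuous_const.mul (continuous_finsetSum _ fun j _ => hN j)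
      simpa using this.tendsto 0
    refine squeeze_zero (fun _ => apply_nonneg _ _) (fun φ => ?_) h0
    refine hA (TestFunction.ofSupportedIn hK φ) _ (fun y hy => ?_) fun j hj y => ?_
    · exact φ.zero_on_compl fun hyK => by
        have := hρ hyK
        rw [mem_closedBall_zero_iff] at this
        linarith
    · have h1 : ‖iteratedFDeriv ℝ j φ y‖ ≤ N j φ :=
        ContDiffMapSupportedIn.norm_iteratedFDeriv_apply_le_seminorm_top 𝕂
      exact h1.trans (Finset.single_le_sum (f := fun j => N j φ) (fun _ _ => apply_nonneg _ _)
        (Finset.mem_range_succ_iff.2 hj))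
  exact ⟨⟨T, hc⟩, fun _ => rfl⟩

end Continuity

section Unique

variable {d : ℕ} {𝕂 : Type*} [RCLike 𝕂] {V : Type*} [AddCommGroup V] [Module 𝕂 V]
  [TopologicalSpace V] [IsTopologicalAddGroup V] {ι : Type*} {P : SeminormFamily 𝕂 V ι}

/-- The continuous function that represents a distribution is unique. -/
theorem IsGivenBy.unique [T1Space V] (hP : WithSeminorms P) {ξ : VDist d 𝕂 V}
    {f g : EuclideanSpace ℝ (Fin d) → V} (hf : IsGivenBy ξ f) (hg : IsGivenBy ξ g) : f = g := by
  have h : ∀ ℓ : V →L[𝕂] 𝕂, (fun x => ℓ (f x)) = fun x => ℓ (g x) := fun ℓ => by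
    have hfc := ℓ.continuous.comp hf.1
    have hgc := ℓ.continuous.comp hg.1
    refine hfc.ae_eq_iff_eq (μ := volume) hgc |>.1 ?_
    refine ae_eq_of_integral_contDiff_smul_eq hfc.locallyIntegrable hgc.locallyIntegrable
      fun u hu hc => ?_
    let φ : 𝓓((⊤ : Opens (EuclideanSpace ℝ (Fin d))), 𝕂) :=
      ⟨fun y => (u y : 𝕂), (RCLike.ofRealCLM (K := 𝕂)).contDiff.comp hu,
        hc.comp_left RCLike.ofReal_zero, fun _ _ => trivial⟩
    have h1 : ∀ y, u y • ℓ (f y) = φ y * ℓ (f y) := fun y => RCLike.real_smul_eq_coe_mul _ _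
    have h2 : ∀ y, u y • ℓ (g y) = φ y * ℓ (g y) := fun y => RCLike.real_smul_eq_coe_mul _ _
    simp only [Function.comp_apply, h1, h2]
    rw [← hf.2, ← hg.2]
  funext x
  exact eq_of_dual hP fun ℓ => congrFun (h ℓ) x

end Unique

end

/-! ### The product of continuous elements of the Hölder spaces -/

section

section Pairing

variable {𝕂 : Type*} [RCLike 𝕂]

/-- The dual of the space `V` with the seminorm `p`. It is a Banach space although `p` need not be
a norm. -/
def SeminormDual {V : Type*} [AddCommGroup V] [Module 𝕂 V] (p : Seminorm 𝕂 V) : Type _ :=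
  SeminormSpace p →L[𝕂] 𝕂

section SeminormDual

variable {V : Type*} [AddCommGroup V] [Module 𝕂 V] (p : Seminorm 𝕂 V)

instance : NormedAddCommGroup (SeminormDual p) :=
  NormedAddCommGroup.ofSeparation (E := SeminormSpace p →L[𝕂] 𝕂)
    fun f hf => ContinuousLinearMap.ext fun x =>
      norm_le_zero_iff.1 ((f.le_opNorm x).trans_eq (by rw [hf, zero_mul]))

instance : NormedSpace 𝕂 (SeminormDual p) :=
  inferInstanceAs (NormedSpace 𝕂 (SeminormSpace p →L[𝕂] 𝕂))

instance : NormedSpace ℝ (SeminormDual p) :=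
  inferInstanceAs (NormedSpace ℝ (SeminormSpace p →L[𝕂] 𝕂))

instance : IsScalarTower ℝ 𝕂 (SeminormDual p) :=
  inferInstanceAs (IsScalarTower ℝ 𝕂 (SeminormSpace p →L[𝕂] 𝕂))

instance : CompleteSpace (SeminormDual p) :=
  inferInstanceAs (CompleteSpace (SeminormSpace p →L[𝕂] 𝕂))

/-- Evaluation of an element of the dual at a vector. -/
def SeminormDual.eval (x : V) : SeminormDual p →ₗ[𝕂] 𝕂 where
  toFun e := (show SeminormSpace p →L[𝕂] 𝕂 from e) (toSeminormSpace p x)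
  map_add' _ _ := rfl
  map_smul' _ _ := rfl

theorem SeminormDual.norm_eval_le (x : V) (e : SeminormDual p) : ‖eval p x e‖ ≤ p x * ‖e‖ := by
  rw [mul_comm]
  exact (show SeminormSpace p →L[𝕂] 𝕂 from e).le_opNorm (toSeminormSpace p x)

theorem SeminormDual.eval_add (x y : V) (e : SeminormDual p) :
    eval p (x + y) e = eval p x e + eval p y e :=
  map_add (show SeminormSpace p →L[𝕂] 𝕂 from e) (toSeminormSpace p x) (toSeminormSpace p y)

theorem SeminormDual.eval_smul (c : 𝕂) (x : V) (e : SeminormDual p) :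
    eval p (c • x) e = c • eval p x e :=
  map_smul (show SeminormSpace p →L[𝕂] 𝕂 from e) c (toSeminormSpace p x)

/-- A linear functional bounded by a multiple of the seminorm, as an element of the dual. -/
theorem SeminormDual.exists_of_bound (ℓ : V →ₗ[𝕂] 𝕂) {C : ℝ} (hC : 0 ≤ C)
    (h : ∀ x, ‖ℓ x‖ ≤ C * p x) : ∃ e : SeminormDual p, ‖e‖ ≤ C ∧ ∀ x, eval p x e = ℓ x := by
  let m : SeminormSpace p →ₗ[𝕂] 𝕂 := ℓ
  exact ⟨m.mkContinuous C h, m.mkContinuous_norm_le hC h, fun _ => rfl⟩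

theorem SeminormDual.ext {e e' : SeminormDual p} (h : ∀ x, eval p x e = eval p x e') : e = e' :=
  ContinuousLinearMap.ext (f := (show SeminormSpace p →L[𝕂] 𝕂 from e))
    (g := (show SeminormSpace p →L[𝕂] 𝕂 from e')) h

end SeminormDual

/-- Young's product estimate for a bilinear pairing that is not bundled as a continuous map. -/
theorem exists_holderBd_bilin_of_bound {d : ℕ} {s : Fin d → ℝ} {E F G : Type*}
    [NormedAddCommGroup E] [NormedSpace ℝ E] [CompleteSpace E] [NormedAddCommGroup F]
    [NormedSpace ℝ F] [CompleteSpace F] [NormedAddCommGroup G] [NormedSpace ℝ G] [CompleteSpace G]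
    (hs : ∀ i, 1 ≤ s i) {α β : ℝ} {r : ℕ} (hpos : 0 < α + β) (hr : 0 < r + min α β) (rf rg : ℕ)
    (b : E → F → G) (hb₁ : ∀ x x' y, b (x + x') y = b x y + b x' y)
    (hb₂ : ∀ (c : ℝ) x y, b (c • x) y = c • b x y)
    (hb₃ : ∀ x y y', b x (y + y') = b x y + b x y')
    (hb₄ : ∀ (c : ℝ) x y, b x (c • y) = c • b x y) (hb : ∀ x y, ‖b x y‖ ≤ ‖x‖ * ‖y‖) :
    ∃ A, 0 ≤ A ∧ ∀ (f : EuclideanSpace ℝ (Fin d) → E), Continuous f →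
      ∀ (g : EuclideanSpace ℝ (Fin d) → F), Continuous g → ∀ (R Cf Cg : ℝ), 0 ≤ Cf → 0 ≤ Cg →
      HolderBd s α rf f (R + 4 * d) Cf → HolderBd s β rg g (R + 4 * d) Cg →
      HolderBd s (min α β) r (fun y => b (f y) (g y)) R (A * (Cf * Cg)) := by
  obtain ⟨A, hA, h⟩ := exists_holderBd_bilin (E := E) (F := F) (G := G) hs hpos hr rf rg
  exact ⟨A, hA, h (LinearMap.mkContinuous₂ (LinearMap.mk₂ ℝ b hb₁ hb₂ hb₃ hb₄) 1
    fun x y => by rw [one_mul]; exact hb x y) (LinearMap.mkContinuous₂_norm_le _ zero_le_one _)⟩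

end Pairing

section HolderSpaceSeminorm

variable {d : ℕ} {𝕂 : Type*} [RCLike 𝕂] {s : Fin d → ℝ} {V : Type*} [AddCommGroup V] [Module 𝕂 V]
  [TopologicalSpace V] [IsTopologicalAddGroup V] [ContinuousSMul 𝕂 V] {ι : Type*}
  {P : SeminormFamily 𝕂 V ι} {α : ℝ}

/-- The closed ball as a compact set. -/
def ballCompacts (d : ℕ) (R : ℝ) : Compacts (EuclideanSpace ℝ (Fin d)) :=
  ⟨Metric.closedBall 0 R, isCompact_closedBall 0 R⟩

theorem mem_ballCompacts {R : ℝ} {x : EuclideanSpace ℝ (Fin d)} :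
    x ∈ ballCompacts d R ↔ ‖x‖ ≤ R := mem_closedBall_zero_iff

/-- The Hölder seminorm on the ball of radius `R`, on the Hölder space. -/
def ballSeminorm (s : Fin d → ℝ) (α : ℝ) (P : SeminormFamily 𝕂 V ι) (R : ℝ) (i : ι) :
    Seminorm 𝕂 (HolderSpace s α P) :=
  (holderSeminorms s α P (ballCompacts d R, i)).comp (HolderSpace s α P).subtype

theorem continuous_ballSeminorm (R : ℝ) (i : ι) : Continuous (ballSeminorm s α P R i) :=
  ((withSeminorms_holder s α P).continuous_seminorm _).comp continuous_subtype_val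

theorem holderNorm_ball (R : ℝ) (i : ι) (ξ : HolderSpace s α P) :
    holderNorm s α (P i) (ballCompacts d R) (HolderSpace.toDist ξ) =
      ENNReal.ofReal (ballSeminorm s α P R i ξ) :=
  (ENNReal.ofReal_toReal ((ξ : BoundedHolder s α P).2 (ballCompacts d R) i).ne).symm

/-- The elements of the Hölder space that are given by continuous functions. -/
def continuousElements (s : Fin d → ℝ) (α : ℝ) (P : SeminormFamily 𝕂 V ι) :
    Submodule 𝕂 (HolderSpace s α P) where
  carrier := {ξ | ∃ f, IsGivenBy (HolderSpace.toDist ξ) f}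
  zero_mem' := ⟨_, IsGivenBy.zero⟩
  add_mem' := fun ⟨_, hf⟩ ⟨_, hg⟩ => ⟨_, hf.add hg⟩
  smul_mem' := fun c _ ⟨_, hf⟩ => ⟨_, hf.const_smul c⟩

/-- The elements of the Hölder space that are given by test functions. -/
def testElements (s : Fin d → ℝ) (α : ℝ) (P : SeminormFamily 𝕂 V ι) : Set (HolderSpace s α P) :=
  {ξ | ∃ f, IsTest 𝕂 f ∧ IsGivenBy (HolderSpace.toDist ξ) f}

theorem dense_testElements : Dense (testElements s α P) := by
  intro ξ
  rw [closure_subtype]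
  have h : (ξ : BoundedHolder s α P) ∈ closure (testSubmodule s α P : Set _) := ξ.2
  refine closure_mono (fun ζ hζ => ?_) h
  exact ⟨(⟨ζ, subset_closure hζ⟩ : HolderSpace s α P), hζ, rfl⟩

theorem dense_continuousElements :
    Dense (continuousElements s α P : Set (HolderSpace s α P)) :=
  dense_testElements.mono fun _ h => h.imp fun _ hf => hf.2

end HolderSpaceSeminorm

section Product

variable {d : ℕ} {𝕂 : Type*} [RCLike 𝕂] {s : Fin d → ℝ} {A : Type*} [NonUnitalRing A]
  [Module 𝕂 A] [IsScalarTower 𝕂 A A] [SMulCommClass 𝕂 A A] {ι : Type*}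
  {P : SeminormFamily 𝕂 A ι}

section Estimate

variable [TopologicalSpace A] [IsTopologicalAddGroup A] [ContinuousSMul 𝕂 A]

/-- Young's estimate for the scalar components of a pointwise product in the algebra: the pairing
of `f` and `g` is `ℓ (f g)`, where `f` acts as the functional `a ↦ ℓ (f a)` and `g` as an element
of the bidual of the algebra with the given seminorm. -/
theorem exists_holderBd_mul (hP : WithSeminorms P)
    (hmul : ∀ (i : ι) (a b : A), P i (a * b) ≤ P i a * P i b) (hs : ∀ i, 1 ≤ s i) {α β : ℝ}
    (hpos : 0 < α + β) (i : ι) :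
    ∃ M, 0 ≤ M ∧ ∀ (R : ℝ) (ξ : HolderSpace s α P) (ζ : HolderSpace s β P)
      (f g : EuclideanSpace ℝ (Fin d) → A), IsGivenBy (HolderSpace.toDist ξ) f →
      IsGivenBy (HolderSpace.toDist ζ) g → ∀ ℓ : A →L[𝕂] 𝕂, (∀ a, ‖ℓ a‖ ≤ P i a) →
      HolderBd s (min α β) (testOrder (min α β)) (fun y => ℓ (f y * g y)) R
        (M * (ballSeminorm s α P (R + 4 * d) i ξ * ballSeminorm s β P (R + 4 * d) i ζ)) := by
  obtain ⟨M, hM, h⟩ := exists_holderBd_bilin_of_bound (s := s) hs hpos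
    (testOrder_add_pos (min α β)) (testOrder α) (testOrder β)
    (fun (e : SeminormDual (P i)) (e' : SeminormDual (P i) →L[𝕂] 𝕂) => e' e)
    (fun e₁ e₂ e' => map_add e' e₁ e₂)
    (fun c e e' => by
      rw [RCLike.real_smul_eq_coe_smul (K := 𝕂), map_smul, RCLike.real_smul_eq_coe_smul (K := 𝕂)])
    (fun _ _ _ => rfl) (fun _ _ _ => rfl)
    (fun e e' => by rw [mul_comm]; exact e'.le_opNorm e)
  refine ⟨M, hM, fun R ξ ζ f g hf hg ℓ hℓ => ?_⟩
  have hm : ∀ a, ∃ e : SeminormDual (P i), ‖e‖ ≤ P i a ∧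
      ∀ x, SeminormDual.eval (P i) x e = ℓ (a * x) := fun a =>
    SeminormDual.exists_of_bound (P i) (ℓ.toLinearMap ∘ₗ LinearMap.mulLeft 𝕂 a)
      (apply_nonneg _ _) fun x => (hℓ _).trans (hmul i a x)
  choose m hm₁ hm₂ using hm
  let T₁ : A →ₗ[𝕂] SeminormDual (P i) :=
    { toFun := m
      map_add' := fun a a' => SeminormDual.ext _ fun x => by
        rw [map_add, hm₂, hm₂, hm₂, add_mul, map_add]
      map_smul' := fun c a => SeminormDual.ext _ fun x => by
        rw [RingHom.id_apply, map_smul, hm₂, hm₂, smul_mul_assoc, map_smul] }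
  let T₂ : A →ₗ[𝕂] SeminormDual (P i) →L[𝕂] 𝕂 :=
    { toFun := fun a => (SeminormDual.eval (P i) a).mkContinuous (P i a)
        (SeminormDual.norm_eval_le (P i) a)
      map_add' := fun a a' => ContinuousLinearMap.ext fun e => SeminormDual.eval_add (P i) a a' e
      map_smul' := fun c a => ContinuousLinearMap.ext fun e => SeminormDual.eval_smul (P i) c a e }
  have hT₁ : ∀ a, ‖T₁ a‖ ≤ P i a := hm₁
  have hT₂ : ∀ a, ‖T₂ a‖ ≤ P i a := fun a =>
    LinearMap.mkContinuous_norm_le _ (apply_nonneg _ _) (SeminormDual.norm_eval_le (P i) a)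
  have c₁ := continuous_of_norm_le_seminorm hP i T₁ hT₁
  have c₂ := continuous_of_norm_le_seminorm hP i T₂ hT₂
  have hK : ∀ x : EuclideanSpace ℝ (Fin d), ‖x‖ ≤ R + 4 * d → x ∈ ballCompacts d (R + 4 * d) :=
    fun x hx => mem_ballCompacts.2 hx
  have b₁ := hf.holderBd hs ⟨T₁, c₁⟩ hT₁ (apply_nonneg _ _) hK (holderNorm_ball _ i ξ).le
  have b₂ := hg.holderBd hs ⟨T₂, c₂⟩ hT₂ (apply_nonneg _ _) hK (holderNorm_ball _ i ζ).le
  have := h _ (c₁.comp hf.1) _ (c₂.comp hg.1) R _ _ (apply_nonneg _ _) (apply_nonneg _ _)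
    b₁ b₂
  have he : ∀ y, T₂ (g y) (T₁ (f y)) = ℓ (f y * g y) := fun y => hm₂ (f y) (g y)
  rw [← funext he]
  exact this

end Estimate

end Product

end

/-! ### Young multiplication -/

section

section YoungMul

variable {d : ℕ} {𝕂 : Type*} [RCLike 𝕂] {s : Fin d → ℝ} {A : Type*} [NonUnitalRing A]
  [Module 𝕂 A] [IsScalarTower 𝕂 A A] [SMulCommClass 𝕂 A A] [UniformSpace A] [IsUniformAddGroup A]
  [ContinuousSMul 𝕂 A] [T2Space A] [CompleteSpace A] {ι : Type*} {P : SeminormFamily 𝕂 A ι}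
  {α β : ℝ}

/-- The product of the elements given by continuous functions, as a bilinear map with values in
all functionals on test functions. -/
theorem exists_weakMul (hP : WithSeminorms P)
    (hmul : ∀ (i : ι) (a b : A), P i (a * b) ≤ P i a * P i b) (s : Fin d → ℝ) (α β : ℝ) :
    ∃ W : continuousElements s α P →ₗ[𝕂] continuousElements s β P →ₗ[𝕂]
        (𝓓((⊤ : Opens (EuclideanSpace ℝ (Fin d))), 𝕂) → A),
      ∀ ξ ζ f g, IsGivenBy (HolderSpace.toDist ξ.1) f → IsGivenBy (HolderSpace.toDist ζ.1) g →
        ∀ φ (ℓ : A →L[𝕂] 𝕂), ℓ (W ξ ζ φ) = ∫ y, φ y * ℓ (f y * g y) := by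
  have := continuousMul_of_seminorms hP hmul
  choose f hf using fun ξ : continuousElements s α P => ξ.2
  choose g hg using fun ξ : continuousElements s β P => ξ.2
  have hf' : ∀ ξ h, IsGivenBy (HolderSpace.toDist ξ.1) h → f ξ = h := fun ξ h hh =>
    (hf ξ).unique hP hh
  have hg' : ∀ ζ h, IsGivenBy (HolderSpace.toDist ζ.1) h → g ζ = h := fun ξ h hh =>
    (hg ξ).unique hP hh
  have hw : ∀ ξ ζ (φ : 𝓓((⊤ : Opens (EuclideanSpace ℝ (Fin d))), 𝕂)), ∃ a : A,
      ∀ ℓ : A →L[𝕂] 𝕂, ℓ a = ∫ y, φ y * ℓ (f ξ y * g ζ y) := fun ξ ζ φ => by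
    obtain ⟨a, ha⟩ := exists_weak_integral hP (h := fun y => φ y • (f ξ y * g ζ y))
      (φ.continuous.smul ((hf ξ).1.mul (hg ζ).1)) φ.hasCompactSupport.smul_right
    exact ⟨a, fun ℓ => by simp only [ha, map_smul, smul_eq_mul]⟩
  choose w hw using hw
  have hi : ∀ ξ ζ (φ : 𝓓((⊤ : Opens (EuclideanSpace ℝ (Fin d))), 𝕂)) (ℓ : A →L[𝕂] 𝕂),
      Integrable fun y => φ y * ℓ (f ξ y * g ζ y) := fun ξ ζ φ ℓ =>
    integrable_test φ ℓ ((hf ξ).1.mul (hg ζ).1)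
  refine ⟨LinearMap.mk₂ 𝕂 w (fun ξ ξ' ζ => ?_) (fun c ξ ζ => ?_) (fun ξ ζ ζ' => ?_)
    (fun c ξ ζ => ?_), fun ξ ζ f' g' hf₁ hg₁ φ ℓ => ?_⟩
  · funext φ
    refine eq_of_dual hP fun ℓ => ?_
    rw [Pi.add_apply, map_add, hw, hw, hw, ← integral_add (hi _ _ _ _) (hi _ _ _ _),
      hf' (ξ + ξ') _ ((hf ξ).add (hf ξ'))]
    simp only [add_mul, map_add, mul_add]
  · funext φ
    refine eq_of_dual hP fun ℓ => ?_
    rw [Pi.smul_apply, map_smul, hw, hw, hf' (c • ξ) _ ((hf ξ).const_smul c), smul_eq_mul,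
      ← integral_const_mul]
    simp only [smul_mul_assoc, map_smul, smul_eq_mul, mul_left_comm]
  · funext φ
    refine eq_of_dual hP fun ℓ => ?_
    rw [Pi.add_apply, map_add, hw, hw, hw, ← integral_add (hi _ _ _ _) (hi _ _ _ _),
      hg' (ζ + ζ') _ ((hg ζ).add (hg ζ'))]
    simp only [map_add, mul_add]
  · funext φ
    refine eq_of_dual hP fun ℓ => ?_
    rw [Pi.smul_apply, map_smul, hw, hw, hg' (c • ζ) _ ((hg ζ).const_smul c), smul_eq_mul,
      ← integral_const_mul]
    simp only [mul_smul_comm, map_smul, smul_eq_mul, mul_left_comm]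
  · rw [← hf' ξ f' hf₁, ← hg' ζ g' hg₁]
    exact hw ξ ζ φ ℓ

/-- The product extended to the Hölder spaces by density, as a family of functionals on test
functions, with the bounds that the extension inherits from Young's estimate. -/
theorem exists_extended_mul (hP : WithSeminorms P)
    (hmul : ∀ (i : ι) (a b : A), P i (a * b) ≤ P i a * P i b) (hs : ∀ i, 1 ≤ s i)
    (hpos : 0 < α + β) :
    ∃ B : HolderSpace s α P →ₗ[𝕂] HolderSpace s β P →ₗ[𝕂]
        (𝓓((⊤ : Opens (EuclideanSpace ℝ (Fin d))), 𝕂) →ₗ[𝕂] A),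
      (∀ ξ ζ f g, IsGivenBy (HolderSpace.toDist ξ) f → IsGivenBy (HolderSpace.toDist ζ) g →
        ∀ φ (ℓ : A →L[𝕂] 𝕂), ℓ (B ξ ζ φ) = ∫ y, φ y * ℓ (f y * g y)) ∧
      (∀ i, ∃ M, 0 ≤ M ∧ ∀ R ξ ζ x, ‖x‖ ≤ R →
        (∀ η ∈ testBallVanishing 𝕂 s (testOrder (min α β)) (min α β), ∀ l : Ioc (0 : ℝ) 1,
          P i (B ξ ζ (rescale s l x η)) ≤ M * (ballSeminorm s α P (R + 4 * d) i ξ *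
            ballSeminorm s β P (R + 4 * d) i ζ) * (l : ℝ) ^ min α β) ∧
        ∀ η ∈ testBall 𝕂 s (testOrder (min α β)),
          P i (B ξ ζ (rescale s ⟨1, by norm_num⟩ x η)) ≤ M * (ballSeminorm s α P (R + 4 * d) i ξ *
            ballSeminorm s β P (R + 4 * d) i ζ)) ∧
      ∀ i ρ, ∃ R M, ∀ ξ ζ (φ : 𝓓((⊤ : Opens (EuclideanSpace ℝ (Fin d))), 𝕂)) (B' : ℝ),
        (∀ y, ρ < ‖y‖ → φ y = 0) →
        (∀ j ≤ testOrder (min α β), ∀ y, ‖iteratedFDeriv ℝ j φ y‖ ≤ B') →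
        P i (B ξ ζ φ) ≤ M * (ballSeminorm s α P R i ξ * ballSeminorm s β P R i ζ) * B' := by
  have := continuousMul_of_seminorms hP hmul
  obtain ⟨W, hW⟩ := exists_weakMul hP hmul s α β
  have hcE := fun ξ : continuousElements s α P => ξ.2
  have hcE' := fun ξ : continuousElements s β P => ξ.2
  -- the bounds for elements given by continuous functions
  have bd₁ : ∀ i, ∃ M, 0 ≤ M ∧ ∀ R ξ ζ x, ‖x‖ ≤ R →
        (∀ η ∈ testBallVanishing 𝕂 s (testOrder (min α β)) (min α β), ∀ l : Ioc (0 : ℝ) 1,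
          P i (W ξ ζ (rescale s l x η)) ≤ M * (ballSeminorm s α P (R + 4 * d) i ξ *
            ballSeminorm s β P (R + 4 * d) i ζ) * (l : ℝ) ^ min α β) ∧
        ∀ η ∈ testBall 𝕂 s (testOrder (min α β)),
          P i (W ξ ζ (rescale s ⟨1, by norm_num⟩ x η)) ≤ M * (ballSeminorm s α P (R + 4 * d) i ξ *
            ballSeminorm s β P (R + 4 * d) i ζ) := fun i => by
    obtain ⟨M, hM, h⟩ := exists_holderBd_mul hP hmul hs hpos i
    refine ⟨2 * M, by positivity, fun R ξ ζ x hx => ?_⟩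
    obtain ⟨f, hf⟩ := hcE ξ
    obtain ⟨g, hg⟩ := hcE' ζ
    have hh := h R ξ ζ f g hf hg
    refine ⟨fun η hη l => ?_, fun η hη => ?_⟩
    · exact (seminorm_le_of_holderBd hP i (hf.1.mul hg.1) hh hx hη l
        (hW ξ ζ f g hf hg _)).trans_eq (by ring)
    · exact (seminorm_le_of_holderBd_one hP i (hf.1.mul hg.1) hh hx hη
        (hW ξ ζ f g hf hg _)).trans_eq (by ring)
  have bd₂ : ∀ i ρ, ∃ R M, ∀ ξ ζ (φ : 𝓓((⊤ : Opens (EuclideanSpace ℝ (Fin d))), 𝕂)) (B' : ℝ),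
        (∀ y, ρ < ‖y‖ → φ y = 0) →
        (∀ j ≤ testOrder (min α β), ∀ y, ‖iteratedFDeriv ℝ j φ y‖ ≤ B') →
        P i (W ξ ζ φ) ≤ M * (ballSeminorm s α P R i ξ * ballSeminorm s β P R i ζ) * B' :=
      fun i ρ => by
    obtain ⟨M, hM, h⟩ := exists_holderBd_mul hP hmul hs hpos i
    obtain ⟨M', hM', h'⟩ := exists_seminorm_le_of_holderBd 𝕂 hs (testOrder (min α β)) ρ
    refine ⟨ρ + d + 4 * d, M' * M, fun ξ ζ φ B' hφ hB => ?_⟩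
    obtain ⟨f, hf⟩ := hcE ξ
    obtain ⟨g, hg⟩ := hcE' ζ
    exact (h' hP i _ (hf.1.mul hg.1) _ _ (h (ρ + d) ξ ζ f g hf hg) φ hφ B' hB _
      (hW ξ ζ f g hf hg φ)).trans_eq (by ring)
  have hWc : Continuous fun z : continuousElements s α P × continuousElements s β P =>
      W z.1 z.2 := by
    refine continuous_pi fun φ => ?_
    let w : continuousElements s α P →+ continuousElements s β P →+ A :=
      AddMonoidHom.mk' (fun ξ => AddMonoidHom.mk' (fun ζ => W ξ ζ φ) fun ζ ζ' => by simp)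
        fun ξ ξ' => by ext ζ; simp
    refine continuous_of_seminorm_le_mul hP w fun i => ?_
    obtain ⟨ρ, hρ⟩ := φ.hasCompactSupport.isCompact.isBounded.subset_closedBall 0
    obtain ⟨B', -, hB⟩ := exists_bound_iteratedFDeriv φ.contDiff φ.hasCompactSupport
      (testOrder (min α β))
    obtain ⟨R, M, h⟩ := bd₂ i ρ
    refine ⟨fun ξ => M * B' * ballSeminorm s α P R i ξ, fun ζ => ballSeminorm s β P R i ζ,
      ((continuous_ballSeminorm R i).comp continuous_subtype_val).const_mul _,
      (continuous_ballSeminorm R i).comp continuous_subtype_val, by simp, by simp, fun ξ ζ => ?_⟩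
    refine (h ξ ζ φ B' (fun y hy => ?_) hB).trans_eq (by ring)
    refine image_eq_zero_of_notMem_tsupport fun hy' => ?_
    have := hρ hy'
    rw [mem_closedBall_zero_iff] at this
    linarith
  obtain ⟨B, hBc, hBW⟩ := exists_bilin_extension dense_continuousElements
    dense_continuousElements W hWc
  have hBφ : ∀ φ, Continuous fun z : HolderSpace s α P × HolderSpace s β P => B z.1 z.2 φ :=
    fun φ => (continuous_apply φ).comp hBc
  -- every bound by a multiple of the Hölder seminorms passes to the extension
  have key : ∀ i R c φ, (∀ ξ ζ, P i (W ξ ζ φ) ≤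
      c * (ballSeminorm s α P R i ξ * ballSeminorm s β P R i ζ)) → ∀ ξ ζ, P i (B ξ ζ φ) ≤
      c * (ballSeminorm s α P R i ξ * ballSeminorm s β P R i ζ) := fun i R c φ h ξ ζ => by
    have c₁ : Continuous (ballSeminorm s α P R i) := continuous_ballSeminorm R i
    have c₂ : Continuous (ballSeminorm s β P R i) := continuous_ballSeminorm R i
    refine dense_bilin_induction (p := fun ξ ζ => P i (B ξ ζ φ) ≤
      c * (ballSeminorm s α P R i ξ * ballSeminorm s β P R i ζ)) dense_continuousElements
      dense_continuousElements (isClosed_le ((hP.continuous_seminorm i).comp (hBφ φ))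
        (by fun_prop)) (fun ξ ζ => ?_) ξ ζ
    rw [hBW]
    exact h ξ ζ
  have hadd : ∀ ξ ζ φ φ', B ξ ζ (φ + φ') = B ξ ζ φ + B ξ ζ φ' := fun ξ ζ φ φ' => by
    refine dense_bilin_induction (p := fun ξ ζ => B ξ ζ (φ + φ') = B ξ ζ φ + B ξ ζ φ')
      dense_continuousElements dense_continuousElements
      (isClosed_eq (hBφ _) ((hBφ _).add (hBφ _))) (fun ξ ζ => ?_) ξ ζ
    obtain ⟨f, hf⟩ := hcE ξ
    obtain ⟨g, hg⟩ := hcE' ζ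
    rw [hBW]
    refine eq_of_dual hP fun ℓ => ?_
    have hfg : Continuous fun y => f y * g y := hf.1.mul hg.1
    rw [map_add, hW ξ ζ f g hf hg, hW ξ ζ f g hf hg, hW ξ ζ f g hf hg,
      ← integral_add (integrable_test φ ℓ hfg) (integrable_test φ' ℓ hfg)]
    simp only [add_apply, add_mul]
  have hsmul : ∀ ξ ζ (c : 𝕂) φ, B ξ ζ (c • φ) = c • B ξ ζ φ := fun ξ ζ c φ => by
    refine dense_bilin_induction (p := fun ξ ζ => B ξ ζ (c • φ) = c • B ξ ζ φ)
      dense_continuousElements dense_continuousElements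
      (isClosed_eq (hBφ _) ((hBφ _).const_smul c)) (fun ξ ζ => ?_) ξ ζ
    obtain ⟨f, hf⟩ := hcE ξ
    obtain ⟨g, hg⟩ := hcE' ζ
    rw [hBW]
    refine eq_of_dual hP fun ℓ => ?_
    rw [map_smul, hW ξ ζ f g hf hg, hW ξ ζ f g hf hg, smul_eq_mul, ← integral_const_mul]
    simp only [smul_apply, smul_eq_mul, mul_assoc]
  let b : HolderSpace s α P → HolderSpace s β P →
      (𝓓((⊤ : Opens (EuclideanSpace ℝ (Fin d))), 𝕂) →ₗ[𝕂] A) := fun ξ ζ =>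
    { toFun := B ξ ζ
      map_add' := hadd ξ ζ
      map_smul' := hsmul ξ ζ }
  refine ⟨LinearMap.mk₂ 𝕂 b (fun ξ ξ' ζ => ?_) (fun c ξ ζ => ?_) (fun ξ ζ ζ' => ?_)
    (fun c ξ ζ => ?_), fun ξ ζ f g hf hg φ ℓ => ?_, fun i => ?_, fun i ρ => ?_⟩
  · ext φ
    exact congrFun (LinearMap.map_add₂ B ξ ξ' ζ) φ
  · ext φ
    exact congrFun (LinearMap.map_smul₂ B c ξ ζ) φ
  · ext φ
    exact congrFun (map_add (B ξ) ζ ζ') φ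
  · ext φ
    exact congrFun (map_smul (B ξ) c ζ) φ
  · change ℓ (B ξ ζ φ) = _
    have := hW ⟨ξ, f, hf⟩ ⟨ζ, g, hg⟩ f g hf hg φ ℓ
    rw [← hBW] at this
    exact this
  · obtain ⟨M, hM, h⟩ := bd₁ i
    refine ⟨M, hM, fun R ξ ζ x hx => ⟨fun η hη l => ?_, fun η hη => ?_⟩⟩
    · rw [mul_right_comm]
      refine key i (R + 4 * d) (M * (l : ℝ) ^ min α β) _ (fun ξ ζ => ?_) ξ ζ
      rw [mul_right_comm]
      exact (h R ξ ζ x hx).1 η hη l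
    · exact key i (R + 4 * d) M _ (fun ξ ζ => (h R ξ ζ x hx).2 η hη) ξ ζ
  · obtain ⟨R, M, h⟩ := bd₂ i ρ
    refine ⟨R, M, fun ξ ζ φ B' hφ hB => ?_⟩
    rw [mul_right_comm]
    refine key i R (M * B') φ (fun ξ ζ => ?_) ξ ζ
    rw [mul_right_comm]
    exact h ξ ζ φ B' hφ hB

/-- Young multiplication: the sufficiency of `α + β > 0`. -/
theorem exists_young_mul (hP : WithSeminorms P)
    (hmul : ∀ (i : ι) (a b : A), P i (a * b) ≤ P i a * P i b) (hs : ∀ i, 1 ≤ s i)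
    (hpos : 0 < α + β) :
    ∃ B : HolderSpace s α P →ₗ[𝕂] HolderSpace s β P →ₗ[𝕂] HolderSpace s (min α β) P,
      Continuous (fun z : HolderSpace s α P × HolderSpace s β P => B z.1 z.2) ∧
      ExtendsMul B := by
  have := continuousMul_of_seminorms hP hmul
  obtain ⟨B, hB, bd₁, bd₂⟩ := exists_extended_mul hP hmul hs hpos
  have hD : ∀ ξ ζ, ∃ θ : VDist d 𝕂 A, ∀ φ, θ φ = B ξ ζ φ := fun ξ ζ =>
    exists_vdist_of_bound hP (B ξ ζ) (testOrder (min α β)) fun i ρ => by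
      obtain ⟨R, M, h⟩ := bd₂ i ρ
      exact ⟨_, fun φ B' => h ξ ζ φ B'⟩
  choose D hD using hD
  have hbd : ∀ (K : Compacts (EuclideanSpace ℝ (Fin d))) i, ∃ R M, 0 ≤ M ∧ ∀ ξ ζ,
      holderNorm s (min α β) (P i) K (D ξ ζ) ≤ ENNReal.ofReal
        (2 * (M * (ballSeminorm s α P R i ξ * ballSeminorm s β P R i ζ))) := fun K i => by
    obtain ⟨R, hR⟩ := K.isCompact.isBounded.subset_closedBall 0
    obtain ⟨M, hM, h⟩ := bd₁ i
    have hx : ∀ x ∈ K, ‖x‖ ≤ R := fun x hx => mem_closedBall_zero_iff.1 (hR hx)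
    refine ⟨R + 4 * d, M, hM, fun ξ ζ => holderNorm_le (by positivity) (fun x hxK η hη l => ?_)
      fun x hxK η hη => ?_⟩
    · rw [hD]
      exact (h R ξ ζ x (hx x hxK)).1 η hη l
    · rw [hD]
      exact (h R ξ ζ x (hx x hxK)).2 η hη
  let D' : HolderSpace s α P → HolderSpace s β P → BoundedHolder s (min α β) P := fun ξ ζ =>
    ⟨D ξ ζ, fun K i => by
      obtain ⟨R, M, -, h⟩ := hbd K i
      exact (h ξ ζ).trans_lt ENNReal.ofReal_lt_top⟩
  have hD' : ∀ ξ ζ, BoundedHolder.toDist s (min α β) P (D' ξ ζ) = D ξ ζ := fun _ _ => rfl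
  let L : HolderSpace s α P →ₗ[𝕂] HolderSpace s β P →ₗ[𝕂] BoundedHolder s (min α β) P :=
    LinearMap.mk₂ 𝕂 D'
      (fun ξ ξ' ζ => Subtype.ext <| ContinuousLinearMap.ext fun φ => by
        change D (ξ + ξ') ζ φ = D ξ ζ φ + D ξ' ζ φ
        simp only [hD, map_add, LinearMap.add_apply])
      (fun c ξ ζ => Subtype.ext <| ContinuousLinearMap.ext fun φ => by
        change D (c • ξ) ζ φ = c • D ξ ζ φ
        simp only [hD, map_smul, LinearMap.smul_apply])
      (fun ξ ζ ζ' => Subtype.ext <| ContinuousLinearMap.ext fun φ => by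
        change D ξ (ζ + ζ') φ = D ξ ζ φ + D ξ ζ' φ
        simp only [hD, map_add, LinearMap.add_apply])
      (fun c ξ ζ => Subtype.ext <| ContinuousLinearMap.ext fun φ => by
        change D ξ (c • ζ) φ = c • D ξ ζ φ
        simp only [hD, map_smul, LinearMap.smul_apply])
  have hLc : Continuous fun z : HolderSpace s α P × HolderSpace s β P => L z.1 z.2 := by
    let w : HolderSpace s α P →+ HolderSpace s β P →+ BoundedHolder s (min α β) P :=
      AddMonoidHom.mk' (fun ξ => (L ξ).toAddMonoidHom) fun ξ ξ' => by ext ζ; simp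
    refine continuous_of_seminorm_le_mul (withSeminorms_holder s (min α β) P) w fun Ki => ?_
    obtain ⟨R, M, hM, h⟩ := hbd Ki.1 Ki.2
    refine ⟨fun ξ => 2 * M * ballSeminorm s α P R Ki.2 ξ, fun ζ => ballSeminorm s β P R Ki.2 ζ,
      (continuous_ballSeminorm R _).const_mul _, continuous_ballSeminorm R _, by simp, by simp,
      fun ξ ζ => ?_⟩
    have h1 := ENNReal.toReal_mono ENNReal.ofReal_ne_top (h ξ ζ)
    rw [ENNReal.toReal_ofReal (by positivity)] at h1
    exact h1.trans_eq (by ring)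
  have hgiven : ∀ ξ ζ f g, IsGivenBy (HolderSpace.toDist ξ) f →
      IsGivenBy (HolderSpace.toDist ζ) g → IsGivenBy (D ξ ζ) fun x => f x * g x :=
    fun ξ ζ f g hf hg => ⟨hf.1.mul hg.1, fun φ ℓ => by rw [hD, hB ξ ζ f g hf hg]⟩
  -- products of test functions are test functions, so the product maps into the closure
  have hmem : ∀ ξ ζ, L ξ ζ ∈ HolderSpace s (min α β) P := fun ξ ζ => by
    refine map_mem_closure₂ (f := fun ξ ζ => L ξ ζ) (s := testElements s α P)
      (t := testElements s β P) (u := testSubmodule s (min α β) P) hLc (dense_testElements ξ)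
      (dense_testElements ζ) fun ξ hξ ζ hζ => ?_
    obtain ⟨f, hf, hf'⟩ := hξ
    obtain ⟨g, hg, hg'⟩ := hζ
    exact ⟨_, hf.mul hg, hgiven ξ ζ f g hf' hg'⟩
  refine ⟨LinearMap.mk₂ 𝕂 (fun ξ ζ => ⟨L ξ ζ, hmem ξ ζ⟩) (fun ξ ξ' ζ => ?_) (fun c ξ ζ => ?_)
    (fun ξ ζ ζ' => ?_) (fun c ξ ζ => ?_), hLc.subtype_mk _, fun ξ ζ f g hf hg =>
    hgiven ξ ζ f g hf hg⟩
  · exact Subtype.ext (LinearMap.map_add₂ L ξ ξ' ζ)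
  · exact Subtype.ext (LinearMap.map_smul₂ L c ξ ζ)
  · exact Subtype.ext (map_add (L ξ) ζ ζ')
  · exact Subtype.ext (map_smul (L ξ) c ζ)

end YoungMul

end

/-! ### Lacunary series of localised plane waves -/

section

section Waves

variable {d : ℕ} {s : Fin d → ℝ}

/-- The plane wave `x ↦ cos (w x_i + θ)`. -/
def planeWave (i : Fin d) (w θ : ℝ) (x : EuclideanSpace ℝ (Fin d)) : ℝ := Real.cos (w * x i + θ)

theorem contDiff_planeWave (i : Fin d) (w θ : ℝ) : ContDiff ℝ ∞ (planeWave i w θ) := by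
  unfold planeWave; fun_prop

theorem abs_planeWave_le (i : Fin d) (w θ : ℝ) (x : EuclideanSpace ℝ (Fin d)) :
    |planeWave i w θ x| ≤ 1 := Real.abs_cos_le_one _

theorem dirDeriv_planeWave (i : Fin d) (w θ : ℝ) (x : EuclideanSpace ℝ (Fin d)) :
    fderiv ℝ (planeWave i w (θ - Real.pi / 2)) x (EuclideanSpace.single i 1) =
      w * planeWave i w θ x := by
  have h1 : HasFDerivAt (fun x : EuclideanSpace ℝ (Fin d) => w * x i + (θ - Real.pi / 2))
      (w • (EuclideanSpace.proj i : EuclideanSpace ℝ (Fin d) →L[ℝ] ℝ)) x :=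
    ((EuclideanSpace.proj i : EuclideanSpace ℝ (Fin d) →L[ℝ] ℝ).hasFDerivAt.const_mul w).add_const _
  have h2 := h1.cos
  rw [show planeWave i w (θ - Real.pi / 2) = fun x => Real.cos (w * x i + (θ - Real.pi / 2)) from
    rfl, h2.fderiv]
  have h3 : Real.sin (w * x i + (θ - Real.pi / 2)) = -Real.cos (w * x i + θ) := by
    rw [← add_sub_assoc, Real.sin_sub_pi_div_two]
  simp [h3, planeWave, mul_comm]

/-- Every derivative of a plane wave of unit frequency is bounded by one. -/
theorem norm_iteratedFDeriv_planeWave_le (i : Fin d) (θ : ℝ) (j : ℕ)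
    (x : EuclideanSpace ℝ (Fin d)) : ‖iteratedFDeriv ℝ j (planeWave i 1 θ) x‖ ≤ 1 := by
  have h1 : planeWave i 1 θ = (fun x : EuclideanSpace ℝ (Fin d) => (Real.cos ∘
      (EuclideanSpace.proj i : EuclideanSpace ℝ (Fin d) →L[ℝ] ℝ)) (x + EuclideanSpace.single i θ)) := by
    funext x; simp [planeWave]
  rw [h1, iteratedFDeriv_comp_add_right]
  rw [(EuclideanSpace.proj i : EuclideanSpace ℝ (Fin d) →L[ℝ] ℝ).iteratedFDeriv_comp_right
    (Real.contDiff_cos (n := ∞)) _ (i := j) (by exact_mod_cast le_top)]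
  refine (ContinuousMultilinearMap.norm_compContinuousLinearMap_le _ _).trans ?_
  have hp : ‖(EuclideanSpace.proj i : EuclideanSpace ℝ (Fin d) →L[ℝ] ℝ)‖ ≤ 1 :=
    ContinuousLinearMap.opNorm_le_bound _ zero_le_one fun y => by
      simpa using PiLp.norm_apply_le y i
  refine mul_le_one₀ ?_ (Finset.prod_nonneg fun _ _ => norm_nonneg _)
    (Finset.prod_le_one (fun _ _ => norm_nonneg _) fun _ _ => hp)
  rw [norm_iteratedFDeriv_eq_norm_iteratedDeriv, Real.norm_eq_abs]
  exact Real.abs_iteratedDeriv_cos_le_one j _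

/-- Integration by parts: pairing a bump with a plane wave of frequency `w` gains a factor `w⁻¹`
for each derivative of the bump. -/
theorem abs_integral_mul_planeWave_le (hs : ∀ i, 1 ≤ s i) (i : Fin d) {w : ℝ} (hw : 0 < w)
    (r : ℕ) : ∀ {ψ : EuclideanSpace ℝ (Fin d) → ℝ}, IsBump s ψ → ∀ {B : ℝ},
      (∀ y, ‖iteratedFDeriv ℝ r ψ y‖ ≤ B) → ∀ θ, |∫ y, ψ y * planeWave i w θ y| ≤
        w⁻¹ ^ r * (B * volume.real (Metric.closedBall (0 : EuclideanSpace ℝ (Fin d)) d)) := by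
  induction r with
  | zero =>
    intro ψ hψ B hB θ
    have := norm_integral_smul_le (χ := ψ) (H := planeWave i w θ) (A := B) (B := 1)
      (fun _ hy => hψ.eq_zero hs hy) (fun y => by simpa using hB y)
      fun y _ => abs_planeWave_le i w θ y
    simpa using this
  | succ r ih =>
    intro ψ hψ B hB θ
    have h1 := integral_dirDeriv_mul hψ.smooth (hψ.hasCompactSupport hs)
      (contDiff_planeWave i w (θ - Real.pi / 2)) (EuclideanSpace.single i 1)
    have h2 : ∫ y, ψ y * planeWave i w θ y = -(w⁻¹ * ∫ y, dirDeriv (EuclideanSpace.single i 1) ψ y *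
        planeWave i w (θ - Real.pi / 2) y) := by
      rw [h1]
      simp only [dirDeriv_planeWave, mul_left_comm _ w]
      rw [integral_const_mul]
      field_simp
    rw [h2, abs_neg, abs_mul, abs_of_pos (inv_pos.2 hw), pow_succ', mul_assoc]
    gcongr
    refine ih (hψ.dirDeriv _) (fun y => ?_) _
    refine (norm_iteratedFDeriv_dirDeriv_le hψ.smooth _ y r).trans ?_
    simpa using hB y

/-- The plane wave that oscillates at scale `c` in the `i`-th direction, localised by `χ`. -/
def wavePacket (s : Fin d → ℝ) (i : Fin d) (χ : EuclideanSpace ℝ (Fin d) → ℝ) (c θ : ℝ)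
    (x : EuclideanSpace ℝ (Fin d)) : ℝ := χ x * planeWave i (c ^ (-s i)) θ x

theorem contDiff_wavePacket {χ : EuclideanSpace ℝ (Fin d) → ℝ} (hχ : ContDiff ℝ ∞ χ) (i : Fin d)
    (c θ : ℝ) : ContDiff ℝ ∞ (wavePacket s i χ c θ) := hχ.mul (contDiff_planeWave _ _ _)

theorem planeWave_add_dil (i : Fin d) {c l : ℝ} (hc : 0 < c) (hl : 0 < l) (θ : ℝ)
    (x z : EuclideanSpace ℝ (Fin d)) :
    planeWave i (c ^ (-s i)) θ (x + dil s l z) =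
      planeWave i ((l / c) ^ s i) (c ^ (-s i) * x i + θ) z := by
  simp only [planeWave, PiLp.add_apply, dil_apply]
  congr 1
  rw [Real.div_rpow hl.le hc.le, Real.rpow_neg hc.le]
  ring

theorem norm_iteratedFDeriv_comp_add_dil_le (hs : ∀ i, 1 ≤ s i) {χ : EuclideanSpace ℝ (Fin d) → ℝ}
    (hχ : ContDiff ℝ ∞ χ) {n : ℕ} {B : ℝ} (hB : ∀ j ≤ n, ∀ y, ‖iteratedFDeriv ℝ j χ y‖ ≤ B)
    {c : ℝ} (h0 : 0 < c) (h1 : c ≤ 1) (x z : EuclideanSpace ℝ (Fin d)) {j : ℕ} (hj : j ≤ n) :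
    ‖iteratedFDeriv ℝ j (fun z => χ (x + dil s c z)) z‖ ≤ B := by
  refine (norm_iteratedFDeriv_comp_dil_le hs (g := fun y => χ (x + y))
    (hχ.comp (contDiff_const.add contDiff_id)) h0 h1 j z).trans ?_
  rw [iteratedFDeriv_comp_add_left]
  exact (mul_le_of_le_one_left (norm_nonneg _) (pow_le_one₀ h0.le h1)).trans (hB j hj _)

theorem scaledBd_wavePacket (hs : ∀ i, 1 ≤ s i) (i : Fin d) {χ : EuclideanSpace ℝ (Fin d) → ℝ}
    (hχ : ContDiff ℝ ∞ χ) {n : ℕ} {B : ℝ} (hB : ∀ j ≤ n, ∀ y, ‖iteratedFDeriv ℝ j χ y‖ ≤ B)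
    {c : ℝ} (h0 : 0 < c) (h1 : c ≤ 1) (θ R : ℝ) :
    ScaledBd s (wavePacket s i χ c θ) c R n (2 ^ n * B) := by
  intro x _ j hj
  simp only [wavePacket, planeWave_add_dil i h0 h0, div_self h0.ne', Real.one_rpow]
  refine (norm_iteratedFDeriv_mul_le_two_pow (contDiff_comp_add_dil hχ x c)
    (contDiff_planeWave _ _ _) 0 (b := 1) (fun j hj =>
      norm_iteratedFDeriv_comp_add_dil_le hs hχ hB h0 h1 x 0 hj)
    (fun j _ => norm_iteratedFDeriv_planeWave_le i _ j 0) hj).trans_eq (by rw [mul_one])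

/-- Averaging a wave packet at a scale `l` coarser than that of its oscillation. -/
theorem norm_avg_wavePacket_le (hs : ∀ i, 1 ≤ s i) (i : Fin d) {χ : EuclideanSpace ℝ (Fin d) → ℝ}
    (hχ : ContDiff ℝ ∞ χ) {r : ℕ} {B : ℝ} (hB : ∀ j ≤ r, ∀ y, ‖iteratedFDeriv ℝ j χ y‖ ≤ B)
    {c l : ℝ} (h0 : 0 < c) (hcl : c ≤ l) (hl : l ≤ 1) (θ : ℝ) {η : EuclideanSpace ℝ (Fin d) → ℝ}
    (hη : IsBump s η) (hη1 : ∀ j ≤ r, ∀ y, ‖iteratedFDeriv ℝ j η y‖ ≤ 1)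
    (x : EuclideanSpace ℝ (Fin d)) :
    ‖avg s η l (wavePacket s i χ c θ) x‖ ≤ (c / l) ^ r *
      (2 ^ r * B * volume.real (Metric.closedBall (0 : EuclideanSpace ℝ (Fin d)) d)) := by
  have hl0 : 0 < l := h0.trans_le hcl
  have hB0 : 0 ≤ B := (norm_nonneg _).trans (hB 0 (Nat.zero_le _) 0)
  have hψ : IsBump s fun z => η z * χ (x + dil s l z) :=
    ⟨hη.smooth.mul (contDiff_comp_add_dil hχ x l), tsupport_mul_subset_left.trans hη.supp⟩
  have hw : l / c ≤ (l / c) ^ s i := by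
    have h1 : 1 ≤ l / c := (one_le_div h0).2 hcl
    simpa using Real.rpow_le_rpow_of_exponent_le h1 (hs i)
  have hlc : 0 < l / c := div_pos hl0 h0
  have h := abs_integral_mul_planeWave_le hs i (hlc.trans_le hw) r hψ (B := 2 ^ r * (1 * B))
    (fun y => norm_iteratedFDeriv_mul_le_two_pow hη.smooth (contDiff_comp_add_dil hχ x l) y
      (fun j hj => hη1 j hj y)
      (fun j hj => norm_iteratedFDeriv_comp_add_dil_le hs hχ hB hl0 hl x y hj) le_rfl)
    (c ^ (-s i) * x i + θ)
  have h2 : avg s η l (wavePacket s i χ c θ) x = ∫ y, η y * χ (x + dil s l y) *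
      planeWave i ((l / c) ^ s i) (c ^ (-s i) * x i + θ) y := by
    simp only [avg, wavePacket, planeWave_add_dil i h0 hl0, smul_eq_mul, mul_assoc]
  rw [h2, Real.norm_eq_abs]
  refine h.trans ?_
  rw [one_mul]
  have h3 : ((l / c) ^ s i)⁻¹ ≤ c / l := by
    rw [← inv_div l c]
    exact inv_anti₀ hlc hw
  gcongr

theorem avg_sum_smul (hs : ∀ i, 1 ≤ s i) {η : EuclideanSpace ℝ (Fin d) → ℝ} (hη : IsBump s η)
    (l : ℝ) (T : Finset ℕ) (a : ℕ → ℝ) {f : ℕ → EuclideanSpace ℝ (Fin d) → ℝ}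
    (hf : ∀ n, Continuous (f n)) (x : EuclideanSpace ℝ (Fin d)) :
    avg s η l (fun y => ∑ n ∈ T, a n * f n y) x = ∑ n ∈ T, a n * avg s η l (f n) x := by
  have hi : ∀ n ∈ T, Integrable fun z => a n * (η z * f n (x + dil s l z)) := fun n _ =>
    ((hη.smooth.continuous.mul ((hf n).comp (by fun_prop))).integrable_of_hasCompactSupport
      (hη.hasCompactSupport hs).mul_right).const_mul _
  simp only [avg, smul_eq_mul, Finset.mul_sum, mul_left_comm _ (a _)]
  rw [integral_finsetSum _ hi]
  simp only [integral_const_mul]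

/-- The partial sum `∑ ε_n 2^(-nα) cos (2^(n 𝔰_i) x_i + θ_n) χ(x)` of a lacunary series. -/
def waveSeries (s : Fin d → ℝ) (i : Fin d) (χ : EuclideanSpace ℝ (Fin d) → ℝ) (α : ℝ)
    (ε θ : ℕ → ℝ) (N : ℕ) (x : EuclideanSpace ℝ (Fin d)) : ℝ :=
  ∑ n ∈ Finset.range N, ε n * dy n ^ α * wavePacket s i χ (dy n) (θ n) x

theorem contDiff_waveSeries {χ : EuclideanSpace ℝ (Fin d) → ℝ} (hχ : ContDiff ℝ ∞ χ) (i : Fin d)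
    (α : ℝ) (ε θ : ℕ → ℝ) (N : ℕ) : ContDiff ℝ ∞ (waveSeries s i χ α ε θ N) :=
  ContDiff.sum fun _ _ => contDiff_const.mul (contDiff_wavePacket hχ i _ _)

theorem hasCompactSupport_waveSeries {χ : EuclideanSpace ℝ (Fin d) → ℝ} (hχ : HasCompactSupport χ)
    (i : Fin d) (α : ℝ) (ε θ : ℕ → ℝ) (N : ℕ) :
    HasCompactSupport (waveSeries s i χ α ε θ N) :=
  hχ.mono' fun x hx => by
    by_contra h
    exact hx (by simp [waveSeries, wavePacket, image_eq_zero_of_notMem_tsupport h])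

/-- The partial sums of the lacunary series are bounded in the Hölder space of exponent `α`,
whatever the signs and the phases. -/
theorem exists_holderBd_waveSeries (hs : ∀ i, 1 ≤ s i) (i : Fin d)
    {χ : EuclideanSpace ℝ (Fin d) → ℝ} (hχ : ContDiff ℝ ∞ χ) (hχc : HasCompactSupport χ) (α : ℝ) :
    ∃ C, 0 ≤ C ∧ ∀ ε θ : ℕ → ℝ, (∀ n, |ε n| ≤ 1) → ∀ N R,
      HolderBd s α (testOrder α) (waveSeries s i χ α ε θ N) R C := by
  set r := testOrder α
  have hr : 0 < (r : ℝ) + α := testOrder_add_pos α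
  obtain ⟨n, e, A, he, hA, hgain⟩ := exists_avg_gain (G := ℝ) hs α
  obtain ⟨B, hB0, hB⟩ := exists_bound_iteratedFDeriv hχ hχc n
  obtain ⟨B', hB'0, hB'⟩ := exists_bound_iteratedFDeriv hχ hχc r
  obtain ⟨A₁, hA₁, hfine⟩ := sum_dy_rpow_fine hr
  obtain ⟨A₂, hA₂, hcoarse⟩ := sum_dy_rpow_coarse (sub_neg.2 he)
  set V := 2 ^ r * B' * volume.real (Metric.closedBall (0 : EuclideanSpace ℝ (Fin d)) d)
  have hV : 0 ≤ V := by positivity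
  have hsplit : ∀ (ε θ : ℕ → ℝ) (T : Finset ℕ) (η : EuclideanSpace ℝ (Fin d) → ℝ) l x,
      (∀ n, |ε n| ≤ 1) →
      |∑ n ∈ T, ε n * dy n ^ α * avg s η l (wavePacket s i χ (dy n) (θ n)) x| ≤
        ∑ n ∈ T, dy n ^ α * ‖avg s η l (wavePacket s i χ (dy n) (θ n)) x‖ :=
      fun ε θ T η l x hε => by
    refine (Finset.abs_sum_le_sum_abs _ _).trans (Finset.sum_le_sum fun k _ => ?_)
    rw [abs_mul, abs_mul, abs_of_nonneg (Real.rpow_nonneg (dy_pos k).le α), Real.norm_eq_abs]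
    refine mul_le_mul_of_nonneg_right ?_ (abs_nonneg _)
    exact mul_le_of_le_one_left (Real.rpow_nonneg (dy_pos k).le α) (hε k)
  -- wave packets finer than the test function, by integration by parts
  have hF : ∀ (θ : ℕ → ℝ) (T : Finset ℕ) l, 0 < l → l ≤ 1 → (∀ k ∈ T, dy k ≤ l) →
      ∀ η : EuclideanSpace ℝ (Fin d) → ℝ, IsBump s η →
      (∀ j ≤ r, ∀ y, ‖iteratedFDeriv ℝ j η y‖ ≤ 1) → ∀ x,
      ∑ k ∈ T, dy k ^ α * ‖avg s η l (wavePacket s i χ (dy k) (θ k)) x‖ ≤ V * A₁ * l ^ α :=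
      fun θ T l hl hl1 hT η hη hη1 x => by
    have hlr : 0 < l ^ r := pow_pos hl r
    calc _ ≤ ∑ k ∈ T, V * (l ^ r)⁻¹ * dy k ^ ((r : ℝ) + α) := by
          refine Finset.sum_le_sum fun k hk => ?_
          have h := norm_avg_wavePacket_le hs i hχ hB' (dy_pos k) (hT k hk) hl1 (θ k) hη hη1 x
          refine (mul_le_mul_of_nonneg_left h (Real.rpow_nonneg (dy_pos k).le α)).trans_eq ?_
          rw [Real.rpow_add (dy_pos k), Real.rpow_natCast, div_pow]
          ring
      _ ≤ V * (l ^ r)⁻¹ * (A₁ * l ^ ((r : ℝ) + α)) := by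
          rw [← Finset.mul_sum]
          gcongr
          exact hfine T l hl hT
      _ = _ := by
          rw [Real.rpow_add hl, Real.rpow_natCast]
          field_simp
  refine ⟨V * A₁ + A * (2 ^ n * B) * A₂, by positivity, fun ε θ hε N R =>
    ⟨fun x hx η hη hη1 hv l hl hl1 => ?_, fun x hx η hη hη1 => ?_⟩⟩
  all_goals
    unfold waveSeries
    rw [avg_sum_smul hs hη _ _ (fun n => ε n * dy n ^ α) (fun k =>
      (contDiff_wavePacket hχ i _ (θ k)).continuous), Real.norm_eq_abs]
    refine (hsplit ε θ _ η _ x hε).trans ?_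
  -- wave packets coarser than the test function, by its vanishing moments
  · have hC : ∑ k ∈ (Finset.range N).filter (fun k => ¬ dy k ≤ l),
        dy k ^ α * ‖avg s η l (wavePacket s i χ (dy k) (θ k)) x‖ ≤
        A * (2 ^ n * B) * A₂ * l ^ α := by
      have hle : ∀ k ∈ (Finset.range N).filter (fun k => ¬ dy k ≤ l), l ≤ dy k := fun k hk =>
        (not_le.1 (Finset.mem_filter.1 hk).2).le
      calc _ ≤ ∑ k ∈ (Finset.range N).filter (fun k => ¬ dy k ≤ l),
            A * (2 ^ n * B) * l ^ e * dy k ^ (α - e) := by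
            refine Finset.sum_le_sum fun k hk => ?_
            have h := hgain η hη (fun y => by simpa using hη1 0 (Nat.zero_le _) y) hv _
              (contDiff_wavePacket hχ i _ _) _ (dy k) l R hl (hle k hk) (dy_le_one k)
              (scaledBd_wavePacket hs i hχ hB (dy_pos k) (dy_le_one k) (θ k) _) x hx
            refine (mul_le_mul_of_nonneg_left h (Real.rpow_nonneg (dy_pos k).le α)).trans_eq ?_
            rw [Real.rpow_sub (dy_pos k), Real.div_rpow hl.le (dy_pos k).le]
            ring
        _ ≤ A * (2 ^ n * B) * l ^ e * (A₂ * l ^ (α - e)) := by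
            rw [← Finset.mul_sum]
            have := Real.rpow_nonneg hl.le e
            gcongr
            exact hcoarse _ l hl hle
        _ = _ := by
            have := (Real.rpow_pos_of_pos hl e).ne'
            rw [Real.rpow_sub hl]
            field_simp
    rw [← Finset.sum_filter_add_sum_filter_not _ (fun k => dy k ≤ l), add_mul]
    exact add_le_add (hF θ _ l hl hl1 (fun k hk => (Finset.mem_filter.1 hk).2) η hη hη1 x) hC
  · have h := hF θ (Finset.range N) 1 one_pos le_rfl (fun k _ => dy_le_one k) η hη hη1 x
    rw [Real.one_rpow, mul_one] at h
    exact h.trans (le_add_of_nonneg_right (by positivity))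

end Waves

/-! ### Resonant signs and phases -/

section Resonance

/-- Signs can be chosen so that the off-diagonal part of a quadratic form is nonnegative. -/
theorem exists_signs_sum_diag_le (t : ℕ → ℕ → ℝ) (N : ℕ) : ∃ ε : ℕ → ℝ, (∀ n, |ε n| ≤ 1) ∧
    ∑ n ∈ Finset.range N, t n n ≤
      ∑ n ∈ Finset.range N, ∑ m ∈ Finset.range N, ε n * ε m * t n m := by
  induction N with
  | zero => exact ⟨fun _ => 0, by simp, by simp⟩
  | succ N ih =>
    obtain ⟨ε, hε, h⟩ := ih
    -- the last sign only has to agree with the sign of the terms in which it occurs once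
    set S := ∑ n ∈ Finset.range N, ε n * (t n N + t N n)
    obtain ⟨σ, hσ, hσS⟩ : ∃ σ : ℝ, σ ^ 2 = 1 ∧ 0 ≤ σ * S := by
      rcases le_total 0 S with hS | hS
      · exact ⟨1, by norm_num, by simpa⟩
      · exact ⟨-1, by norm_num, by simpa⟩
    have hne : ∀ n ∈ Finset.range N, Function.update ε N σ n = ε n := fun n hn =>
      Function.update_of_ne (Finset.mem_range.1 hn).ne _ _
    refine ⟨Function.update ε N σ, fun n => ?_, ?_⟩
    · rcases eq_or_ne n N with rfl | hn
      · rw [Function.update_self]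
        exact ((sq_le_one_iff_abs_le_one σ).1 hσ.le)
      · rw [Function.update_of_ne hn]
        exact hε n
    · have h1 : ∑ n ∈ Finset.range (N + 1), ∑ m ∈ Finset.range (N + 1),
          Function.update ε N σ n * Function.update ε N σ m * t n m =
          (∑ n ∈ Finset.range N, ∑ m ∈ Finset.range N, ε n * ε m * t n m) + σ * S + t N N := by
        have h2 : ∀ n ∈ Finset.range N, ∑ m ∈ Finset.range (N + 1),
            Function.update ε N σ n * Function.update ε N σ m * t n m =
            (∑ m ∈ Finset.range N, ε n * ε m * t n m) + σ * (ε n * t n N) := fun n hn => by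
          rw [Finset.sum_range_succ, Function.update_self, hne n hn,
            Finset.sum_congr rfl fun m hm => by rw [hne m hm]]
          ring
        have h3 : ∀ m ∈ Finset.range N, Function.update ε N σ N * Function.update ε N σ m * t N m =
            σ * (ε m * t N m) := fun m hm => by
          rw [hne m hm, Function.update_self]
          ring
        have h4 : σ * S = ∑ n ∈ Finset.range N, σ * (ε n * t n N) +
            ∑ n ∈ Finset.range N, σ * (ε n * t N n) := by
          simp only [S, Finset.mul_sum, ← Finset.sum_add_distrib, mul_add]
        rw [Finset.sum_range_succ, Finset.sum_congr rfl h2, Finset.sum_range_succ _ N,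
          Finset.sum_congr rfl h3, Finset.sum_add_distrib, h4, Function.update_self, ← sq, hσ]
        ring
      rw [h1, Finset.sum_range_succ]
      linarith

variable {d : ℕ} {s : Fin d → ℝ}

/-- One of the phases `0` and `-π/2` makes the mean square of the wave at least one half. -/
theorem exists_phase (i : Fin d) (w : ℝ) {η : EuclideanSpace ℝ (Fin d) → ℝ} (hη : Continuous η)
    (hc : HasCompactSupport η) : ∃ θ, (∫ y, η y) / 2 ≤ ∫ y, η y * planeWave i w θ y ^ 2 := by
  have hi : ∀ θ, Integrable fun y => η y * planeWave i w θ y ^ 2 := fun θ =>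
    (hη.mul ((contDiff_planeWave i w θ).continuous.pow 2)).integrable_of_hasCompactSupport
      hc.mul_right
  have h : ∫ y, η y = (∫ y, η y * planeWave i w 0 y ^ 2) +
      ∫ y, η y * planeWave i w (-(Real.pi / 2)) y ^ 2 := by
    rw [← integral_add (hi _) (hi _)]
    congr 1
    funext y
    rw [← mul_add, planeWave, planeWave, add_zero, ← sub_eq_add_neg, Real.cos_sub_pi_div_two,
      Real.cos_sq_add_sin_sq, mul_one]
  by_contra! hcon
  linarith [hcon 0, hcon (-(Real.pi / 2))]

/-- If `α + β ≤ 0`, the signs and phases of two lacunary series with exponents `α` and `β` can be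
chosen so that the mean of the product of the `N`-th partial sums grows linearly in `N`. -/
theorem exists_waveSeries_resonance (i : Fin d) {χ η : EuclideanSpace ℝ (Fin d) → ℝ}
    (hχ : ContDiff ℝ ∞ χ) (hη : Continuous η) (hc : HasCompactSupport η)
    (hpos : ∀ y, 0 ≤ η y) (hχη : ∀ y, η y ≠ 0 → χ y = 1) {α β : ℝ} (hab : α + β ≤ 0) :
    ∃ θ : ℕ → ℝ, ∀ N : ℕ, ∃ ε : ℕ → ℝ, (∀ n, |ε n| ≤ 1) ∧ N * ((∫ y, η y) / 2) ≤
      ∫ y, η y * (waveSeries s i χ α ε θ N y * waveSeries s i χ β ε θ N y) := by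
  choose θ hθ using fun n => exists_phase i (dy n ^ (-s i)) hη hc
  refine ⟨θ, fun N => ?_⟩
  set u : ℕ → EuclideanSpace ℝ (Fin d) → ℝ := fun n => wavePacket s i χ (dy n) (θ n)
  have hu : ∀ n, Continuous (u n) := fun n => (contDiff_wavePacket hχ i _ _).continuous
  have hi : ∀ n m, Integrable fun y => η y * (u n y * u m y) := fun n m =>
    (hη.mul ((hu n).mul (hu m))).integrable_of_hasCompactSupport hc.mul_right
  obtain ⟨ε, hε, h⟩ := exists_signs_sum_diag_le
    (fun n m => dy n ^ α * dy m ^ β * ∫ y, η y * (u n y * u m y)) N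
  refine ⟨ε, hε, le_trans ?_ (h.trans_eq ?_)⟩
  · have h0 : (N : ℝ) * ((∫ y, η y) / 2) = ∑ _n ∈ Finset.range N, (∫ y, η y) / 2 := by simp
    rw [h0]
    refine Finset.sum_le_sum fun n _ => ?_
    rw [← Real.rpow_add (dy_pos n)]
    have h1 : ∫ y, η y * (u n y * u n y) = ∫ y, η y * planeWave i (dy n ^ (-s i)) (θ n) y ^ 2 := by
      congr 1
      funext y
      by_cases hy : η y = 0
      · simp [hy]
      · simp only [u, wavePacket, hχη y hy]
        ring
    have h2 : 0 ≤ (∫ y, η y) / 2 := by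
      have : 0 ≤ ∫ y, η y := integral_nonneg fun y => hpos y
      positivity
    rw [h1]
    have h3 : 1 ≤ dy n ^ (α + β) :=
      Real.one_le_rpow_of_pos_of_le_one_of_nonpos (dy_pos n) (dy_le_one n) hab
    exact (hθ n).trans (le_mul_of_one_le_left (h2.trans (hθ n)) h3)
  · have h1 : ∀ y, η y * (waveSeries s i χ α ε θ N y * waveSeries s i χ β ε θ N y) =
        ∑ n ∈ Finset.range N, ∑ m ∈ Finset.range N,
          ε n * ε m * (dy n ^ α * dy m ^ β) * (η y * (u n y * u m y)) := fun y => by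
      simp only [waveSeries]
      rw [Finset.sum_mul_sum]
      simp only [Finset.mul_sum]
      refine Finset.sum_congr rfl fun n _ => Finset.sum_congr rfl fun m _ => ?_
      ring
    simp only [h1]
    rw [integral_finsetSum _ fun n _ => integrable_finsetSum _ fun m _ => (hi n m).const_mul _]
    refine Finset.sum_congr rfl fun n _ => ?_
    rw [integral_finsetSum _ fun m _ => (hi n m).const_mul _]
    refine Finset.sum_congr rfl fun m _ => ?_
    rw [integral_const_mul]
    ring

end Resonance

end

/-! ### Necessity of a positive sum of exponents -/

section

section Elementary

variable {d : ℕ} {𝕂 : Type*} [RCLike 𝕂] {s : Fin d → ℝ} {V : Type*} [AddCommGroup V] [Module 𝕂 V]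
  [TopologicalSpace V] [IsTopologicalAddGroup V] [ContinuousSMul 𝕂 V]

theorem isCk_ofReal_smul (a : V) (n : ℕ) : ∀ {c : EuclideanSpace ℝ (Fin d) → ℝ},
    ContDiff ℝ ∞ c → IsCk 𝕂 n fun x => ((c x : ℝ) : 𝕂) • a := by
  have hcont : ∀ {c : EuclideanSpace ℝ (Fin d) → ℝ}, ContDiff ℝ ∞ c →
      Continuous fun x => ((c x : ℝ) : 𝕂) • a := fun hc =>
    (RCLike.continuous_ofReal.comp hc.continuous).smul continuous_const
  induction n with
  | zero => exact hcont
  | succ n ih =>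
    intro c hc
    refine ⟨hcont hc, fun i x => ((dirDeriv (EuclideanSpace.single i 1) c x : ℝ) : 𝕂) • a,
      fun i x => ?_, fun i => ih (contDiff_dirDeriv hc _)⟩
    have h := ((hc.differentiable (by simp) x).hasFDerivAt.hasLineDerivAt
      (EuclideanSpace.single i 1)).tendsto_slope_zero
    refine (((RCLike.continuous_ofReal.tendsto _).comp h).smul_const a).congr fun t => ?_
    simp only [Function.comp_apply, smul_eq_mul, RCLike.ofReal_mul, RCLike.ofReal_sub, mul_smul,
      sub_smul]

variable {ι : Type*} {P : SeminormFamily 𝕂 V ι}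

theorem holderBd_ofReal_mul {α R C : ℝ} {r : ℕ} {c : EuclideanSpace ℝ (Fin d) → ℝ}
    (h : HolderBd s α r c R C) {M : ℝ} {b : 𝕂} (hb : ‖b‖ ≤ M) :
    HolderBd s α r (fun y => ((c y : ℝ) : 𝕂) * b) R (C * M) := by
  have key : ∀ (η : EuclideanSpace ℝ (Fin d) → ℝ) l x,
      avg s η l (fun y => ((c y : ℝ) : 𝕂) * b) x = avg s η l c x • b := fun η l x => by
    simp only [avg, ← RCLike.real_smul_eq_coe_mul, ← smul_assoc, integral_smul_const]
  refine ⟨fun x hx η hη hη1 hv l hl hl1 => ?_, fun x hx η hη hη1 => ?_⟩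
  · rw [key, norm_smul, mul_right_comm]
    exact mul_le_mul (h.1 x hx η hη hη1 hv l hl hl1) hb (norm_nonneg _)
      ((norm_nonneg _).trans (h.1 x hx η hη hη1 hv l hl hl1))
  · rw [key, norm_smul]
    exact mul_le_mul (h.2 x hx η hη hη1) hb (norm_nonneg _)
      ((norm_nonneg _).trans (h.2 x hx η hη hη1))

/-- A real test function with Hölder bounds, times a fixed vector, is an element of the Hölder
space, with control of its seminorms. -/
theorem exists_holderSpace_of_holderBd (hP : WithSeminorms P) {α C : ℝ} (hC : 0 ≤ C)
    {c : EuclideanSpace ℝ (Fin d) → ℝ} (hc : ContDiff ℝ ∞ c) (hcs : HasCompactSupport c)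
    (h : ∀ R, HolderBd s α (testOrder α) c R C) (a : V) :
    ∃ ξ : HolderSpace s α P, IsTest 𝕂 (fun x => ((c x : ℝ) : 𝕂) • a) ∧
      IsGivenBy (HolderSpace.toDist ξ) (fun x => ((c x : ℝ) : 𝕂) • a) ∧
      ∀ Ki, holderSeminorms s α P Ki ξ ≤ 4 * C * P Ki.2 a := by
  have hcc : Continuous fun y => ((c y : ℝ) : 𝕂) := RCLike.continuous_ofReal.comp hc.continuous
  have htest : IsTest 𝕂 fun x => ((c x : ℝ) : 𝕂) • a :=
    ⟨fun n => isCk_ofReal_smul a n hc, (hcs.comp_left RCLike.ofReal_zero).smul_right⟩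
  let S : VDist d 𝕂 𝕂 := TestFunction.integralAgainstBilinCLM (ContinuousLinearMap.mul 𝕂 𝕂)
    volume fun y => ((c y : ℝ) : 𝕂)
  let T : VDist d 𝕂 V := S.smulRight a
  have hT : ∀ φ, T φ = (∫ y, φ y * ((c y : ℝ) : 𝕂)) • a := fun φ => by
    change S φ • a = _
    rw [TestFunction.integralAgainstBilinCLM_eq_integral
      (hcc.locallyIntegrable.locallyIntegrableOn _)]
    rfl
  have hgiven : IsGivenBy T fun x => ((c x : ℝ) : 𝕂) • a := ⟨(htest.1 0), fun φ ℓ => by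
    simp only [hT, map_smul, smul_eq_mul, ← mul_assoc]
    rw [integral_mul_const]⟩
  have hbd : ∀ (K : Compacts (EuclideanSpace ℝ (Fin d))) i,
      holderNorm s α (P i) K T ≤ ENNReal.ofReal (2 * (2 * (C * P i a))) := fun K i => by
    obtain ⟨R, hR⟩ := K.isCompact.isBounded.subset_closedBall 0
    have hx : ∀ x ∈ K, ‖x‖ ≤ R := fun x hx => mem_closedBall_zero_iff.1 (hR hx)
    have hℓ : ∀ ℓ : V →L[𝕂] 𝕂, (∀ b, ‖ℓ b‖ ≤ P i b) →
        HolderBd s α (testOrder α) (fun y => ℓ (((c y : ℝ) : 𝕂) • a)) R (C * P i a) :=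
      fun ℓ hb => by
        simp only [map_smul, smul_eq_mul]
        exact holderBd_ofReal_mul (h R) (hb a)
    have h0 : 0 ≤ P i a := apply_nonneg _ _
    exact holderNorm_le (by positivity)
      (fun x hxK η hη l => seminorm_le_of_holderBd hP i hgiven.1 hℓ (hx x hxK) hη l (hgiven.2 _))
      fun x hxK η hη => seminorm_le_of_holderBd_one hP i hgiven.1 hℓ (hx x hxK) hη (hgiven.2 _)
  let ξ₀ : BoundedHolder s α P := ⟨T, fun K i => (hbd K i).trans_lt ENNReal.ofReal_lt_top⟩
  have hξ₀ : ξ₀ ∈ testSubmodule s α P := ⟨_, htest, hgiven⟩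
  refine ⟨⟨ξ₀, subset_closure hξ₀⟩, htest, hgiven, fun Ki => ?_⟩
  have h0 : 0 ≤ P Ki.2 a := apply_nonneg _ _
  have h1 := ENNReal.toReal_mono ENNReal.ofReal_ne_top (hbd Ki.1 Ki.2)
  rw [ENNReal.toReal_ofReal (by positivity)] at h1
  exact h1.trans_eq (by ring)

theorem tendsto_inv_smul_of_seminorms_le {α : ℝ} (ξ : ℕ → HolderSpace s α P)
    {M : Compacts (EuclideanSpace ℝ (Fin d)) × ι → ℝ}
    (h : ∀ n Ki, holderSeminorms s α P Ki (ξ n) ≤ M Ki) :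
    Tendsto (fun n : ℕ => (((n : 𝕂) + 1)⁻¹) • ξ n) atTop (𝓝 0) := by
  rw [tendsto_subtype_rng, (withSeminorms_holder s α P).tendsto_nhds]
  intro Ki ε hε
  have h1 : Tendsto (fun n : ℕ => 1 / ((n : ℝ) + 1) * M Ki) atTop (𝓝 0) := by
    simpa using tendsto_one_div_add_atTop_nhds_zero_nat.mul_const (M Ki)
  filter_upwards [h1.eventually (gt_mem_nhds hε)] with n hn
  refine lt_of_le_of_lt ?_ hn
  rw [Submodule.coe_zero, sub_zero, Submodule.coe_smul, map_smul_eq_mul, norm_inv, one_div]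
  have h2 : ‖(n : 𝕂) + 1‖ = (n : ℝ) + 1 := by
    rw [← Nat.cast_succ, RCLike.norm_natCast, Nat.cast_succ]
  rw [h2]
  gcongr
  exact h n Ki

end Elementary

section Necessity

variable {d : ℕ} {𝕂 : Type*} [RCLike 𝕂] {s : Fin d → ℝ} {A : Type*} [NonUnitalRing A]
  [Module 𝕂 A] [IsScalarTower 𝕂 A A] [SMulCommClass 𝕂 A A] [TopologicalSpace A]
  [IsTopologicalAddGroup A] [ContinuousSMul 𝕂 A] {ι : Type*} {P : SeminormFamily 𝕂 A ι}
  {α β γ : ℝ}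

/-- Testing against a normalised bump at scale one bounds the Hölder seminorm of a product from
below. -/
theorem integral_mul_seminorm_le_ballSeminorm (hP : WithSeminorms P) (hs : ∀ i, 1 ≤ s i) (i : ι)
    {η : EuclideanSpace ℝ (Fin d) → ℝ} (hη : IsBump s η)
    (hη1 : ∀ j ≤ testOrder γ, ∀ y, ‖iteratedFDeriv ℝ j η y‖ ≤ 1) {a b : A}
    {c c' : EuclideanSpace ℝ (Fin d) → ℝ} {ξ : HolderSpace s γ P}
    (hξ : IsGivenBy (HolderSpace.toDist ξ)
      fun x => (((c x : ℝ) : 𝕂) • a) * (((c' x : ℝ) : 𝕂) • b)) :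
    (∫ y, η y * (c y * c' y)) * P i (a * b) ≤ ballSeminorm s γ P 0 i ξ := by
  obtain ⟨ℓ, hℓ, hℓab⟩ := exists_dual_eq_seminorm hP i (a * b)
  have h1 := apply_rescale_one_le_of_holderNorm_le (holderNorm_ball (s := s) (α := γ) 0 i ξ).le
    (apply_nonneg _ _) (x := 0) (mem_ballCompacts.2 (by simp)) (hη.toTest_mem_testBall hs hη1)
  refine le_trans ?_ ((hℓ _).trans h1)
  rw [hξ.2]
  have h2 := integral_toTest_smul (𝕂 := 𝕂) hη hs ⟨1, by norm_num⟩ 0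
    (fun x => ℓ ((((c x : ℝ) : 𝕂) • a) * (((c' x : ℝ) : 𝕂) • b)))
  have h3 : ∀ y, η y • ℓ ((((c y : ℝ) : 𝕂) • a) * (((c' y : ℝ) : 𝕂) • b)) =
      (η y * (c y * c' y)) • ℓ (a * b) := fun y => by
    rw [smul_mul_smul_comm, map_smul, ← RCLike.ofReal_mul, ← RCLike.real_smul_eq_coe_smul, smul_smul]
  simp only [smul_eq_mul] at h2
  rw [h2]
  simp only [avg, dil_one, zero_add, h3]
  rw [integral_smul_const, norm_smul, hℓab]
  exact mul_le_mul_of_nonneg_right (le_abs_self _) (apply_nonneg _ _)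

/-- If `α + β ≤ 0` and the multiplication is not identically zero, the multiplication of test
functions has no continuous extension to the Hölder spaces. -/
theorem pos_of_continuous_extendsTestMul [T1Space A] (hP : WithSeminorms P)
    (hne : ∃ a b : A, a * b ≠ 0) (hd : 0 < d) (hs : ∀ i, 1 ≤ s i)
    (B : HolderSpace s α P →ₗ[𝕂] HolderSpace s β P →ₗ[𝕂] HolderSpace s γ P)
    (hB : Continuous fun z : HolderSpace s α P × HolderSpace s β P => B z.1 z.2)
    (hE : ExtendsTestMul B) : 0 < α + β := by
  by_contra! hab
  obtain ⟨a, b, hne⟩ := hne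
  obtain ⟨i, hi⟩ := hP.separating_of_T1 (a * b) hne
  have hp : 0 < P i (a * b) := (apply_nonneg _ _).lt_of_ne' hi
  let k : Fin d := ⟨0, hd⟩
  -- a nonnegative bump, normalised to be admissible as a test function
  obtain ⟨ψ, hψ, hψ0, -, hψ1⟩ := exists_isBump_nonneg hs
  obtain ⟨D, hD, hDψ⟩ := exists_bound_iteratedFDeriv hψ.smooth (hψ.hasCompactSupport hs) (testOrder γ)
  have hη := hψ.const_mul (D + 1)⁻¹
  set η : EuclideanSpace ℝ (Fin d) → ℝ := fun y => (D + 1)⁻¹ * ψ y with hηdef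
  have hη1 : ∀ j ≤ testOrder γ, ∀ y, ‖iteratedFDeriv ℝ j η y‖ ≤ 1 := fun j hj y => by
    change ‖iteratedFDeriv ℝ j ((D + 1)⁻¹ • ψ) y‖ ≤ 1
    rw [iteratedFDeriv_const_smul_apply (hψ.smooth.contDiffAt.of_le (by exact_mod_cast le_top)),
      norm_smul, norm_inv, Real.norm_of_nonneg (by positivity)]
    exact inv_mul_le_one_of_le₀ ((hDψ j hj y).trans (by linarith)) (by positivity)
  have hη0 : ∀ y, 0 ≤ η y := fun y => mul_nonneg (by positivity) (hψ0 y)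
  have hηi : ∫ y, η y = (D + 1)⁻¹ := by rw [integral_const_mul, hψ1, mul_one]
  -- a cutoff that equals one on the support of all bumps
  let χ : ContDiffBump (0 : EuclideanSpace ℝ (Fin d)) :=
    ⟨d + 1, d + 2, by positivity, by linarith⟩
  have hχ : ContDiff ℝ ∞ χ := χ.contDiff
  have hχc : HasCompactSupport χ := χ.hasCompactSupport
  have hχη : ∀ y, η y ≠ 0 → χ y = 1 := fun y hy => by
    refine χ.one_of_mem_closedBall (mem_closedBall_zero_iff.2 ?_)
    by_contra! h
    exact hy (hη.eq_zero hs (lt_trans (by change (d : ℝ) < d + 1; linarith) h))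
  obtain ⟨C, hC, hCb⟩ := exists_holderBd_waveSeries hs k hχ hχc α
  obtain ⟨C', hC', hCb'⟩ := exists_holderBd_waveSeries hs k hχ hχc β
  obtain ⟨θ, hθ⟩ := exists_waveSeries_resonance (s := s) k hχ hη.smooth.continuous
    (hη.hasCompactSupport hs) hη0 hχη hab
  choose ε hε hres using hθ
  choose ξ hξt hξg hξb using fun N : ℕ => exists_holderSpace_of_holderBd hP hC
    (contDiff_waveSeries hχ k α (ε N) θ N) (hasCompactSupport_waveSeries hχc k α (ε N) θ N)
    (hCb (ε N) θ (hε N) N) a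
  choose ζ hζt hζg hζb using fun N : ℕ => exists_holderSpace_of_holderBd hP hC'
    (contDiff_waveSeries hχ k β (ε N) θ N) (hasCompactSupport_waveSeries hχc k β (ε N) θ N)
    (hCb' (ε N) θ (hε N) N) b
  have hlow : ∀ N : ℕ, N * ((D + 1)⁻¹ / 2) * P i (a * b) ≤
      ballSeminorm s γ P 0 i (B (ξ N) (ζ N)) := fun N => by
    have h := hres N
    rw [hηi] at h
    exact (mul_le_mul_of_nonneg_right h hp.le).trans (integral_mul_seminorm_le_ballSeminorm hP hs i
      hη hη1 (hE _ _ _ _ (hξt N) (hζt N) (hξg N) (hζg N)))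
  -- the factors tend to zero after division by `n + 1`, the product of the `(n + 1) ^ 2`-th
  -- partial sums does not
  have hu := tendsto_inv_smul_of_seminorms_le (fun n => ξ ((n + 1) ^ 2)) fun n => hξb _
  have hv := tendsto_inv_smul_of_seminorms_le (fun n => ζ ((n + 1) ^ 2)) fun n => hζb _
  have hlim := ((continuous_ballSeminorm (s := s) (α := γ) (P := P) 0 i).comp hB).tendsto (0, 0)
    |>.comp (hu.prodMk_nhds hv)
  simp only [Function.comp_apply, map_zero] at hlim
  have hle : (D + 1)⁻¹ / 2 * P i (a * b) ≤ 0 := by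
    refine ge_of_tendsto hlim (Eventually.of_forall fun n => ?_)
    have h1 := hlow ((n + 1) ^ 2)
    have h2 : ‖(n : 𝕂) + 1‖ = (n : ℝ) + 1 := by
      rw [← Nat.cast_succ, RCLike.norm_natCast, Nat.cast_succ]
    simp only [Function.comp_apply, map_smul, LinearMap.smul_apply, map_smul_eq_mul, norm_inv, h2]
    rw [← mul_assoc, ← mul_inv, ← sq, le_inv_mul_iff₀ (by positivity), ← mul_assoc]
    exact_mod_cast h1
  have : 0 < (D + 1)⁻¹ / 2 * P i (a * b) := by positivity
  linarith

end Necessity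

end

end VecHolder

end

theorem mainTheorem12 {𝕂 : Type*} [RCLike 𝕂]
    {A : Type*} [NonUnitalRing A] [Module 𝕂 A] [IsScalarTower 𝕂 A A] [SMulCommClass 𝕂 A A]
    [UniformSpace A] [IsUniformAddGroup A] [ContinuousSMul 𝕂 A] [T2Space A] [CompleteSpace A]
    {ι : Type*} (P : SeminormFamily 𝕂 A ι) (hP : WithSeminorms P)
    (hmul : ∀ (i : ι) (a b : A), P i (a * b) ≤ P i a * P i b)
    (hne : ∃ a b : A, a * b ≠ 0)
    {d : ℕ} (hd : 0 < d) (s : Fin d → ℝ) (hs : ∀ i, 1 ≤ s i) (α β : ℝ) :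
    ((∃ B : HolderSpace s α P →ₗ[𝕂] HolderSpace s β P →ₗ[𝕂] HolderSpace s (min α β) P,
        Continuous (fun z : HolderSpace s α P × HolderSpace s β P => B z.1 z.2) ∧
        ExtendsMul B) ↔ 0 < α + β) ∧
    ((∃ B : HolderSpace s α P →ₗ[𝕂] HolderSpace s β P →ₗ[𝕂] HolderSpace s (min α β) P,
        Continuous (fun z : HolderSpace s α P × HolderSpace s β P => B z.1 z.2) ∧
        ExtendsTestMul B) ↔ 0 < α + β) := by
  refine ⟨⟨fun ⟨B, hB, hE⟩ => ?_, exists_young_mul hP hmul hs⟩,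
    ⟨fun ⟨B, hB, hE⟩ => pos_of_continuous_extendsTestMul hP hne hd hs B hB hE, fun hpos => ?_⟩⟩
  · exact pos_of_continuous_extendsTestMul hP hne hd hs B hB fun ξ ζ f g _ _ => hE ξ ζ f g
  · obtain ⟨B, hB, hE⟩ := exists_young_mul hP hmul hs hpos
    exact ⟨B, hB, fun ξ ζ f g _ _ => hE ξ ζ f g⟩
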